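/- **Conventions.** A polygon is a two-dimensional convex polygon in $\mathbb R^2$ with vertices in $\mathbb Z^2$. It is *$h$-transverse* if each of its edges has an outward normal vector $(0,\pm1)$ or $(\pm1,k)$ with $k\in\mathbb Z$. For such $\Delta$ let $a(\Delta)$ be its height (maximal minus minimal ordinate), $e^{+\infty}(\Delta)$ and $e^{-\infty}(\Delta)$ the lengths of its top and bottom horizontal edges (possibly $0$), $y(\Delta)=|\partial\Delta\cap\mathbb Z^2|$, and $s_{\max}(\Delta,g)=\lfloor (y(\Delta)-1+g)/2\rfloor$. Let $b_{\rm left}(\Delta)$ (resp. $b_{\rm right}(\Delta)$) be the unordered list of integers in which $k$ appears as many times as the integral length of the side with outward normal $(-1,k)$ (resp. $(1,k)$). **Floor diagrams.** A floor diagram with Newton polygon $\Delta$ and genus $g$ is a finite connected acyclic oriented graph $\Gamma$ of first Betti number $g$, with edge weights $w\ge 1$, with $a(\Delta)$ vertices, whose edges are bounded (adjacent to two vertices) or infinite (adjacent to one vertex), with $e^{-\infty}(\Delta)$ infinite edges entering their vertex and $e^{+\infty}(\Delta)$ infinite edges leaving their vertex, all of weight $1$, together with bijections $L:V(\Gamma)\to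 b_{\rm left}(\Delta)$ and $R:V(\Gamma)\to b_{\rm right}(\Delta)$ (each integer is taken as a value as often as it appears in the list) such that at each vertex $v$ the sum of the entering weights minus the sum of the leaving weights is $L(v)+R(v)$. It has $y(\Delta)-1+g$ elements (vertices and edges), partially ordered by oriented paths. A *marking* is an increasing bijection $m$ from the set of elements to $\{1,\dots,y(\Delta)-1+g\}$. Marked diagrams are taken up to isomorphisms preserving orientation, $w$, $L$, $R$ and $m$. **Multiplicities.** A pairing of order $s$ of $\{1,\dots,n\}$ is a set of $s$ disjoint pairs $\{i,i+1\}\subset\{1,\dots,n\}$. A marking $m$ is compatible with a pairing $S$ if for each $\alpha\in S$ the set $m^{-1}(\alpha)$ consists either of an edge and an adjacent vertex, or of two edges both entering or both leaving the same vertex. Put $[n](q)=\frac{q^{n/2}-q^{-n/2}}{q^{1/2}-q^{-1/2}}$. If $m$ and $S$ are compatible, $\mu_S(\mathcal D,m)$ is the product of $[w(e)](q)^2$ over the edges $e$ in no pair of $S$, of $[w(e)](q^2)$ over the edges $e$ paired with a vertex, and of $[w(e)][w(e')][w(e)+w(e')]/[2]$ (at $q$) over the pairs of edges $\{e,e'\}$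 paired together; otherwise $\mu_S(\mathcal D,m)=0$. For a pairing $S$ of order $s$ of $\{1,\dots,y(\Delta)-1+g\}$, let $G_g(\Delta,s)=G_g(\Delta,S)=\sum_{(\mathcal D,m)}\mu_S(\mathcal D,m)$, the sum running over the isomorphism classes of marked floor diagrams with Newton polygon $\Delta$ and genus $g$. **Proposition 3.7.** Let $\Delta$ be an $h$-transverse polygon whose top is a single vertex $p$, at which sides with outward normals $(-1,k)$ and $(1,1-k)$ meet for some $k\in\mathbb Z$, both of integral length at least $2$. Let $\tilde\Delta$ be the polygon obtained from $\Delta$ by cutting off the top corner, i.e. by removing the part of $\Delta$ strictly above the horizontal segment joining the two points of these sides at integral distance $2$ from $p$ (if $\Delta$ has height $2$, then $\tilde\Delta$ is a segment and $G_g(\tilde\Delta,s)=0$). Let $g,s\in\mathbb N$ with $s+1\le s_{\max}(\Delta,g)$. Then, whatever pairings of orders $s+1$, $s$ and $s$ are used to compute the three terms, $$G_g(\Delta,s+1)=G_g(\Delta,s)-2\,G_g(\tilde\Delta,s).$$ -/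

import Mathlib

noncomputable section

namespace FloorDiagrams

/-! ### Lattice polygons -/

/-- The lattice `ℤ²` inside `ℝ²`. -/
def lattice : Set (ℝ × ℝ) :=
  Set.range fun z : ℤ × ℤ => ((z.1 : ℝ), (z.2 : ℝ))

/-- A convex polygon in `ℝ²` with vertices in `ℤ²`. -/
def IsLatticePolygon (Δ : Set (ℝ × ℝ)) : Prop :=
  (∃ T : Set (ℝ × ℝ), T.Finite ∧ T ⊆ lattice ∧ Δ = convexHull ℝ T) ∧ (interior Δ).Nonempty

/-- The face of `Δ` with outward normal vector `ν`: the points of `Δ` at which the linear form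
`⟨ν, ·⟩` is maximal on `Δ`. It is an edge of `Δ` if it has more than one point. -/
def face (Δ : Set (ℝ × ℝ)) (ν : ℝ × ℝ) : Set (ℝ × ℝ) :=
  {x ∈ Δ | ∀ y ∈ Δ, ν.1 * y.1 + ν.2 * y.2 ≤ ν.1 * x.1 + ν.2 * x.2}

/-- An `h`-transverse polygon: every edge has an outward normal vector of the form `(0, ±1)` or
`(±1, k)` with `k ∈ ℤ`. -/
def IsHTransverse (Δ : Set (ℝ × ℝ)) : Prop :=
  IsLatticePolygon Δ ∧
    ∀ ν : ℝ × ℝ, ν ≠ 0 → (face Δ ν).Nontrivial →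
      ∃ c : ℝ, 0 < c ∧
        (ν = c • ((0, 1) : ℝ × ℝ) ∨ ν = c • ((0, -1) : ℝ × ℝ) ∨
          ∃ k : ℤ, ν = c • ((1, (k : ℝ)) : ℝ × ℝ) ∨ ν = c • ((-1, (k : ℝ)) : ℝ × ℝ))

/-- The height `a(Δ)`: the difference between the maximal and the minimal ordinate. -/
def height (Δ : Set (ℝ × ℝ)) : ℝ :=
  sSup (Prod.snd '' Δ) - sInf (Prod.snd '' Δ)

/-- The integral length of the side of `Δ` with outward normal vector `ν`: the number of lattice
points on it minus one. It is `0` if that face is a vertex. -/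
def sideLength (Δ : Set (ℝ × ℝ)) (ν : ℝ × ℝ) : ℕ :=
  (face Δ ν ∩ lattice).ncard - 1

/-- The length `e^{+∞}(Δ)` of the top horizontal edge. -/
def ePlus (Δ : Set (ℝ × ℝ)) : ℕ := sideLength Δ (0, 1)

/-- The length `e^{-∞}(Δ)` of the bottom horizontal edge. -/
def eMinus (Δ : Set (ℝ × ℝ)) : ℕ := sideLength Δ (0, -1)

/-- The multiplicity of `k` in the list `b_left(Δ)`. -/
def bLeft (Δ : Set (ℝ × ℝ)) (k : ℤ) : ℕ := sideLength Δ (-1, (k : ℝ))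

/-- The multiplicity of `k` in the list `b_right(Δ)`. -/
def bRight (Δ : Set (ℝ × ℝ)) (k : ℤ) : ℕ := sideLength Δ (1, (k : ℝ))

/-- The number `y(Δ)` of lattice points on the boundary of `Δ`. -/
def boundaryPoints (Δ : Set (ℝ × ℝ)) : ℕ := (frontier Δ ∩ lattice).ncard

/-- `y(Δ) - 1 + g`, the number of elements of a floor diagram with Newton polygon `Δ` and
genus `g`. -/
def numElements (Δ : Set (ℝ × ℝ)) (g : ℕ) : ℕ := boundaryPoints Δ - 1 + g

/-- `s_max(Δ, g) = ⌊(y(Δ) - 1 + g) / 2⌋`. -/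
def sMax (Δ : Set (ℝ × ℝ)) (g : ℕ) : ℕ := numElements Δ g / 2

/-- The top of `Δ` is the single lattice vertex `p`, at which the two sides with outward normal
vectors `(-1, k)` and `(1, 1 - k)` meet (so that their primitive directions `(-k, -1)` and
`(1 - k, -1)` form a basis of `ℤ²`), and both of these sides have integral length at least `2`. -/
def HasTopCorner (Δ : Set (ℝ × ℝ)) (p : ℤ × ℤ) (k : ℤ) : Prop :=
  ((p.1 : ℝ), (p.2 : ℝ)) ∈ face Δ (-1, (k : ℝ)) ∧
  ((p.1 : ℝ) - 2 * k, (p.2 : ℝ) - 2) ∈ face Δ (-1, (k : ℝ)) ∧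
  ((p.1 : ℝ), (p.2 : ℝ)) ∈ face Δ (1, 1 - (k : ℝ)) ∧
  ((p.1 : ℝ) + 2 * (1 - k), (p.2 : ℝ) - 2) ∈ face Δ (1, 1 - (k : ℝ))

/-- The polygon obtained from `Δ` by cutting off the top corner `p`, that is, the part of `Δ` above
the horizontal segment that joins the two points at integral distance `2` from `p` on the two
sides through `p`. -/
def cutTopCorner (Δ : Set (ℝ × ℝ)) (p : ℤ × ℤ) : Set (ℝ × ℝ) :=
  {x ∈ Δ | x.2 ≤ (p.2 : ℝ) - 2}

/-! ### Oriented graphs -/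

/-- A finite oriented graph. `src e` is the vertex that the edge `e` leaves and `tgt e` the one that
it enters. A source has `src e = none`, a sink has `tgt e = none`, and every edge is adjacent to
at least one vertex. -/
structure OrientedGraph where
  V : Type
  E : Type
  fintypeV : Fintype V
  fintypeE : Fintype E
  src : E → Option V
  tgt : E → Option V
  adjacent_vertex : ∀ e, src e ≠ none ∨ tgt e ≠ none

attribute [instance] OrientedGraph.fintypeV OrientedGraph.fintypeE

namespace OrientedGraph

/-- The underlying simple graph on the vertices, given by the bounded edges. -/
def underlying (Γ : OrientedGraph) : SimpleGraph Γ.V :=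
  SimpleGraph.fromRel fun u v => ∃ e, Γ.src e = some u ∧ Γ.tgt e = some v

/-- The vertices and edges of the graph. -/
abbrev Element (Γ : OrientedGraph) : Type := Γ.V ⊕ Γ.E

/-- One step along the orientation: from a vertex to an edge leaving it, or from an edge to the
vertex it enters. -/
inductive Step (Γ : OrientedGraph) : Γ.Element → Γ.Element → Prop
  | leave (v : Γ.V) (e : Γ.E) (h : Γ.src e = some v) : Step Γ (Sum.inl v) (Sum.inr e)
  | enter (e : Γ.E) (v : Γ.V) (h : Γ.tgt e = some v) : Step Γ (Sum.inr e) (Sum.inl v)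

/-- `α ≺ β`: there is an oriented path from `α` to `β`. -/
def Prec (Γ : OrientedGraph) : Γ.Element → Γ.Element → Prop :=
  Relation.TransGen Γ.Step

/-- There is no oriented cycle. -/
def Acyclic (Γ : OrientedGraph) : Prop := ∀ α, ¬ Γ.Prec α α

open Classical in
/-- The bounded edges. -/
def boundedEdges (Γ : OrientedGraph) : Finset Γ.E :=
  Finset.univ.filter fun e => Γ.src e ≠ none ∧ Γ.tgt e ≠ none

open Classical in
/-- The infinite edges oriented toward their vertex. -/
def sources (Γ : OrientedGraph) : Finset Γ.E :=
  Finset.univ.filter fun e => Γ.src e = none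

open Classical in
/-- The infinite edges oriented from their vertex. -/
def sinks (Γ : OrientedGraph) : Finset Γ.E :=
  Finset.univ.filter fun e => Γ.tgt e = none

/-- The first Betti number: bounded edges minus vertices plus connected components (infinite edges
are contractible). -/
def genus (Γ : OrientedGraph) : ℤ :=
  (Γ.boundedEdges.card : ℤ) - Fintype.card Γ.V + Nat.card Γ.underlying.ConnectedComponent

open Classical in
/-- The divergence of a vertex: entering weights minus leaving weights. -/
def divergence (Γ : OrientedGraph) (w : Γ.E → ℕ) (v : Γ.V) : ℤ :=
  (∑ e ∈ Finset.univ.filter (fun e => Γ.tgt e = some v), (w e : ℤ)) -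
    ∑ e ∈ Finset.univ.filter (fun e => Γ.src e = some v), (w e : ℤ)

/-- The edge `e` is adjacent to the vertex `v`. -/
def Adjacent (Γ : OrientedGraph) (e : Γ.E) (v : Γ.V) : Prop :=
  Γ.src e = some v ∨ Γ.tgt e = some v

end OrientedGraph

/-! ### Floor diagrams -/

open Classical in
/-- A floor diagram with Newton polygon `Δ` and genus `g`. The maps `L` and `R` are bijections onto
the unordered lists `b_left(Δ)` and `b_right(Δ)`, that is, every integer is taken as many times as it
occurs in the list. -/
structure FloorDiagram (Δ : Set (ℝ × ℝ)) (g : ℕ) extends OrientedGraph where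
  w : E → ℕ
  L : V → ℤ
  R : V → ℤ
  w_pos : ∀ e, 0 < w e
  connected : toOrientedGraph.underlying.Connected
  acyclic : toOrientedGraph.Acyclic
  genus_eq : toOrientedGraph.genus = g
  card_V : (Fintype.card V : ℝ) = height Δ
  card_sinks : toOrientedGraph.sinks.card = ePlus Δ
  card_sources : toOrientedGraph.sources.card = eMinus Δ
  w_infinite : ∀ e, src e = none ∨ tgt e = none → w e = 1
  L_bij : ∀ k, (Finset.univ.filter fun v => L v = k).card = bLeft Δ k
  R_bij : ∀ k, (Finset.univ.filter fun v => R v = k).card = bRight Δ k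
  div_eq : ∀ v, toOrientedGraph.divergence w v = L v + R v

/-- A floor diagram with an increasing bijection `m` from its elements to `{1, …, n}`. -/
structure MarkedFloorDiagram (Δ : Set (ℝ × ℝ)) (g : ℕ) extends FloorDiagram Δ g where
  m : V ⊕ E → ℕ
  m_bij : Set.BijOn m Set.univ (Set.Icc 1 (Fintype.card V + Fintype.card E))
  m_increasing : ∀ α β, toOrientedGraph.Prec α β → m α < m β

/-- A pairing of order `s` of `{1, …, n}`: a set of `s` disjoint pairs `{i, i + 1} ⊆ {1, …, n}`. -/
def IsPairing (n s : ℕ) (S : Finset (Finset ℕ)) : Prop :=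
  S.card = s ∧ (∀ α ∈ S, ∃ i, 1 ≤ i ∧ i + 1 ≤ n ∧ α = {i, i + 1}) ∧
    (S : Set (Finset ℕ)).PairwiseDisjoint id

/-- For `t = q^{1/2}`, the quantum integer `[n](q)`. -/
def quantumInt {K : Type*} [Field K] (t : K) (n : ℤ) : K :=
  (t ^ n - t ^ (-n)) / (t - t⁻¹)

/-- The field `ℚ(q^{1/2})`, which contains `ℤ[q^{±1/2}]`. Its generator `RatFunc.X` is
`q^{1/2}`. -/
abbrev QField : Type := RatFunc ℚ

/-- `[n] = [n](q)`. -/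
def qInt (n : ℤ) : QField := quantumInt RatFunc.X n

/-- `[n]_2 = [n](q²)`. -/
def qIntTwo (n : ℤ) : QField := quantumInt (RatFunc.X ^ 2) n

namespace MarkedFloorDiagram

variable {Δ : Set (ℝ × ℝ)} {g : ℕ}

/-- Isomorphism of marked floor diagrams. -/
def Iso (D D' : MarkedFloorDiagram Δ g) : Prop :=
  ∃ (φV : D.V ≃ D'.V) (φE : D.E ≃ D'.E),
    (∀ e, D'.src (φE e) = (D.src e).map φV) ∧
    (∀ e, D'.tgt (φE e) = (D.tgt e).map φV) ∧
    (∀ e, D'.w (φE e) = D.w e) ∧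
    (∀ v, D'.L (φV v) = D.L v) ∧
    (∀ v, D'.R (φV v) = D.R v) ∧
    (∀ v, D'.m (Sum.inl (φV v)) = D.m (Sum.inl v)) ∧
    (∀ e, D'.m (Sum.inr (φE e)) = D.m (Sum.inr e))

theorem iso_refl (D : MarkedFloorDiagram Δ g) : Iso D D :=
  ⟨Equiv.refl _, Equiv.refl _, by simp⟩

theorem iso_symm {D D' : MarkedFloorDiagram Δ g} (h : Iso D D') : Iso D' D := by
  obtain ⟨φV, φE, h1, h2, h3, h4, h5, h6, h7⟩ := h
  refine ⟨φV.symm, φE.symm, ?_, ?_, ?_, ?_, ?_, ?_, ?_⟩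
  · intro e
    have := h1 (φE.symm e)
    rw [Equiv.apply_symm_apply] at this
    simp [this, Option.map_map]
  · intro e
    have := h2 (φE.symm e)
    rw [Equiv.apply_symm_apply] at this
    simp [this, Option.map_map]
  · intro e; simp [← h3]
  · intro e; simp [← h4]
  · intro e; simp [← h5]
  · intro e; simp [← h6]
  · intro e; simp [← h7]

theorem iso_trans {D D' D'' : MarkedFloorDiagram Δ g} (h : Iso D D') (h' : Iso D' D'') :
    Iso D D'' := by
  obtain ⟨φV, φE, h1, h2, h3, h4, h5, h6, h7⟩ := h
  obtain ⟨ψV, ψE, k1, k2, k3, k4, k5, k6, k7⟩ := h'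
  exact ⟨φV.trans ψV, φE.trans ψE, by simp [*], by simp [*], by simp [*], by simp [*],
    by simp [*], by simp [*], by simp [*]⟩

/-- The isomorphism relation on marked floor diagrams. -/
def isoSetoid (Δ : Set (ℝ × ℝ)) (g : ℕ) : Setoid (MarkedFloorDiagram Δ g) :=
  ⟨Iso, iso_refl, iso_symm, iso_trans⟩

/-- The set `m⁻¹(α)` of elements whose mark lies in `α`. -/
def marked (D : MarkedFloorDiagram Δ g) (α : Finset ℕ) : Set (D.V ⊕ D.E) :=
  {x | D.m x ∈ α}

/-- The marking is compatible with `S`: for every `α ∈ S` the set `m⁻¹(α)` consists of an edge and an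
adjacent vertex, or of two edges that both enter or both leave the same vertex. -/
def Compatible (D : MarkedFloorDiagram Δ g) (S : Finset (Finset ℕ)) : Prop :=
  ∀ α ∈ S,
    (∃ e v, D.marked α = {Sum.inr e, Sum.inl v} ∧ D.toOrientedGraph.Adjacent e v) ∨
    (∃ e e', e ≠ e' ∧ D.marked α = {Sum.inr e, Sum.inr e'} ∧
      ∃ v, (D.tgt e = some v ∧ D.tgt e' = some v) ∨ (D.src e = some v ∧ D.src e' = some v))

open Classical in
/-- The edges in no pair of `S`. -/
def E₀ (D : MarkedFloorDiagram Δ g) (S : Finset (Finset ℕ)) : Finset D.E :=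
  Finset.univ.filter fun e => ∀ α ∈ S, Sum.inr e ∉ D.marked α

open Classical in
/-- The edges paired with a vertex. -/
def E₁ (D : MarkedFloorDiagram Δ g) (S : Finset (Finset ℕ)) : Finset D.E :=
  Finset.univ.filter fun e => ∃ v, ∃ α ∈ S, D.marked α = {Sum.inr e, Sum.inl v}

open Classical in
/-- The pairs `{e, e'}` of edges that are paired with each other. -/
def E₂ (D : MarkedFloorDiagram Δ g) (S : Finset (Finset ℕ)) : Finset (Finset D.E) :=
  Finset.univ.filter fun P => ∃ e e', e ≠ e' ∧ P = {e, e'} ∧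
    ∃ α ∈ S, D.marked α = {Sum.inr e, Sum.inr e'}

open Classical in
/-- The refined `S`-multiplicity. A pair `P = {e, e'}` of edges contributes
`[w(e)] [w(e')] [w(e) + w(e')] / [2]`. -/
def mult (S : Finset (Finset ℕ)) (D : MarkedFloorDiagram Δ g) : QField :=
  if D.Compatible S then
    (∏ e ∈ D.E₀ S, qInt (D.w e) ^ 2) * (∏ e ∈ D.E₁ S, qIntTwo (D.w e)) *
      ∏ P ∈ D.E₂ S, (∏ e ∈ P, qInt (D.w e)) * qInt (∑ e ∈ P, (D.w e : ℤ)) / qInt 2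
  else 0

theorem mult_eq_of_iso (S : Finset (Finset ℕ)) (D D' : MarkedFloorDiagram Δ g)
    (h : Iso D D') : mult S D = mult S D' := by
  classical
  obtain ⟨φV, φE, h1, h2, h3, -, -, h6, h7⟩ := h
  have hm : ∀ (α : Finset ℕ) (a b : D.V ⊕ D.E),
      D'.marked α = {Equiv.sumCongr φV φE a, Equiv.sumCongr φV φE b} ↔
        D.marked α = {a, b} := by
    intro α a b
    have key : D'.marked α = Equiv.sumCongr φV φE '' D.marked α := by
      ext x
      obtain ⟨y, rfl⟩ := (Equiv.sumCongr φV φE).surjective x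
      rw [(Equiv.sumCongr φV φE).injective.mem_set_image]
      rcases y with v | e <;> simp [marked, h6, h7]
    rw [key, ← Set.image_pair, (Equiv.sumCongr φV φE).injective.image_injective.eq_iff]
  have hev : ∀ (α : Finset ℕ) e v, D'.marked α = {Sum.inr (φE e), Sum.inl (φV v)} ↔
      D.marked α = {Sum.inr e, Sum.inl v} := fun α e v => hm α (Sum.inr e) (Sum.inl v)
  have hee : ∀ (α : Finset ℕ) e e', D'.marked α = {Sum.inr (φE e), Sum.inr (φE e')} ↔
      D.marked α = {Sum.inr e, Sum.inr e'} := fun α e e' => hm α (Sum.inr e) (Sum.inr e')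
  have hsome : ∀ (o : Option D.V) v, o.map φV = some (φV v) ↔ o = some v := by
    intro o v; cases o <;> simp
  have hc : D.Compatible S ↔ D'.Compatible S := by
    unfold Compatible OrientedGraph.Adjacent
    simp only [← φE.exists_congr_right, ← φV.exists_congr_right, hev, hee, h1, h2, hsome,
      φE.injective.ne_iff]
  unfold mult
  by_cases hC : D.Compatible S
  · rw [if_pos hC, if_pos (hc.1 hC)]
    congr 1
    · congr 1
      · refine Finset.prod_equiv φE ?_ ?_
        · intro e
          simp only [E₀, Finset.mem_filter, Finset.mem_univ, true_and]
          refine forall₂_congr fun α _ => not_congr ?_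
          show D.m _ ∈ α ↔ D'.m _ ∈ α
          rw [h7]
        · intro e _; rw [h3]
      · refine Finset.prod_equiv φE ?_ ?_
        · intro e
          simp only [E₁, Finset.mem_filter, Finset.mem_univ, true_and,
            ← φV.exists_congr_right, hev]
        · intro e _; rw [h3]
    · refine Finset.prod_equiv φE.finsetCongr ?_ ?_
      · intro P
        simp only [E₂, Finset.mem_filter, Finset.mem_univ, true_and,
          ← φE.exists_congr_right, hee, φE.injective.ne_iff]
        refine exists_congr fun e => exists_congr fun e' => ?_
        have : (φE.finsetCongr P = {φE e, φE e'}) ↔ P = {e, e'} := by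
          have h0 : ({φE e, φE e'} : Finset D'.E) = φE.finsetCongr {e, e'} := by
            simp [Equiv.finsetCongr_apply, Finset.map_insert]
          rw [h0, φE.finsetCongr.injective.eq_iff]
        rw [this]
      · intro P _
        simp [Equiv.finsetCongr_apply, h3]
  · rw [if_neg hC, if_neg (fun h => hC (hc.2 h))]

/-- `G_g(Δ, S)`: the sum of the refined `S`-multiplicities over the isomorphism classes of marked
floor diagrams with Newton polygon `Δ` and genus `g`. -/
def _root_.FloorDiagrams.invariant (Δ : Set (ℝ × ℝ)) (g : ℕ) (S : Finset (Finset ℕ)) : QField :=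
  ∑ᶠ c : Quotient (isoSetoid Δ g), Quotient.lift (mult S) (mult_eq_of_iso S) c

end MarkedFloorDiagram

end FloorDiagrams

end

noncomputable section

namespace FloorDiagrams

section

/-! ### Quantum integers -/

theorem ratFunc_X_sub_inv_ne_zero : (RatFunc.X : RatFunc ℚ) - RatFunc.X⁻¹ ≠ 0 := by
  intro h
  have hX : (RatFunc.X : RatFunc ℚ) ≠ 0 := RatFunc.X_ne_zero
  have h2 : (RatFunc.X : RatFunc ℚ) ^ 2 = 1 := by
    field_simp at h
    linear_combination h
  have h3 : (algebraMap (Polynomial ℚ) (RatFunc ℚ)) (Polynomial.X ^ 2) =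
      algebraMap (Polynomial ℚ) (RatFunc ℚ) 1 := by
    simpa [RatFunc.algebraMap_X] using h2
  have h4 := congrArg Polynomial.natDegree (RatFunc.algebraMap_injective ℚ h3)
  simp at h4

theorem ratFunc_X_sq_sub_inv_ne_zero :
    (RatFunc.X : RatFunc ℚ) ^ 2 - ((RatFunc.X : RatFunc ℚ) ^ 2)⁻¹ ≠ 0 := by
  intro h
  have hX : (RatFunc.X : RatFunc ℚ) ≠ 0 := RatFunc.X_ne_zero
  have h2 : (RatFunc.X : RatFunc ℚ) ^ 4 = 1 := by
    field_simp at h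
    linear_combination h
  have h3 : (algebraMap (Polynomial ℚ) (RatFunc ℚ)) (Polynomial.X ^ 4) =
      algebraMap (Polynomial ℚ) (RatFunc ℚ) 1 := by
    simpa [RatFunc.algebraMap_X] using h2
  have h4 := congrArg Polynomial.natDegree (RatFunc.algebraMap_injective ℚ h3)
  simp at h4

theorem qInt_one : qInt 1 = 1 := by
  simp only [qInt, quantumInt, zpow_one, zpow_neg]
  exact div_self ratFunc_X_sub_inv_ne_zero

theorem qIntTwo_one : qIntTwo 1 = 1 := by
  simp only [qIntTwo, quantumInt, zpow_one, zpow_neg]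
  exact div_self ratFunc_X_sq_sub_inv_ne_zero

theorem qInt_zero : qInt 0 = 0 := by simp [qInt, quantumInt]

theorem qInt_neg (a : ℤ) : qInt (-a) = -qInt a := by
  simp only [qInt, quantumInt, neg_neg]
  ring

theorem qIntTwo_neg (a : ℤ) : qIntTwo (-a) = -qIntTwo a := by
  simp only [qIntTwo, quantumInt, neg_neg]
  ring

theorem qIntTwo_mul_add (a b : ℤ) :
    qIntTwo a * qInt b ^ 2 + qInt a ^ 2 * qIntTwo b =
      2 * (qInt a * qInt b * qInt (a + b) / qInt 2) := by
  have hX : (RatFunc.X : RatFunc ℚ) ≠ 0 := RatFunc.X_ne_zero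
  have h1 := ratFunc_X_sub_inv_ne_zero
  have h2 := ratFunc_X_sq_sub_inv_ne_zero
  simp only [qInt, qIntTwo, quantumInt]
  have e1 : ∀ n : ℤ, ((RatFunc.X : RatFunc ℚ) ^ 2) ^ n = (RatFunc.X ^ n) ^ 2 := by
    intro n
    rw [← zpow_natCast, ← zpow_natCast, ← zpow_mul, ← zpow_mul, mul_comm]
  have e2 : (RatFunc.X : RatFunc ℚ) ^ (2 : ℤ) = RatFunc.X ^ 2 := by norm_cast
  simp only [e1, zpow_neg, zpow_add₀ hX, e2]
  have hx : (RatFunc.X : RatFunc ℚ) ^ a ≠ 0 := zpow_ne_zero _ hX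
  have hy : (RatFunc.X : RatFunc ℚ) ^ b ≠ 0 := zpow_ne_zero _ hX
  generalize (RatFunc.X : RatFunc ℚ) ^ a = x at hx ⊢
  generalize (RatFunc.X : RatFunc ℚ) ^ b = y at hy ⊢
  generalize (RatFunc.X : RatFunc ℚ) = t at *
  generalize hd : t - t⁻¹ = d at *
  generalize hf : t ^ 2 - (t ^ 2)⁻¹ = f at *
  field_simp
  ring

theorem qIntTwo_mul_sub (a b : ℤ) :
    qIntTwo a * qInt b ^ 2 - qInt a ^ 2 * qIntTwo b =
      -(2 * (qInt a * qInt b * qInt (a - b) / qInt 2)) := by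
  have h := qIntTwo_mul_add a (-b)
  rw [qInt_neg, qIntTwo_neg, ← sub_eq_add_neg] at h
  linear_combination h

/-! ### Codes: diagrams whose elements are the marks -/

/-- An element of a diagram whose elements are identified with their marks. -/
inductive Cell
  | empty
  | vert (l r : ℤ)
  | edge (s t : Option ℕ) (w : ℕ)

/-- Renaming the marks of the end points. -/
def Cell.map (σ : ℕ → ℕ) : Cell → Cell
  | .empty => .empty
  | .vert l r => .vert l r
  | .edge s t w => .edge (s.map σ) (t.map σ) w

/-- The factor of an unpaired element. -/
def Cell.weight : Cell → QField
  | .edge _ _ w => qInt w ^ 2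
  | _ => 1

/-- There is an edge from the element `a` to `b`. -/
def codeStep (c : ℕ → Cell) (a b : ℕ) : Prop :=
  match c a, c b with
  | .vert _ _, .edge s _ _ => s = some a
  | .edge _ t _, .vert _ _ => t = some b
  | _, _ => False

open Classical in
/-- The factor of the paired elements `a` and `b`; it is `0` if they are not compatible. -/
def pairWeight (c : ℕ → Cell) (a b : ℕ) : QField :=
  match c a, c b with
  | .vert _ _, .edge s t w => if s = some a ∨ t = some a then qIntTwo w else 0
  | .edge s t w, .vert _ _ => if s = some b ∨ t = some b then qIntTwo w else 0
  | .edge s t w, .edge s' t' w' =>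
    if (s ≠ none ∧ s = s') ∨ (t ≠ none ∧ t = t') then
      qInt w * qInt w' * qInt (w + w') / qInt 2 else 0
  | _, _ => 0

/-- Renaming the marks of a code. -/
def relabel (σ : Equiv.Perm ℕ) (c : ℕ → Cell) : ℕ → Cell :=
  fun j => (c (σ.symm j)).map σ

theorem relabel_apply (σ : Equiv.Perm ℕ) (c : ℕ → Cell) (j : ℕ) :
    relabel σ c (σ j) = (c j).map σ := by simp [relabel]

theorem Cell.map_map (σ τ : ℕ → ℕ) (x : Cell) : (x.map σ).map τ = x.map (τ ∘ σ) := by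
  cases x <;> simp [Cell.map]

theorem Cell.map_id (x : Cell) : x.map id = x := by
  cases x <;> simp [Cell.map]

theorem relabel_symm_relabel (σ : Equiv.Perm ℕ) (c : ℕ → Cell) :
    relabel σ.symm (relabel σ c) = c := by
  funext j
  simp only [relabel, Cell.map_map, Equiv.symm_symm, Equiv.symm_apply_apply]
  rw [Equiv.symm_comp_self, Cell.map_id]

theorem option_map_perm_inj (σ : Equiv.Perm ℕ) (o o' : Option ℕ) :
    o.map σ = o'.map σ ↔ o = o' :=
  (Option.map_injective σ.injective).eq_iff

theorem weight_map (σ : ℕ → ℕ) (x : Cell) : (x.map σ).weight = x.weight := by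
  cases x <;> rfl

theorem codeStep_relabel (σ : Equiv.Perm ℕ) (c : ℕ → Cell) (a b : ℕ) :
    codeStep (relabel σ c) (σ a) (σ b) ↔ codeStep c a b := by
  simp only [codeStep, relabel_apply]
  cases c a <;> cases c b <;> simp [Cell.map]

theorem pairWeight_relabel (σ : Equiv.Perm ℕ) (c : ℕ → Cell) (a b : ℕ) :
    pairWeight (relabel σ c) (σ a) (σ b) = pairWeight c a b := by
  simp only [pairWeight, relabel_apply]
  cases c a <;> cases c b <;>
    simp [Cell.map, option_map_perm_inj]

/-- The marks which lie in no pair `{i, i + 1}` with `i ∈ I`. -/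
def unpaired (n : ℕ) (I : Finset ℕ) : Finset ℕ :=
  Finset.Icc 1 n \ (I ∪ I.image (· + 1))

/-- The multiplicity of a code with respect to the pairs `{i, i + 1}`, `i ∈ I`. -/
def codeMult (n : ℕ) (I : Finset ℕ) (c : ℕ → Cell) : QField :=
  (∏ i ∈ I, pairWeight c i (i + 1)) * ∏ j ∈ unpaired n I, (c j).weight

end

section

/-! ### The code of a diagram with a marking -/

variable {Δ : Set (ℝ × ℝ)} {g : ℕ}

/-- The cell of an element of a diagram. -/
def FloorDiagram.cell (D : FloorDiagram Δ g) (m : D.V ⊕ D.E → ℕ) : D.V ⊕ D.E → Cell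
  | .inl v => .vert (D.L v) (D.R v)
  | .inr e => .edge ((D.src e).map fun v => m (.inl v)) ((D.tgt e).map fun v => m (.inl v)) (D.w e)

open Classical in
/-- The code of a diagram with a marking. -/
def FloorDiagram.code (D : FloorDiagram Δ g) (m : D.V ⊕ D.E → ℕ) (j : ℕ) : Cell :=
  if h : ∃ α, m α = j then D.cell m h.choose else .empty

namespace FloorDiagram

variable {D : FloorDiagram Δ g} {m : D.V ⊕ D.E → ℕ}

theorem code_apply (hm : Function.Injective m) (α : D.V ⊕ D.E) :
    D.code m (m α) = D.cell m α := by
  have h : ∃ β, m β = m α := ⟨α, rfl⟩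
  rw [code, dif_pos h, hm h.choose_spec]

theorem code_inl (hm : Function.Injective m) (v : D.V) :
    D.code m (m (.inl v)) = .vert (D.L v) (D.R v) := code_apply hm _

theorem code_inr (hm : Function.Injective m) (e : D.E) :
    D.code m (m (.inr e)) =
      .edge ((D.src e).map fun v => m (.inl v)) ((D.tgt e).map fun v => m (.inl v)) (D.w e) :=
  code_apply hm _

theorem code_of_not_mem {j : ℕ} (h : ∀ α, m α ≠ j) : D.code m j = .empty := by
  rw [code, dif_neg (by simpa using h)]

theorem code_eq_vert (hm : Function.Injective m) {j : ℕ} {l r : ℤ}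
    (h : D.code m j = .vert l r) : ∃ v, m (.inl v) = j ∧ D.L v = l ∧ D.R v = r := by
  by_cases hj : ∃ α, m α = j
  · obtain ⟨α, rfl⟩ := hj
    rw [code_apply hm] at h
    rcases α with v | e
    · simp only [cell, Cell.vert.injEq] at h
      exact ⟨v, rfl, h⟩
    · simp [cell] at h
  · rw [code_of_not_mem (by simpa using hj)] at h
    simp at h

theorem code_eq_edge (hm : Function.Injective m) {j w : ℕ} {s t : Option ℕ}
    (h : D.code m j = .edge s t w) : ∃ e, m (.inr e) = j ∧
      ((D.src e).map fun v => m (.inl v)) = s ∧ ((D.tgt e).map fun v => m (.inl v)) = t ∧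
      D.w e = w := by
  by_cases hj : ∃ α, m α = j
  · obtain ⟨α, rfl⟩ := hj
    rw [code_apply hm] at h
    rcases α with v | e
    · simp [cell] at h
    · simp only [cell, Cell.edge.injEq] at h
      exact ⟨e, rfl, h⟩
  · rw [code_of_not_mem (by simpa using hj)] at h
    simp at h

theorem inl_inj (hm : Function.Injective m) {v v' : D.V} (h : m (.inl v) = m (.inl v')) :
    v = v' := Sum.inl_injective (hm h)

theorem inr_inj (hm : Function.Injective m) {e e' : D.E} (h : m (.inr e) = m (.inr e')) :
    e = e' := Sum.inr_injective (hm h)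

theorem inl_ne_inr (hm : Function.Injective m) (v : D.V) (e : D.E) :
    m (.inl v) ≠ m (.inr e) := fun h => by simpa using hm h

theorem map_mark_eq_some (hm : Function.Injective m) (o : Option D.V) (v : D.V) :
    (o.map fun v => m (.inl v)) = some (m (.inl v)) ↔ o = some v := by
  cases o with
  | none => simp
  | some u => simpa using ⟨inl_inj hm, fun h => by rw [h]⟩

theorem map_mark_inj (hm : Function.Injective m) (o o' : Option D.V) :
    ((o.map fun v => m (.inl v)) = o'.map fun v => m (.inl v)) ↔ o = o' :=
  (Option.map_injective fun _ _ h => inl_inj hm h).eq_iff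

theorem codeStep_code (hm : Function.Injective m) (α β : D.V ⊕ D.E) :
    codeStep (D.code m) (m α) (m β) ↔ D.toOrientedGraph.Step α β := by
  rcases α with v | e <;> rcases β with v' | e' <;>
    simp only [codeStep, code_inl hm, code_inr hm, map_mark_eq_some hm, false_iff]
  · rintro ⟨⟩
  · exact ⟨.leave _ _, fun | .leave _ _ h => h⟩
  · exact ⟨.enter _ _, fun | .enter _ _ h => h⟩
  · rintro ⟨⟩

theorem codeStep_code' (hm : Function.Injective m) {a b : ℕ} (h : codeStep (D.code m) a b) :
    ∃ α β, m α = a ∧ m β = b ∧ D.toOrientedGraph.Step α β := by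
  by_cases ha : ∃ α, m α = a
  · by_cases hb : ∃ β, m β = b
    · obtain ⟨α, rfl⟩ := ha
      obtain ⟨β, rfl⟩ := hb
      exact ⟨α, β, rfl, rfl, (codeStep_code hm _ _).1 h⟩
    · simp only [codeStep, code_of_not_mem (not_exists.1 hb)] at h
      split at h <;> simp_all
  · simp only [codeStep, code_of_not_mem (not_exists.1 ha)] at h

theorem prec_increasing (h : ∀ α β, D.toOrientedGraph.Step α β → m α < m β) (α β : D.V ⊕ D.E)
    (hp : D.toOrientedGraph.Prec α β) : m α < m β := by
  induction hp with
  | single h' => exact h _ _ h'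
  | tail _ h' ih => exact ih.trans (h _ _ h')

theorem increasing_iff (hm : Function.Injective m) :
    (∀ α β, D.toOrientedGraph.Prec α β → m α < m β) ↔
      ∀ a b, codeStep (D.code m) a b → a < b := by
  constructor
  · intro h a b hab
    obtain ⟨α, β, rfl, rfl, hs⟩ := codeStep_code' hm hab
    exact h _ _ (.single hs)
  · intro h
    exact prec_increasing fun α β hs => h _ _ ((codeStep_code hm _ _).2 hs)

theorem code_relabel (hm : Function.Injective m) (σ : Equiv.Perm ℕ) :
    D.code (σ ∘ m) = relabel σ (D.code m) := by
  funext j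
  obtain ⟨j, rfl⟩ := σ.surjective j
  rw [relabel_apply]
  by_cases hj : ∃ α, m α = j
  · obtain ⟨α, rfl⟩ := hj
    rw [show σ (m α) = (σ ∘ m) α from rfl, code_apply (σ.injective.comp hm), code_apply hm]
    rcases α with v | e
    · rfl
    · simp [cell, Cell.map, Option.map_map, Function.comp_def]
  · rw [code_of_not_mem (not_exists.1 hj), code_of_not_mem, Cell.map]
    intro α h
    exact hj ⟨α, σ.injective h⟩

end FloorDiagram

/-- The codes of the diagrams with `n` elements and a marking which need not be increasing. -/
def looseCodes (Δ : Set (ℝ × ℝ)) (g n : ℕ) : Set (ℕ → Cell) :=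
  {c | ∃ (D : FloorDiagram Δ g) (m : D.V ⊕ D.E → ℕ),
    Function.Injective m ∧ Set.range m = Set.Icc 1 n ∧ D.code m = c}

/-- The codes of the marked floor diagrams with `n` elements. -/
def codes (Δ : Set (ℝ × ℝ)) (g n : ℕ) : Set (ℕ → Cell) :=
  {c ∈ looseCodes Δ g n | ∀ a b, codeStep c a b → a < b}

namespace MarkedFloorDiagram

theorem m_injective (D : MarkedFloorDiagram Δ g) : Function.Injective D.m :=
  fun _ _ h => D.m_bij.injOn (Set.mem_univ _) (Set.mem_univ _) h

theorem range_m (D : MarkedFloorDiagram Δ g) :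
    Set.range D.m = Set.Icc 1 (Fintype.card D.V + Fintype.card D.E) := by
  rw [← D.m_bij.image_eq, Set.image_univ]

/-- The code of a marked floor diagram. -/
def code (D : MarkedFloorDiagram Δ g) : ℕ → Cell := D.toFloorDiagram.code D.m

theorem code_eq_of_iso {D D' : MarkedFloorDiagram Δ g} (h : Iso D D') : D.code = D'.code := by
  obtain ⟨φV, φE, h1, h2, h3, h4, h5, h6, h7⟩ := h
  funext j
  by_cases hj : ∃ α, D.m α = j
  · obtain ⟨α, rfl⟩ := hj
    rcases α with v | e
    · rw [code, FloorDiagram.code_inl D.m_injective, ← h6, code,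
        FloorDiagram.code_inl D'.m_injective, h4, h5]
    · rw [code, FloorDiagram.code_inr D.m_injective, ← h7, code,
        FloorDiagram.code_inr D'.m_injective, h1, h2, h3]
      simp [Option.map_map, Function.comp_def, h6]
  · have hj' : ¬ ∃ α, D'.m α = j := by
      rintro ⟨α, rfl⟩
      rcases α with v | e
      · exact hj ⟨.inl (φV.symm v), by rw [← h6, φV.apply_symm_apply]⟩
      · exact hj ⟨.inr (φE.symm e), by rw [← h7, φE.apply_symm_apply]⟩
    rw [code, FloorDiagram.code_of_not_mem (not_exists.1 hj), code,
      FloorDiagram.code_of_not_mem (not_exists.1 hj')]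

theorem iso_of_code_eq {D D' : MarkedFloorDiagram Δ g} (h : D.code = D'.code) : Iso D D' := by
  have key : ∀ {D D' : MarkedFloorDiagram Δ g}, D.code = D'.code →
      (∀ v, ∃ v', D'.m (.inl v') = D.m (.inl v) ∧ D'.L v' = D.L v ∧ D'.R v' = D.R v) ∧
      (∀ e, ∃ e', D'.m (.inr e') = D.m (.inr e) ∧
        ((D'.src e').map fun v => D'.m (.inl v)) = ((D.src e).map fun v => D.m (.inl v)) ∧
        ((D'.tgt e').map fun v => D'.m (.inl v)) = ((D.tgt e).map fun v => D.m (.inl v)) ∧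
        D'.w e' = D.w e) := by
    intro D D' h
    refine ⟨fun v => ?_, fun e => ?_⟩
    · exact FloorDiagram.code_eq_vert D'.m_injective
        ((congrFun h _).symm.trans (FloorDiagram.code_inl D.m_injective v))
    · exact FloorDiagram.code_eq_edge D'.m_injective
        ((congrFun h _).symm.trans (FloorDiagram.code_inr D.m_injective e))
  obtain ⟨hV, hE⟩ := key h
  obtain ⟨hV', hE'⟩ := key h.symm
  choose φ hφ using hV
  choose ψ hψ using hE
  choose φ' hφ' using hV'
  choose ψ' hψ' using hE'
  let φV : D.V ≃ D'.V := ⟨φ, φ',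
    fun v => FloorDiagram.inl_inj D.m_injective (by rw [(hφ' _).1, (hφ _).1]),
    fun v => FloorDiagram.inl_inj D'.m_injective (by rw [(hφ _).1, (hφ' _).1])⟩
  let φE : D.E ≃ D'.E := ⟨ψ, ψ',
    fun v => FloorDiagram.inr_inj D.m_injective (by rw [(hψ' _).1, (hψ _).1]),
    fun v => FloorDiagram.inr_inj D'.m_injective (by rw [(hψ _).1, (hψ' _).1])⟩
  refine ⟨φV, φE, fun e => ?_, fun e => ?_, fun e => (hψ e).2.2.2, fun v => (hφ v).2.1,
    fun v => (hφ v).2.2, fun v => (hφ v).1, fun e => (hψ e).1⟩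
  · rw [← FloorDiagram.map_mark_inj D'.m_injective]
    refine (hψ e).2.1.trans ?_
    rw [Option.map_map]
    congr 1
    funext v
    exact (hφ v).1.symm
  · rw [← FloorDiagram.map_mark_inj D'.m_injective]
    refine (hψ e).2.2.1.trans ?_
    rw [Option.map_map]
    congr 1
    funext v
    exact (hφ v).1.symm

theorem marked_eq_pair (D : MarkedFloorDiagram Δ g) {i : ℕ} {α β : D.V ⊕ D.E}
    (hα : D.m α = i) (hβ : D.m β = i + 1) : D.marked {i, i + 1} = {α, β} := by
  ext x
  simp only [marked, Set.mem_ofPred_eq, Finset.mem_insert, Finset.mem_singleton,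
    Set.mem_insert_iff, Set.mem_singleton_iff, ← hβ]
  rw [← hα, D.m_injective.eq_iff, D.m_injective.eq_iff]

theorem pair_marks (D : MarkedFloorDiagram Δ g) {i : ℕ} {α β : D.V ⊕ D.E} (hαβ : α ≠ β)
    (h : D.marked {i, i + 1} = {α, β}) :
    (D.m α = i ∧ D.m β = i + 1) ∨ (D.m β = i ∧ D.m α = i + 1) := by
  have ha : D.m α ∈ ({i, i + 1} : Finset ℕ) := by
    have : α ∈ D.marked {i, i + 1} := by rw [h]; simp
    exact this
  have hb : D.m β ∈ ({i, i + 1} : Finset ℕ) := by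
    have : β ∈ D.marked {i, i + 1} := by rw [h]; simp
    exact this
  have := D.m_injective.ne hαβ
  simp only [Finset.mem_insert, Finset.mem_singleton] at ha hb
  omega

end MarkedFloorDiagram

end

section

variable {Δ : Set (ℝ × ℝ)} {g : ℕ}

@[to_additive]
theorem prod_eq_prod_of_rel {α β M : Type*} [CommMonoid M] {A : Finset α} {B : Finset β}
    {f : α → M} {h : β → M} (r : α → β → Prop) (hA : ∀ a ∈ A, ∃ b ∈ B, r a b)
    (hB : ∀ b ∈ B, ∃ a ∈ A, r a b)
    (hr : ∀ a ∈ A, ∀ b ∈ B, ∀ b' ∈ B, r a b → r a b' → b = b')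
    (hl : ∀ a ∈ A, ∀ a' ∈ A, ∀ b ∈ B, r a b → r a' b → a = a')
    (hfg : ∀ a ∈ A, ∀ b ∈ B, r a b → f a = h b) : ∏ a ∈ A, f a = ∏ b ∈ B, h b := by
  choose φ hφ hrφ using hA
  refine Finset.prod_bij φ hφ ?_ ?_ ?_
  · intro a ha a' ha' he
    exact hl a ha a' ha' (φ a ha) (hφ a ha) (hrφ a ha) (he ▸ hrφ a' ha')
  · intro b hb
    obtain ⟨a, ha, hab⟩ := hB b hb
    exact ⟨a, ha, hr a ha _ (hφ a ha) b hb (hrφ a ha) hab⟩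
  · intro a ha
    exact hfg a ha _ (hφ a ha) (hrφ a ha)

/-- The pair `{i, i + 1}`. -/
def consecutive (i : ℕ) : Finset ℕ := {i, i + 1}

theorem consecutive_injective : Function.Injective consecutive := by
  intro i j h
  have h1 : i ∈ consecutive j := by rw [← h]; simp [consecutive]
  have h2 : j ∈ consecutive i := by rw [h]; simp [consecutive]
  simp only [consecutive, Finset.mem_insert, Finset.mem_singleton] at h1 h2
  omega

/-- The pairs `{i, i + 1}`, `i ∈ I`, form a pairing of `{1, …, n}`. -/
def IsPairingIndex (n : ℕ) (I : Finset ℕ) : Prop :=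
  (∀ i ∈ I, 1 ≤ i ∧ i + 1 ≤ n) ∧ ∀ i ∈ I, i + 1 ∉ I

theorem IsPairing.exists_index {n s : ℕ} {S : Finset (Finset ℕ)} (h : IsPairing n s S) :
    ∃ I : Finset ℕ, IsPairingIndex n I ∧ I.card = s ∧ S = I.image consecutive := by
  obtain ⟨hc, hS, hd⟩ := h
  choose! f hf using hS
  have hS' : S = (S.image f).image consecutive := by
    rw [Finset.image_image]
    ext α
    simp only [Finset.mem_image, Function.comp_apply]
    constructor
    · exact fun h => ⟨α, h, (hf α h).2.2.symm⟩
    · rintro ⟨β, hβ, rfl⟩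
      rw [consecutive, ← (hf β hβ).2.2]
      exact hβ
  refine ⟨S.image f, ⟨?_, ?_⟩, ?_, hS'⟩
  · intro i hi
    obtain ⟨α, hα, rfl⟩ := Finset.mem_image.1 hi
    exact ⟨(hf α hα).1, (hf α hα).2.1⟩
  · intro i hi hi'
    obtain ⟨α, hα, rfl⟩ := Finset.mem_image.1 hi
    obtain ⟨β, hβ, he⟩ := Finset.mem_image.1 hi'
    have hne : α ≠ β := by
      rintro rfl
      omega
    have := hd hα hβ hne
    rw [Function.onFun, id, id, Finset.disjoint_left] at this
    refine this (a := f α + 1) ?_ ?_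
    · have : f α + 1 ∈ ({f α, f α + 1} : Finset ℕ) := by simp
      rwa [← (hf α hα).2.2] at this
    · have : f β ∈ ({f β, f β + 1} : Finset ℕ) := by simp
      rwa [← (hf β hβ).2.2, he] at this
  · rw [← hc, hS', Finset.card_image_of_injective _ consecutive_injective, ← hS']

namespace MarkedFloorDiagram

variable (D : MarkedFloorDiagram Δ g) {I : Finset ℕ}

theorem exists_mark {j : ℕ} (h1 : 1 ≤ j) (h2 : j ≤ Fintype.card D.V + Fintype.card D.E) :
    ∃ α, D.m α = j := by
  have : j ∈ Set.range D.m := by rw [D.range_m]; exact ⟨h1, h2⟩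
  exact this

theorem pairWeight_inl_inr (v : D.V) (e : D.E) [Decidable (D.toOrientedGraph.Adjacent e v)] :
    pairWeight D.code (D.m (.inl v)) (D.m (.inr e)) =
      if D.toOrientedGraph.Adjacent e v then qIntTwo (D.w e) else 0 := by
  simp only [pairWeight, code, FloorDiagram.code_inl D.m_injective,
    FloorDiagram.code_inr D.m_injective]
  exact if_congr (or_congr (FloorDiagram.map_mark_eq_some D.m_injective _ _)
    (FloorDiagram.map_mark_eq_some D.m_injective _ _)) rfl rfl

theorem pairWeight_inr_inl (v : D.V) (e : D.E) [Decidable (D.toOrientedGraph.Adjacent e v)] :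
    pairWeight D.code (D.m (.inr e)) (D.m (.inl v)) =
      if D.toOrientedGraph.Adjacent e v then qIntTwo (D.w e) else 0 := by
  simp only [pairWeight, code, FloorDiagram.code_inl D.m_injective,
    FloorDiagram.code_inr D.m_injective]
  exact if_congr (or_congr (FloorDiagram.map_mark_eq_some D.m_injective _ _)
    (FloorDiagram.map_mark_eq_some D.m_injective _ _)) rfl rfl

/-- Two edges both enter or both leave the same vertex. -/
def ShareEnd (e e' : D.E) : Prop :=
  ∃ v, (D.tgt e = some v ∧ D.tgt e' = some v) ∨ (D.src e = some v ∧ D.src e' = some v)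

theorem pairWeight_inr_inr (e e' : D.E) [Decidable (D.ShareEnd e e')] :
    pairWeight D.code (D.m (.inr e)) (D.m (.inr e')) =
      if D.ShareEnd e e' then
        qInt (D.w e) * qInt (D.w e') * qInt (D.w e + D.w e') / qInt 2 else 0 := by
  simp only [pairWeight, code, FloorDiagram.code_inr D.m_injective]
  refine if_congr ?_ rfl rfl
  rw [FloorDiagram.map_mark_inj D.m_injective, FloorDiagram.map_mark_inj D.m_injective]
  simp only [ShareEnd, ne_eq, Option.map_eq_none_iff]
  constructor
  · rintro (⟨h, h'⟩ | ⟨h, h'⟩)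
    · obtain ⟨v, hv⟩ := Option.ne_none_iff_exists'.1 h
      exact ⟨v, .inr ⟨hv, h' ▸ hv⟩⟩
    · obtain ⟨v, hv⟩ := Option.ne_none_iff_exists'.1 h
      exact ⟨v, .inl ⟨hv, h' ▸ hv⟩⟩
  · rintro ⟨v, (⟨h, h'⟩ | ⟨h, h'⟩)⟩ <;> simp [h, h']

theorem ShareEnd.symm {D : MarkedFloorDiagram Δ g} {e e' : D.E} (h : D.ShareEnd e e') :
    D.ShareEnd e' e := by
  obtain ⟨v, (⟨h, h'⟩ | ⟨h, h'⟩)⟩ := h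
  · exact ⟨v, .inl ⟨h', h⟩⟩
  · exact ⟨v, .inr ⟨h', h⟩⟩

theorem pairWeight_of_marked_inl {i : ℕ} {e : D.E} {v : D.V}
    (h : D.marked (consecutive i) = {.inr e, .inl v}) (ha : D.toOrientedGraph.Adjacent e v) :
    pairWeight D.code i (i + 1) = qIntTwo (D.w e) := by
  classical
  rcases D.pair_marks (by simp) h with ⟨h1, h2⟩ | ⟨h1, h2⟩
  · rw [← h2, ← h1, pairWeight_inr_inl, if_pos ha]
  · rw [← h2, ← h1, pairWeight_inl_inr, if_pos ha]

theorem pairWeight_of_marked_inr {i : ℕ} {e e' : D.E} (hne : e ≠ e')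
    (h : D.marked (consecutive i) = {.inr e, .inr e'}) (ha : D.ShareEnd e e') :
    pairWeight D.code i (i + 1) =
      qInt (D.w e) * qInt (D.w e') * qInt (D.w e + D.w e') / qInt 2 := by
  classical
  rcases D.pair_marks (by simpa using hne) h with ⟨h1, h2⟩ | ⟨h1, h2⟩
  · rw [← h2, ← h1, pairWeight_inr_inr, if_pos ha]
  · rw [← h2, ← h1, pairWeight_inr_inr, if_pos ha.symm, add_comm (D.w e' : ℤ),
      mul_comm (qInt (D.w e'))]

theorem compatible_of_pairWeight_ne_zero
    (hI : IsPairingIndex (Fintype.card D.V + Fintype.card D.E) I)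
    (h : ∀ i ∈ I, pairWeight D.code i (i + 1) ≠ 0) : D.Compatible (I.image consecutive) := by
  classical
  intro α hα
  obtain ⟨i, hi, rfl⟩ := Finset.mem_image.1 hα
  obtain ⟨h1, h2⟩ := hI.1 i hi
  obtain ⟨α, hα⟩ := D.exists_mark h1 (by omega)
  obtain ⟨β, hβ⟩ := D.exists_mark (j := i + 1) (by omega) h2
  have hm := D.marked_eq_pair hα hβ
  have hw := h i hi
  rw [← hβ, ← hα] at hw
  rcases α with v | e <;> rcases β with v' | e'
  · simp [pairWeight, code, FloorDiagram.code_inl D.m_injective] at hw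
  · rw [pairWeight_inl_inr] at hw
    exact .inl ⟨e', v, by rw [consecutive, hm, Set.pair_comm], by by_contra h; simp [h] at hw⟩
  · rw [pairWeight_inr_inl] at hw
    exact .inl ⟨e, v', hm, by by_contra h; simp [h] at hw⟩
  · rw [pairWeight_inr_inr] at hw
    refine .inr ⟨e, e', ?_, hm, by by_contra h; exact hw (if_neg h)⟩
    rintro rfl
    omega

theorem index_eq_of_mem (hI : ∀ i ∈ I, i + 1 ∉ I) {i j x : ℕ} (hi : i ∈ I) (hj : j ∈ I)
    (hx : x ∈ consecutive i) (hx' : x ∈ consecutive j) : i = j := by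
  simp only [consecutive, Finset.mem_insert, Finset.mem_singleton] at hx hx'
  have h1 : i + 1 ≠ j := fun e => hI i hi (e ▸ hj)
  have h2 : j + 1 ≠ i := fun e => hI j hj (e ▸ hi)
  omega

theorem prod_unpaired (I : Finset ℕ) :
    ∏ j ∈ unpaired (Fintype.card D.V + Fintype.card D.E) I, (D.code j).weight =
      ∏ e ∈ D.E₀ (I.image consecutive), qInt (D.w e) ^ 2 := by
  classical
  have hmem : ∀ x, D.m x ∈ unpaired (Fintype.card D.V + Fintype.card D.E) I ↔
      ∀ α ∈ I.image consecutive, x ∉ D.marked α := by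
    intro x
    have hx : D.m x ∈ Set.Icc 1 (Fintype.card D.V + Fintype.card D.E) := by
      rw [← D.range_m]; exact ⟨x, rfl⟩
    rw [Set.mem_Icc] at hx
    simp only [unpaired, Finset.mem_sdiff, Finset.mem_Icc, hx, true_and, Finset.mem_union,
      Finset.mem_image, marked, Set.mem_ofPred_eq, consecutive, not_or, not_exists, not_and,
      forall_exists_index, and_imp]
    constructor
    · rintro ⟨h1, h2⟩ α i hi rfl h
      simp only [Finset.mem_insert, Finset.mem_singleton] at h
      rcases h with h | h
      · exact h1 (h ▸ hi)
      · exact h2 i hi h.symm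
    · intro h
      refine ⟨fun hi => h _ _ hi rfl (by simp), fun i hi he => h _ _ hi rfl (by simp [he])⟩
  have h1 : ∏ j ∈ unpaired (Fintype.card D.V + Fintype.card D.E) I, (D.code j).weight =
      ∏ x ∈ Finset.univ.filter
        (fun x => D.m x ∈ unpaired (Fintype.card D.V + Fintype.card D.E) I),
        (D.toFloorDiagram.cell D.m x).weight := by
    symm
    refine Finset.prod_bij (fun x _ => D.m x) (by simp) (fun _ _ _ _ h => D.m_injective h) ?_ ?_
    · intro j hj
      have hj' := hj
      simp only [unpaired, Finset.mem_sdiff, Finset.mem_Icc] at hj'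
      obtain ⟨x, rfl⟩ := D.exists_mark hj'.1.1 hj'.1.2
      exact ⟨x, by simpa using hj, rfl⟩
    · intro x _
      rw [code, FloorDiagram.code_apply D.m_injective]
  rw [h1, Finset.prod_filter, Fintype.prod_sum_type, E₀, Finset.prod_filter]
  simp only [hmem, FloorDiagram.cell, Cell.weight, ite_self, Finset.prod_const_one, one_mul]

theorem prod_E₁ (hI : IsPairingIndex (Fintype.card D.V + Fintype.card D.E) I)
    (hC : D.Compatible (I.image consecutive)) [DecidablePred fun i => ∃ e v,
      D.marked (consecutive i) = {.inr e, .inl v}] :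
    ∏ i ∈ I.filter (fun i => ∃ e v, D.marked (consecutive i) = {.inr e, .inl v}),
        pairWeight D.code i (i + 1) =
      ∏ e ∈ D.E₁ (I.image consecutive), qIntTwo (D.w e) := by
  classical
  refine prod_eq_prod_of_rel (fun i e => ∃ v, D.marked (consecutive i) = {.inr e, .inl v})
    ?_ ?_ ?_ ?_ ?_
  · intro i hi
    obtain ⟨hi, e, v, h⟩ := Finset.mem_filter.1 hi
    exact ⟨e, Finset.mem_filter.2 ⟨Finset.mem_univ _, v, _, Finset.mem_image_of_mem _ hi, h⟩, v, h⟩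
  · intro e he
    obtain ⟨-, v, α, hα, h⟩ := Finset.mem_filter.1 he
    obtain ⟨i, hi, rfl⟩ := Finset.mem_image.1 hα
    exact ⟨i, Finset.mem_filter.2 ⟨hi, e, v, h⟩, v, h⟩
  · rintro i - e - e' - ⟨v, h⟩ ⟨v', h'⟩
    have : (Sum.inr e : D.V ⊕ D.E) ∈ ({.inr e', .inl v'} : Set (D.V ⊕ D.E)) := by
      rw [← h', h]; simp
    simpa using this
  · rintro i hi i' hi' e - ⟨v, h⟩ ⟨v', h'⟩
    refine index_eq_of_mem hI.2 (x := D.m (.inr e)) (Finset.mem_filter.1 hi).1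
      (Finset.mem_filter.1 hi').1 ?_ ?_
    · change Sum.inr e ∈ D.marked (consecutive i)
      rw [h]; simp
    · change Sum.inr e ∈ D.marked (consecutive i')
      rw [h']; simp
  · rintro i hi e - ⟨v, h⟩
    rcases hC _ (Finset.mem_image_of_mem _ (Finset.mem_filter.1 hi).1) with
      ⟨e', v', h', ha⟩ | ⟨e', e'', hne, h', ha⟩
    · rw [D.pairWeight_of_marked_inl h' ha]
      have : (Sum.inr e : D.V ⊕ D.E) ∈ ({.inr e', .inl v'} : Set (D.V ⊕ D.E)) := by
        rw [← h', h]; simp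
      rw [show e = e' by simpa using this]
    · have : (Sum.inl v : D.V ⊕ D.E) ∈ ({.inr e', .inr e''} : Set (D.V ⊕ D.E)) := by
        rw [← h', h]; simp
      simp at this

theorem prod_E₂ (hI : IsPairingIndex (Fintype.card D.V + Fintype.card D.E) I)
    (hC : D.Compatible (I.image consecutive)) [DecidablePred fun i => ¬ ∃ e v,
      D.marked (consecutive i) = {.inr e, .inl v}] :
    ∏ i ∈ I.filter (fun i => ¬ ∃ e v, D.marked (consecutive i) = {.inr e, .inl v}),
        pairWeight D.code i (i + 1) =
      ∏ P ∈ D.E₂ (I.image consecutive),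
        (∏ e ∈ P, qInt (D.w e)) * qInt (∑ e ∈ P, (D.w e : ℤ)) / qInt 2 := by
  classical
  refine prod_eq_prod_of_rel (fun i P => ∃ e e', e ≠ e' ∧ P = {e, e'} ∧
    D.marked (consecutive i) = {.inr e, .inr e'}) ?_ ?_ ?_ ?_ ?_
  · intro i hi
    obtain ⟨hi, hn⟩ := Finset.mem_filter.1 hi
    rcases hC _ (Finset.mem_image_of_mem _ hi) with ⟨e', v', h', ha⟩ | ⟨e, e', hne, h', ha⟩
    · exact absurd ⟨e', v', h'⟩ hn
    · exact ⟨{e, e'}, Finset.mem_filter.2 ⟨Finset.mem_univ _, e, e', hne, by ext; simp, _,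
        Finset.mem_image_of_mem _ hi, h'⟩, e, e', hne, rfl, h'⟩
  · intro P hP
    obtain ⟨-, e, e', hne, rfl, α, hα, h⟩ := Finset.mem_filter.1 hP
    obtain ⟨i, hi, rfl⟩ := Finset.mem_image.1 hα
    refine ⟨i, Finset.mem_filter.2 ⟨hi, ?_⟩, e, e', hne, by ext; simp, h⟩
    rintro ⟨e₁, v, h₁⟩
    have : (Sum.inl v : D.V ⊕ D.E) ∈ ({.inr e, .inr e'} : Set (D.V ⊕ D.E)) := by
      rw [← h, h₁]; simp
    simp at this
  · rintro i - P - P' - ⟨e, e', hne, rfl, h⟩ ⟨f, f', hne', rfl, h'⟩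
    ext x
    have : (Sum.inr x : D.V ⊕ D.E) ∈ D.marked (consecutive i) ↔
        Sum.inr x ∈ D.marked (consecutive i) := Iff.rfl
    nth_rw 1 [h] at this
    rw [h'] at this
    simpa using this
  · rintro i hi i' hi' P - ⟨e, e', hne, rfl, h⟩ ⟨f, f', hne', hP, h'⟩
    have he : e ∈ ({f, f'} : Finset D.E) := by rw [← hP]; simp
    refine index_eq_of_mem hI.2 (x := D.m (.inr e)) (Finset.mem_filter.1 hi).1
      (Finset.mem_filter.1 hi').1 ?_ ?_
    · change Sum.inr e ∈ D.marked (consecutive i)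
      rw [h]; simp
    · change Sum.inr e ∈ D.marked (consecutive i')
      rw [h']; simpa using he
  · rintro i hi P - ⟨e, e', hne, rfl, h⟩
    rw [Finset.prod_pair hne, Finset.sum_pair hne]
    rcases hC _ (Finset.mem_image_of_mem _ (Finset.mem_filter.1 hi).1) with
      ⟨f, v', h', ha⟩ | ⟨f, f', hne', h', ha⟩
    · have : (Sum.inl v' : D.V ⊕ D.E) ∈ ({.inr e, .inr e'} : Set (D.V ⊕ D.E)) := by
        rw [← h, h']; simp
      simp at this
    · have h1 : (Sum.inr f : D.V ⊕ D.E) ∈ ({.inr e, .inr e'} : Set (D.V ⊕ D.E)) := by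
        rw [← h, h']; simp
      have h2 : (Sum.inr f' : D.V ⊕ D.E) ∈ ({.inr e, .inr e'} : Set (D.V ⊕ D.E)) := by
        rw [← h, h']; simp
      simp only [Set.mem_insert_iff, Sum.inr.injEq, Set.mem_singleton_iff] at h1 h2
      have hs : D.ShareEnd e e' := by
        rcases h1 with rfl | rfl <;> rcases h2 with rfl | rfl
        · exact absurd rfl hne'
        · exact ha
        · exact ShareEnd.symm ha
        · exact absurd rfl hne'
      exact D.pairWeight_of_marked_inr hne h hs

theorem mult_eq_codeMult (hI : IsPairingIndex (Fintype.card D.V + Fintype.card D.E) I) :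
    mult (I.image consecutive) D = codeMult (Fintype.card D.V + Fintype.card D.E) I D.code := by
  classical
  unfold mult codeMult
  split_ifs with hC
  · rw [D.prod_unpaired I, ← D.prod_E₁ hI hC, ← D.prod_E₂ hI hC, mul_assoc,
      Finset.prod_filter_mul_prod_filter_not, mul_comm]
  · have : ∃ i ∈ I, pairWeight D.code i (i + 1) = 0 := by
      by_contra! h
      exact hC (D.compatible_of_pairWeight_ne_zero hI h)
    obtain ⟨i, hi, h⟩ := this
    rw [Finset.prod_eq_zero hi h, zero_mul]

end MarkedFloorDiagram

/-- The invariant as a sum over codes. -/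
theorem invariant_eq_finsum {n : ℕ}
    (hn : ∀ D : FloorDiagram Δ g, Fintype.card D.V + Fintype.card D.E = n)
    {I : Finset ℕ} (hI : IsPairingIndex n I) :
    invariant Δ g (I.image consecutive) = ∑ᶠ c ∈ codes Δ g n, codeMult n I c := by
  let F : Quotient (MarkedFloorDiagram.isoSetoid Δ g) → (ℕ → Cell) :=
    Quotient.lift MarkedFloorDiagram.code fun _ _ h => MarkedFloorDiagram.code_eq_of_iso h
  have hF : Function.Injective F := by
    intro a b
    refine Quotient.inductionOn₂ a b fun D D' h => Quotient.sound ?_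
    exact MarkedFloorDiagram.iso_of_code_eq h
  have hr : Set.range F = codes Δ g n := by
    ext c
    constructor
    · rintro ⟨a, rfl⟩
      induction a using Quotient.inductionOn with
      | h D =>
        refine ⟨⟨D.toFloorDiagram, D.m, D.m_injective, ?_, rfl⟩, ?_⟩
        · rw [D.range_m, hn]
        · exact (FloorDiagram.increasing_iff D.m_injective).1 D.m_increasing
    · rintro ⟨⟨D, m, hm, hr, rfl⟩, hc⟩
      refine ⟨Quotient.mk _ ⟨D, m, ?_, (FloorDiagram.increasing_iff hm).2 hc⟩, rfl⟩
      rw [hn, ← hr, ← Set.image_univ]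
      exact hm.injOn.bijOn_image
  rw [← hr, finsum_mem_range hF, invariant]
  refine finsum_congr fun a => ?_
  induction a using Quotient.inductionOn with
  | h D =>
    have := D.mult_eq_codeMult (I := I) (by rw [hn]; exact hI)
    rw [hn] at this
    exact this

end

section

variable {Δ : Set (ℝ × ℝ)} {g : ℕ}

/-! ### Finiteness -/

namespace FloorDiagram

theorem card_eq (D D' : FloorDiagram Δ g) : Fintype.card D.V = Fintype.card D'.V := by
  have := D.card_V.trans D'.card_V.symm
  exact_mod_cast this

theorem exists_L_eq (D D' : FloorDiagram Δ g) (v : D.V) : ∃ v', D'.L v' = D.L v := by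
  classical
  have h : 0 < (Finset.univ.filter fun v' => D'.L v' = D.L v).card := by
    have h1 := D.L_bij (D.L v)
    have h2 := D'.L_bij (D.L v)
    have h3 : 0 < (Finset.univ.filter fun v' => D.L v' = D.L v).card :=
      Finset.card_pos.2 ⟨v, by simp⟩
    convert h3 using 1
    convert h2.trans h1.symm using 2
  obtain ⟨v', hv'⟩ := Finset.card_pos.1 h
  exact ⟨v', (Finset.mem_filter.1 hv').2⟩

theorem exists_R_eq (D D' : FloorDiagram Δ g) (v : D.V) : ∃ v', D'.R v' = D.R v := by
  classical
  have h : 0 < (Finset.univ.filter fun v' => D'.R v' = D.R v).card := by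
    have h1 := D.R_bij (D.R v)
    have h2 := D'.R_bij (D.R v)
    have h3 : 0 < (Finset.univ.filter fun v' => D.R v' = D.R v).card :=
      Finset.card_pos.2 ⟨v, by simp⟩
    convert h3 using 1
    convert h2.trans h1.symm using 2
  obtain ⟨v', hv'⟩ := Finset.card_pos.1 h
  exact ⟨v', (Finset.mem_filter.1 hv').2⟩

open Classical in
theorem sum_divergence (Γ : OrientedGraph) (w : Γ.E → ℕ) (U : Finset Γ.V) :
    ∑ v ∈ U, Γ.divergence w v =
      ∑ e, ((if ∃ v ∈ U, Γ.tgt e = some v then (w e : ℤ) else 0) -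
        if ∃ v ∈ U, Γ.src e = some v then (w e : ℤ) else 0) := by
  have key : ∀ f : Γ.E → Option Γ.V,
      ∑ v ∈ U, ∑ e ∈ Finset.univ.filter (fun e => f e = some v), (w e : ℤ) =
        ∑ e, if ∃ v ∈ U, f e = some v then (w e : ℤ) else 0 := by
    intro f
    simp_rw [Finset.sum_filter]
    rw [Finset.sum_comm]
    refine Finset.sum_congr rfl fun e _ => ?_
    split_ifs with h
    · obtain ⟨v, hv, he⟩ := h
      rw [Finset.sum_eq_single v, if_pos he]
      · intro u _ hu
        rw [if_neg]
        rw [he]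
        simpa using fun h => hu h.symm
      · exact fun h => absurd hv h
    · refine Finset.sum_eq_zero fun v hv => if_neg fun he => h ⟨v, hv, he⟩
  simp only [OrientedGraph.divergence, Finset.sum_sub_distrib, key]

/-- The weights are bounded by the flow through the diagram. -/
theorem w_le (D : FloorDiagram Δ g) (e : D.E) :
    (D.w e : ℤ) ≤ eMinus Δ + ∑ v, |D.L v + D.R v| := by
  classical
  let U : Finset D.V :=
    Finset.univ.filter fun v => D.toOrientedGraph.Prec (.inl v) (.inr e)
  have hU : ∀ v, v ∈ U ↔ D.toOrientedGraph.Prec (.inl v) (.inr e) := by simp [U]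
  have h1 : -∑ v ∈ U, D.toOrientedGraph.divergence D.w v ≤ ∑ v, |D.L v + D.R v| := by
    rw [← Finset.sum_neg_distrib]
    refine (Finset.sum_le_sum fun v _ => ?_).trans
      (Finset.sum_le_sum_of_subset_of_nonneg (Finset.subset_univ U) fun _ _ _ => abs_nonneg _)
    rw [D.div_eq]
    exact neg_le_abs _
  by_cases hs : D.src e = none
  · rw [D.w_infinite e (.inl hs)]
    have : 0 < D.toOrientedGraph.sources.card :=
      Finset.card_pos.2 ⟨e, by simp [OrientedGraph.sources, hs]⟩
    rw [D.card_sources] at this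
    have h3 : (0 : ℤ) ≤ ∑ v, |D.L v + D.R v| := Finset.sum_nonneg fun _ _ => abs_nonneg _
    push_cast
    omega
  · obtain ⟨u, hu⟩ := Option.ne_none_iff_exists'.1 hs
    have h2 : ∑ v ∈ U, D.toOrientedGraph.divergence D.w v ≤ (eMinus Δ : ℤ) - D.w e := by
      rw [sum_divergence, ← D.card_sources, OrientedGraph.sources, Finset.card_filter]
      push_cast
      rw [← Finset.add_sum_erase _ _ (Finset.mem_univ e),
        ← Finset.add_sum_erase (Finset.univ : Finset D.E)
          (fun e => if D.src e = none then (1 : ℤ) else 0) (Finset.mem_univ e)]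
      have ht : ¬ ∃ v ∈ U, D.tgt e = some v := by
        rintro ⟨v, hv, hv'⟩
        rw [hU] at hv
        exact D.acyclic _ (.head (.enter _ _ hv') hv)
      have hs' : ∃ v ∈ U, D.src e = some v :=
        ⟨u, (hU u).2 (.single (.leave _ _ hu)), hu⟩
      rw [if_neg ht, if_pos hs', if_neg hs]
      have : ∀ f ∈ Finset.univ.erase e,
          ((if ∃ v ∈ U, D.tgt f = some v then (D.w f : ℤ) else 0) -
            if ∃ v ∈ U, D.src f = some v then (D.w f : ℤ) else 0) ≤
          if D.src f = none then (1 : ℤ) else 0 := by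
        intro f _
        by_cases hf : D.src f = none
        · rw [if_pos hf, D.w_infinite f (.inl hf)]
          split_ifs <;> simp
        · rw [if_neg hf]
          obtain ⟨x, hx⟩ := Option.ne_none_iff_exists'.1 hf
          by_cases hft : ∃ v ∈ U, D.tgt f = some v
          · have hfs : ∃ v ∈ U, D.src f = some v := by
              obtain ⟨v, hv, hv'⟩ := hft
              refine ⟨x, (hU x).2 ?_, hx⟩
              exact .head (.leave _ _ hx) (.head (.enter _ _ hv') ((hU v).1 hv))
            rw [if_pos hft, if_pos hfs, sub_self]
          · rw [if_neg hft]
            split_ifs <;> simp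
      have := Finset.sum_le_sum this
      linarith
    linarith

end FloorDiagram

theorem finite_looseCodes (Δ : Set (ℝ × ℝ)) (g n : ℕ) : (looseCodes Δ g n).Finite := by
  classical
  rcases (looseCodes Δ g n).eq_empty_or_nonempty with h | ⟨-, D₀, -⟩
  · rw [h]; exact Set.finite_empty
  let M : ℤ := ∑ u : D₀.V, (|D₀.L u| + |D₀.R u|)
  let K : ℕ := (eMinus Δ + Fintype.card D₀.V * (M + M)).toNat
  let O : Set (Option ℕ) := insert none (some '' Set.Icc 1 n)
  let Z : Set Cell := insert .empty
    ((fun x : ℤ × ℤ => Cell.vert x.1 x.2) '' (Set.range D₀.L ×ˢ Set.range D₀.R) ∪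
      (fun x : Option ℕ × Option ℕ × ℕ => Cell.edge x.1 x.2.1 x.2.2) '' (O ×ˢ O ×ˢ Set.Iic K))
  have hO : O.Finite := ((Set.finite_Icc 1 n).image _).insert _
  have hZ : Z.Finite :=
    ((((Set.finite_range _).prod (Set.finite_range _)).image _).union
      ((hO.prod (hO.prod (Set.finite_Iic K))).image _)).insert _
  have hM : ∀ u, |D₀.L u| ≤ M ∧ |D₀.R u| ≤ M := by
    intro u
    have := Finset.single_le_sum (f := fun u => |D₀.L u| + |D₀.R u|)
      (fun u _ => by positivity) (Finset.mem_univ u)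
    have h1 := abs_nonneg (D₀.L u)
    have h2 := abs_nonneg (D₀.R u)
    constructor <;> linarith
  have hc : ∀ c ∈ looseCodes Δ g n, ∀ j, c j ∈ Z ∧ (n < j → c j = .empty) := by
    rintro c ⟨D, m, hm, hr, rfl⟩ j
    by_cases hj : ∃ α, m α = j
    · obtain ⟨α, rfl⟩ := hj
      have hmα : ∀ α, m α ∈ Set.Icc 1 n := fun α => hr ▸ ⟨α, rfl⟩
      refine ⟨?_, fun h => absurd (hmα α).2 (by omega)⟩
      rw [FloorDiagram.code_apply hm]
      rcases α with v | e
      · obtain ⟨v', hv'⟩ := D.exists_L_eq D₀ v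
        obtain ⟨v'', hv''⟩ := D.exists_R_eq D₀ v
        exact .inr (.inl ⟨(D.L v, D.R v), ⟨⟨v', hv'⟩, ⟨v'', hv''⟩⟩, rfl⟩)
      · have hmem : ∀ o : Option D.V, (o.map fun v => m (.inl v)) ∈ O := by
          intro o
          cases o with
          | none => exact .inl rfl
          | some v => exact .inr ⟨_, hmα _, rfl⟩
        refine .inr (.inr ⟨(_, _, _), ⟨hmem _, hmem _, ?_⟩, rfl⟩)
        have h1 := D.w_le e
        have h2 : ∑ v, |D.L v + D.R v| ≤ Fintype.card D₀.V * (M + M) := by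
          rw [← D.card_eq D₀, ← nsmul_eq_mul]
          refine Finset.sum_le_card_nsmul _ _ _ fun v _ => ?_
          obtain ⟨v', hv'⟩ := D.exists_L_eq D₀ v
          obtain ⟨v'', hv''⟩ := D.exists_R_eq D₀ v
          rw [← hv', ← hv'']
          exact (abs_add_le _ _).trans (add_le_add (hM v').1 (hM v'').2)
        change D.w e ≤ K
        have h3 := h1.trans (add_le_add_right h2 _)
        omega
    · rw [FloorDiagram.code_of_not_mem (not_exists.1 hj)]
      exact ⟨.inl rfl, fun _ => rfl⟩
  have hfin : (Set.pi Set.univ fun _ : Fin (n + 1) => Z).Finite := Set.Finite.pi fun _ => hZ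
  refine Set.Finite.of_injOn (f := fun c (i : Fin (n + 1)) => c i)
    (t := Set.pi Set.univ fun _ : Fin (n + 1) => Z) ?_ ?_ hfin
  · intro c h i _
    exact (hc c h i).1
  · intro c h c' h' he
    funext j
    by_cases hj : j < n + 1
    · exact congrFun he ⟨j, hj⟩
    · rw [(hc c h j).2 (by omega), (hc c' h' j).2 (by omega)]

theorem finite_codes (Δ : Set (ℝ × ℝ)) (g n : ℕ) : (codes Δ g n).Finite :=
  (finite_looseCodes Δ g n).subset fun _ h => h.1

end

section

variable {Δ : Set (ℝ × ℝ)} {g n : ℕ}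

/-! ### Changing two edges of a diagram -/

theorem connected_of_reachable {V W : Type*} {G : SimpleGraph V} {H : SimpleGraph W}
    (hG : G.Connected) (f : V → W) (hf : Function.Surjective f)
    (h : ∀ u v, G.Adj u v → H.Reachable (f u) (f v)) : H.Connected := by
  have key : ∀ u v, G.Reachable u v → H.Reachable (f u) (f v) := by
    intro u v huv
    rw [SimpleGraph.reachable_iff_reflTransGen] at huv
    induction huv with
    | refl => exact .rfl
    | tail _ h' ih => exact ih.trans (h _ _ h')
  have := hG.nonempty
  refine (SimpleGraph.connected_iff _).2 ⟨fun a b => ?_, this.map f⟩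
  obtain ⟨u, rfl⟩ := hf a
  obtain ⟨v, rfl⟩ := hf b
  exact key u v (hG.preconnected u v)

namespace OrientedGraph

theorem underlying_adj_of {Γ : OrientedGraph} {e : Γ.E} {u v : Γ.V} (hne : u ≠ v)
    (hs : Γ.src e = some u) (ht : Γ.tgt e = some v) : Γ.underlying.Adj u v := by
  rw [underlying, SimpleGraph.fromRel_adj]
  exact ⟨hne, .inl ⟨e, hs, ht⟩⟩

theorem reachable_of {Γ : OrientedGraph} {e : Γ.E} {u v : Γ.V}
    (hs : Γ.src e = some u) (ht : Γ.tgt e = some v) : Γ.underlying.Reachable u v := by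
  by_cases hne : u = v
  · rw [hne]
  · exact (underlying_adj_of hne hs ht).reachable

theorem card_connectedComponent {Γ : OrientedGraph} (h : Γ.underlying.Connected) :
    Nat.card Γ.underlying.ConnectedComponent = 1 := by
  have hne := h.nonempty
  have := h.preconnected.subsingleton_connectedComponent
  have : Nonempty Γ.underlying.ConnectedComponent :=
    ⟨Γ.underlying.connectedComponentMk hne.some⟩
  exact Nat.card_unique

theorem acyclic_of_increasing {Γ : OrientedGraph} {m : Γ.V ⊕ Γ.E → ℕ}
    (h : ∀ α β, Γ.Step α β → m α < m β) : Γ.Acyclic := by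
  have key : ∀ α β, Γ.Prec α β → m α < m β := by
    intro α β hp
    induction hp with
    | single h' => exact h _ _ h'
    | tail _ h' ih => exact ih.trans (h _ _ h')
  exact fun α hα => lt_irrefl _ (key α α hα)

open Classical in
theorem divergence_eq_sum (Γ : OrientedGraph) (w : Γ.E → ℕ) (v : Γ.V) :
    Γ.divergence w v = ∑ e, ((if Γ.tgt e = some v then (w e : ℤ) else 0) -
      if Γ.src e = some v then (w e : ℤ) else 0) := by
  simp only [divergence, Finset.sum_sub_distrib, Finset.sum_filter]

/-- The graph with other end points of the edges. -/
@[reducible]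
def modify (Γ : OrientedGraph) (src tgt : Γ.E → Option Γ.V)
    (h : ∀ e, src e ≠ none ∨ tgt e ≠ none) : OrientedGraph :=
  { Γ with src := src, tgt := tgt, adjacent_vertex := h }

end OrientedGraph

/-- The diagram with other end points and weights of the edges. -/
@[reducible]
def FloorDiagram.modify (D : FloorDiagram Δ g) (src tgt : D.E → Option D.V) (w : D.E → ℕ)
    (hs : ∀ e, src e = none ↔ D.src e = none) (ht : ∀ e, tgt e = none ↔ D.tgt e = none)
    (hw : ∀ e, 0 < w e) (hwi : ∀ e, src e = none ∨ tgt e = none → w e = 1)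
    (h : ∀ e, src e ≠ none ∨ tgt e ≠ none)
    (hc : (D.toOrientedGraph.modify src tgt h).underlying.Connected)
    (ha : (D.toOrientedGraph.modify src tgt h).Acyclic)
    (hd : ∀ v, (D.toOrientedGraph.modify src tgt h).divergence w v =
      D.toOrientedGraph.divergence D.w v) : FloorDiagram Δ g where
  toOrientedGraph := D.toOrientedGraph.modify src tgt h
  w := w
  L := D.L
  R := D.R
  w_pos := hw
  connected := hc
  acyclic := ha
  genus_eq := by
    have h1 := D.genus_eq
    rw [OrientedGraph.genus, OrientedGraph.card_connectedComponent D.connected] at h1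
    rw [OrientedGraph.genus, OrientedGraph.card_connectedComponent hc, ← h1]
    congr 3
    simp only [OrientedGraph.boundedEdges, hs, ht, ne_eq]
  card_V := D.card_V
  card_sinks := by
    rw [← D.card_sinks]
    simp only [OrientedGraph.sinks, ht]
  card_sources := by
    rw [← D.card_sources]
    simp only [OrientedGraph.sources, hs]
  w_infinite := hwi
  L_bij := D.L_bij
  R_bij := D.R_bij
  div_eq := fun v => by rw [hd, D.div_eq]

/-- The contribution of an edge to the divergence at `x`. -/
def flow (s t : Option ℕ) (w x : ℕ) : ℤ :=
  (if t = some x then (w : ℤ) else 0) - if s = some x then (w : ℤ) else 0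

theorem exchange_mem {c : ℕ → Cell} (hc : c ∈ looseCodes Δ g n) {e f : ℕ} (hef : e ≠ f)
    {s₁ t₁ s₂ t₂ : Option ℕ} {w₁ w₂ : ℕ} (hce : c e = .edge s₁ t₁ w₁) (hcf : c f = .edge s₂ t₂ w₂)
    {s₁' t₁' s₂' t₂' : Option ℕ} {w₁' w₂' : ℕ}
    (hs₁ : s₁' = none ↔ s₁ = none) (ht₁ : t₁' = none ↔ t₁ = none)
    (hs₂ : s₂' = none ↔ s₂ = none) (ht₂ : t₂' = none ↔ t₂ = none)
    (hv : ∀ x, s₁' = some x ∨ t₁' = some x ∨ s₂' = some x ∨ t₂' = some x →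
      ∃ l r, c x = .vert l r)
    (hw₁ : 0 < w₁') (hw₂ : 0 < w₂') (hi₁ : s₁' = none ∨ t₁' = none → w₁' = 1)
    (hi₂ : s₂' = none ∨ t₂' = none → w₂' = 1)
    (hd : ∀ x, flow s₁' t₁' w₁' x + flow s₂' t₂' w₂' x = flow s₁ t₁ w₁ x + flow s₂ t₂ w₂ x)
    (ha : ∃ ρ : ℕ → ℕ, ∀ a b, codeStep (Function.update
      (Function.update c e (.edge s₁' t₁' w₁')) f (.edge s₂' t₂' w₂')) a b → ρ a < ρ b)
    (hr₁ : ∀ a b, s₁ = some a → t₁ = some b → Relation.EqvGen (fun x y =>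
      (s₁' = some x ∧ t₁' = some y) ∨ (s₂' = some x ∧ t₂' = some y)) a b)
    (hr₂ : ∀ a b, s₂ = some a → t₂ = some b → Relation.EqvGen (fun x y =>
      (s₁' = some x ∧ t₁' = some y) ∨ (s₂' = some x ∧ t₂' = some y)) a b) :
    Function.update (Function.update c e (.edge s₁' t₁' w₁')) f (.edge s₂' t₂' w₂') ∈
      looseCodes Δ g n := by
  classical
  obtain ⟨D, m, hm, hr, rfl⟩ := hc
  obtain ⟨e, rfl, rfl, rfl, rfl⟩ := FloorDiagram.code_eq_edge hm hce
  obtain ⟨f, rfl, rfl, rfl, rfl⟩ := FloorDiagram.code_eq_edge hm hcf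
  have hef' : e ≠ f := fun h => hef (by rw [h])
  have hlift : ∀ o : Option ℕ, (∀ x, o = some x → ∃ l r, D.code m x = .vert l r) →
      ∃ o' : Option D.V, (o'.map fun v => m (.inl v)) = o := by
    intro o ho
    cases o with
    | none => exact ⟨none, rfl⟩
    | some x =>
      obtain ⟨l, r, h⟩ := ho x rfl
      obtain ⟨v, rfl, -⟩ := FloorDiagram.code_eq_vert hm h
      exact ⟨some v, rfl⟩
  obtain ⟨s₁', rfl⟩ := hlift s₁' fun x h => hv x (by simp [h])
  obtain ⟨t₁', rfl⟩ := hlift t₁' fun x h => hv x (by simp [h])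
  obtain ⟨s₂', rfl⟩ := hlift s₂' fun x h => hv x (by simp [h])
  obtain ⟨t₂', rfl⟩ := hlift t₂' fun x h => hv x (by simp [h])
  simp only [Option.map_eq_none_iff] at hs₁ ht₁ hs₂ ht₂ hi₁ hi₂
  let src := Function.update (Function.update D.src e s₁') f s₂'
  let tgt := Function.update (Function.update D.tgt e t₁') f t₂'
  let w := Function.update (Function.update D.w e w₁') f w₂'
  have se : src e = s₁' := by simp [src, hef']
  have sf : src f = s₂' := by simp [src]
  have te : tgt e = t₁' := by simp [tgt, hef']
  have tf : tgt f = t₂' := by simp [tgt]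
  have we : w e = w₁' := by simp [w, hef']
  have wf : w f = w₂' := by simp [w]
  have hoth : ∀ x, x ≠ e → x ≠ f → src x = D.src x ∧ tgt x = D.tgt x ∧ w x = D.w x := by
    intro x h1 h2
    simp [src, tgt, w, h1, h2]
  have hcases : ∀ P : D.E → Prop, P e → P f → (∀ x, x ≠ e → x ≠ f → P x) → ∀ x, P x := by
    intro P h1 h2 h3 x
    by_cases hxe : x = e
    · rwa [hxe]
    · by_cases hxf : x = f
      · rwa [hxf]
      · exact h3 x hxe hxf
  have hsrc : ∀ x, src x = none ↔ D.src x = none :=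
    hcases _ (by rw [se, hs₁]) (by rw [sf, hs₂]) fun x h1 h2 => by rw [(hoth x h1 h2).1]
  have htgt : ∀ x, tgt x = none ↔ D.tgt x = none :=
    hcases _ (by rw [te, ht₁]) (by rw [tf, ht₂]) fun x h1 h2 => by rw [(hoth x h1 h2).2.1]
  have hw : ∀ x, 0 < w x :=
    hcases _ (by rwa [we]) (by rwa [wf]) fun x h1 h2 => by
      rw [(hoth x h1 h2).2.2]; exact D.w_pos x
  have hwi : ∀ x, src x = none ∨ tgt x = none → w x = 1 :=
    hcases _ (by rwa [we, se, te]) (by rwa [wf, sf, tf]) fun x h1 h2 => by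
      rw [(hoth x h1 h2).1, (hoth x h1 h2).2.1, (hoth x h1 h2).2.2]
      exact D.w_infinite x
  have hadj : ∀ x, src x ≠ none ∨ tgt x ≠ none := fun x => by
    rw [ne_eq, ne_eq, hsrc, htgt]; exact D.adjacent_vertex x
  let M : D.V → ℕ := fun v => m (.inl v)
  set c' := Function.update (Function.update (D.code m) (m (.inr e))
    (.edge (s₁'.map M) (t₁'.map M) w₁')) (m (.inr f)) (.edge (s₂'.map M) (t₂'.map M) w₂') with hc'
  have cv : ∀ v, c' (m (.inl v)) = .vert (D.L v) (D.R v) := by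
    intro v
    rw [hc', Function.update_of_ne (FloorDiagram.inl_ne_inr hm _ _),
      Function.update_of_ne (FloorDiagram.inl_ne_inr hm _ _), FloorDiagram.code_inl hm]
  have ce : ∀ x, c' (m (.inr x)) = .edge ((src x).map M) ((tgt x).map M) (w x) := by
    refine hcases _ ?_ ?_ ?_
    · rw [hc', Function.update_of_ne hef, Function.update_self, se, te, we]
    · rw [hc', Function.update_self, sf, tf, wf]
    · intro x h1 h2
      rw [hc', Function.update_of_ne fun h => h2 (FloorDiagram.inr_inj hm h),
        Function.update_of_ne fun h => h1 (FloorDiagram.inr_inj hm h), FloorDiagram.code_inr hm,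
        (hoth x h1 h2).1, (hoth x h1 h2).2.1, (hoth x h1 h2).2.2]
  have hac : (D.toOrientedGraph.modify src tgt hadj).Acyclic := by
    obtain ⟨ρ, hρ⟩ := ha
    refine OrientedGraph.acyclic_of_increasing (m := fun α => ρ (m α)) ?_
    rintro _ _ (⟨v, x, h⟩ | ⟨x, v, h⟩)
    · refine hρ _ _ ?_
      simp only [codeStep, cv, ce]
      exact (FloorDiagram.map_mark_eq_some hm _ _).2 h
    · refine hρ _ _ ?_
      simp only [codeStep, cv, ce]
      exact (FloorDiagram.map_mark_eq_some hm _ _).2 h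
  have hconn : (D.toOrientedGraph.modify src tgt hadj).underlying.Connected := by
    set G := (D.toOrientedGraph.modify src tgt hadj).underlying
    have hP : ∀ a b : ℕ, Relation.EqvGen (fun x y => (s₁'.map M = some x ∧ t₁'.map M = some y) ∨
        (s₂'.map M = some x ∧ t₂'.map M = some y)) a b →
        a = b ∨ ∃ u v, M u = a ∧ M v = b ∧ G.Reachable u v := by
      intro a b hab
      induction hab with
      | rel a b h =>
        right
        rcases h with ⟨h1, h2⟩ | ⟨h1, h2⟩
        · obtain ⟨u, hu, rfl⟩ := Option.map_eq_some_iff.1 h1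
          obtain ⟨v, hv, rfl⟩ := Option.map_eq_some_iff.1 h2
          exact ⟨u, v, rfl, rfl, OrientedGraph.reachable_of
            (Γ := D.toOrientedGraph.modify src tgt hadj) (se.trans hu) (te.trans hv)⟩
        · obtain ⟨u, hu, rfl⟩ := Option.map_eq_some_iff.1 h1
          obtain ⟨v, hv, rfl⟩ := Option.map_eq_some_iff.1 h2
          exact ⟨u, v, rfl, rfl, OrientedGraph.reachable_of
            (Γ := D.toOrientedGraph.modify src tgt hadj) (sf.trans hu) (tf.trans hv)⟩
      | refl a => exact .inl rfl
      | symm a b _ ih =>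
        rcases ih with rfl | ⟨u, v, hu, hv, h⟩
        · exact .inl rfl
        · exact .inr ⟨v, u, hv, hu, h.symm⟩
      | trans a b c _ _ ih ih' =>
        rcases ih with rfl | ⟨u, v, hu, hv, h⟩
        · exact ih'
        · rcases ih' with rfl | ⟨u', v', hu', hv', h'⟩
          · exact .inr ⟨u, v, hu, hv, h⟩
          · have : v = u' := FloorDiagram.inl_inj hm (hv.trans hu'.symm)
            subst this
            exact .inr ⟨u, v', hu, hv', h.trans h'⟩
    have hP' : ∀ u v, Relation.EqvGen (fun x y => (s₁'.map M = some x ∧ t₁'.map M = some y) ∨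
        (s₂'.map M = some x ∧ t₂'.map M = some y)) (M u) (M v) → G.Reachable u v := by
      intro u v h
      rcases hP _ _ h with h | ⟨u', v', hu, hv, h⟩
      · rw [FloorDiagram.inl_inj hm h]
      · rwa [← FloorDiagram.inl_inj hm hu, ← FloorDiagram.inl_inj hm hv]
    have hall : ∀ x u v, D.src x = some u → D.tgt x = some v → G.Reachable u v := by
      refine hcases _ ?_ ?_ ?_
      · intro u v hu hv
        exact hP' u v (hr₁ _ _ (by rw [hu]; rfl) (by rw [hv]; rfl))
      · intro u v hu hv
        exact hP' u v (hr₂ _ _ (by rw [hu]; rfl) (by rw [hv]; rfl))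
      · intro x h1 h2 u v hu hv
        exact OrientedGraph.reachable_of (Γ := D.toOrientedGraph.modify src tgt hadj) (e := x)
          ((hoth x h1 h2).1.trans hu) ((hoth x h1 h2).2.1.trans hv)
    refine connected_of_reachable D.connected id Function.surjective_id fun u v h => ?_
    rw [OrientedGraph.underlying, SimpleGraph.fromRel_adj] at h
    rcases h with ⟨-, ⟨x, hu, hv⟩ | ⟨x, hu, hv⟩⟩
    · exact hall x u v hu hv
    · exact (hall x v u hu hv).symm
  have hdiv : ∀ v, (D.toOrientedGraph.modify src tgt hadj).divergence w v =
      D.toOrientedGraph.divergence D.w v := by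
    intro v
    have hfl : ∀ (s t : Option D.V) (k : ℕ), flow (s.map M) (t.map M) k (M v) =
        (if t = some v then (k : ℤ) else 0) - if s = some v then (k : ℤ) else 0 := by
      intro s t k
      rw [flow]
      congr 1
      · exact if_congr (FloorDiagram.map_mark_eq_some hm _ _) rfl rfl
      · exact if_congr (FloorDiagram.map_mark_eq_some hm _ _) rfl rfl
    have h := hd (M v)
    rw [hfl, hfl] at h
    have h' := h.trans (congrArg₂ _ (hfl _ _ _) (hfl _ _ _))
    rw [OrientedGraph.divergence_eq_sum, OrientedGraph.divergence_eq_sum,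
      ← Finset.add_sum_erase _ _ (Finset.mem_univ e), ← Finset.add_sum_erase
        (Finset.univ : Finset D.E) _ (Finset.mem_univ e)]
    have hfe : f ∈ (Finset.univ : Finset D.E).erase e := by simp [hef'.symm]
    rw [← Finset.add_sum_erase _ _ hfe, ← Finset.add_sum_erase _ _ hfe]
    rw [← add_assoc, ← add_assoc]
    congr 1
    · simp only [se, sf, te, tf, we, wf]
      convert h' using 3
    · refine Finset.sum_congr rfl fun x hx => ?_
      have h1 : x ≠ f := (Finset.mem_erase.1 hx).1
      have h2 : x ≠ e := (Finset.mem_erase.1 (Finset.mem_erase.1 hx).2).1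
      simp only [(hoth x h2 h1).1, (hoth x h2 h1).2.1, (hoth x h2 h1).2.2]
  refine ⟨D.modify src tgt w hsrc htgt hw hwi hadj hconn hac hdiv, m, hm, hr, ?_⟩
  funext j
  by_cases hj : ∃ α, m α = j
  · obtain ⟨α, rfl⟩ := hj
    rw [FloorDiagram.code_apply
      (D := D.modify src tgt w hsrc htgt hw hwi hadj hconn hac hdiv) hm]
    rcases α with v | x
    · rw [cv]; rfl
    · rw [ce]; rfl
  · rw [FloorDiagram.code_of_not_mem
      (D := D.modify src tgt w hsrc htgt hw hwi hadj hconn hac hdiv) (not_exists.1 hj), hc',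
      Function.update_of_ne fun h => hj ⟨_, h.symm⟩, Function.update_of_ne fun h => hj ⟨_, h.symm⟩,
      FloorDiagram.code_of_not_mem (not_exists.1 hj)]

end

section

variable {Δ : Set (ℝ × ℝ)} {g n : ℕ}

/-! ### Properties of codes -/

section LooseCodes

variable {c : ℕ → Cell} (hc : c ∈ looseCodes Δ g n)

include hc

theorem src_eq_vert {b w a : ℕ} {t : Option ℕ} (h : c b = .edge (some a) t w) :
    ∃ l r, c a = .vert l r := by
  obtain ⟨D, m, hm, hr, rfl⟩ := hc
  obtain ⟨e, -, hs, -⟩ := FloorDiagram.code_eq_edge hm h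
  obtain ⟨v, -, rfl⟩ := Option.map_eq_some_iff.1 hs
  exact ⟨_, _, FloorDiagram.code_inl hm v⟩

theorem tgt_eq_vert {b w a : ℕ} {s : Option ℕ} (h : c b = .edge s (some a) w) :
    ∃ l r, c a = .vert l r := by
  obtain ⟨D, m, hm, hr, rfl⟩ := hc
  obtain ⟨e, -, -, ht, -⟩ := FloorDiagram.code_eq_edge hm h
  obtain ⟨v, -, rfl⟩ := Option.map_eq_some_iff.1 ht
  exact ⟨_, _, FloorDiagram.code_inl hm v⟩

theorem src_ne_tgt {b w a : ℕ} {s t : Option ℕ} (h : c b = .edge s t w) (hs : s = some a) :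
    t ≠ some a := by
  obtain ⟨D, m, hm, hr, rfl⟩ := hc
  obtain ⟨e, -, rfl, rfl, -⟩ := FloorDiagram.code_eq_edge hm h
  intro ht
  obtain ⟨v, hv, rfl⟩ := Option.map_eq_some_iff.1 hs
  rw [FloorDiagram.map_mark_eq_some hm] at ht
  exact D.acyclic _ (.head (.leave _ _ hv) (.single (.enter _ _ ht)))

theorem weight_pos {b w : ℕ} {s t : Option ℕ} (h : c b = .edge s t w) : 0 < w := by
  obtain ⟨D, m, hm, hr, rfl⟩ := hc
  obtain ⟨e, -, -, -, rfl⟩ := FloorDiagram.code_eq_edge hm h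
  exact D.w_pos e

theorem weight_infinite {b w : ℕ} {s t : Option ℕ} (h : c b = .edge s t w)
    (hst : s = none ∨ t = none) : w = 1 := by
  obtain ⟨D, m, hm, hr, rfl⟩ := hc
  obtain ⟨e, -, rfl, rfl, rfl⟩ := FloorDiagram.code_eq_edge hm h
  exact D.w_infinite e (by simpa using hst)

theorem ne_empty {j : ℕ} (h1 : 1 ≤ j) (h2 : j ≤ n) : c j ≠ .empty := by
  obtain ⟨D, m, hm, hr, rfl⟩ := hc
  have : j ∈ Set.range m := by rw [hr]; exact ⟨h1, h2⟩
  obtain ⟨α, rfl⟩ := this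
  rw [FloorDiagram.code_apply hm]
  rcases α with v | e <;> simp [FloorDiagram.cell]

theorem relabel_mem (σ : Equiv.Perm ℕ) (hσ : σ '' Set.Icc 1 n = Set.Icc 1 n) :
    relabel σ c ∈ looseCodes Δ g n := by
  obtain ⟨D, m, hm, hr, rfl⟩ := hc
  refine ⟨D, σ ∘ m, σ.injective.comp hm, ?_, FloorDiagram.code_relabel hm σ⟩
  rw [Set.range_comp, hr, hσ]

end LooseCodes

theorem codeStep_src {c : ℕ → Cell} (hc : c ∈ looseCodes Δ g n) {b w a : ℕ} {s t : Option ℕ}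
    (h : c b = .edge s t w) (hs : s = some a) : codeStep c a b := by
  subst hs
  obtain ⟨l, r, h'⟩ := src_eq_vert hc h
  simp [codeStep, h, h']

theorem codeStep_tgt {c : ℕ → Cell} (hc : c ∈ looseCodes Δ g n) {b w a : ℕ} {s t : Option ℕ}
    (h : c b = .edge s t w) (ht : t = some a) : codeStep c b a := by
  subst ht
  obtain ⟨l, r, h'⟩ := tgt_eq_vert hc h
  simp [codeStep, h, h']

theorem codeStep_cases {c : ℕ → Cell} {a b : ℕ} (h : codeStep c a b) :
    (∃ l r t w, c a = .vert l r ∧ c b = .edge (some a) t w) ∨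
      ∃ l r s w, c b = .vert l r ∧ c a = .edge s (some b) w := by
  unfold codeStep at h
  split at h
  · rename_i h1 h2
    subst h
    exact .inl ⟨_, _, _, _, h1, h2⟩
  · rename_i h1 h2
    subst h
    exact .inr ⟨_, _, _, _, h2, h1⟩
  · exact h.elim

/-! ### The local contributions -/

open Classical in
/-- The difference of the factors of three elements in the order `a, b, d`, the pair being
`{a, b}` or `{b, d}`. -/
def localTerm (c : ℕ → Cell) (a b d : ℕ) : QField :=
  if codeStep c b a ∨ codeStep c d a ∨ codeStep c d b then 0
  else pairWeight c a b * (c d).weight - (c a).weight * pairWeight c b d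

/-- The sum of the local contributions over all orders of three elements. -/
def localSum (c : ℕ → Cell) (a b d : ℕ) : QField :=
  localTerm c a b d + localTerm c a d b + localTerm c b a d + localTerm c b d a +
    localTerm c d a b + localTerm c d b a

theorem localSum_swap_left (c : ℕ → Cell) (a b d : ℕ) : localSum c a b d = localSum c b a d := by
  simp only [localSum]; ring

theorem localSum_swap_right (c : ℕ → Cell) (a b d : ℕ) : localSum c a b d = localSum c a d b := by
  simp only [localSum]; ring

theorem localSum_edges {c : ℕ → Cell} {a b d : ℕ} {s t s' t' s'' t'' : Option ℕ} {w w' w'' : ℕ}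
    (ha : c a = .edge s t w) (hb : c b = .edge s' t' w') (hd : c d = .edge s'' t'' w'') :
    localSum c a b d = 0 := by
  have hp : ∀ x y : ℕ, ∀ {s t s' t' w w'}, c x = .edge s t w → c y = .edge s' t' w' →
      pairWeight c x y = pairWeight c y x := by
    intro x y s t s' t' w w' hx hy
    simp only [pairWeight, hx, hy]
    congr 1
    · rw [eq_comm (a := s), eq_comm (a := t)]
      refine propext ⟨?_, ?_⟩ <;>
      · rintro (⟨h, h'⟩ | ⟨h, h'⟩) <;> simp_all
    · rw [mul_comm (qInt w'), add_comm (w' : ℤ)]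
  simp only [localSum, localTerm, codeStep, ha, hb, hd, or_self, if_false]
  rw [hp b a hb ha, hp d a hd ha, hp d b hd hb]
  ring

theorem localSum_vertices {c : ℕ → Cell} {a b d : ℕ} {l r l' r' l'' r'' : ℤ}
    (ha : c a = .vert l r) (hb : c b = .vert l' r') (hd : c d = .vert l'' r'') :
    localSum c a b d = 0 := by
  simp [localSum, localTerm, codeStep, pairWeight, ha, hb, hd]

theorem localSum_two_vertices {c : ℕ → Cell} (hc : c ∈ looseCodes Δ g n) {a b d : ℕ}
    (hab : a ≠ b) {l r l' r' : ℤ} {s t : Option ℕ} {w : ℕ}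
    (ha : c a = .vert l r) (hb : c b = .vert l' r') (hd : c d = .edge s t w) :
    localSum c a b d = 0 := by
  have h1 : s = some a → t ≠ some a := src_ne_tgt hc hd
  have h2 : s = some b → t ≠ some b := src_ne_tgt hc hd
  simp only [localSum, localTerm, codeStep, pairWeight, ha, hb, hd, Cell.weight]
  by_cases sa : s = some a <;> by_cases sb : s = some b <;> by_cases ta : t = some a <;>
    by_cases tb : t = some b <;> simp_all

end

section

variable {Δ : Set (ℝ × ℝ)} {g n : ℕ}

theorem localSum_chain {c : ℕ → Cell} (hc : c ∈ looseCodes Δ g n) {e v f : ℕ} {l r : ℤ}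
    {s t : Option ℕ} {A B : ℕ} (hv : c v = .vert l r) (he : c e = .edge s (some v) A)
    (hf : c f = .edge (some v) t B) :
    localSum c e v f = -(2 * (qInt A * qInt B * qInt (A - B) / qInt 2)) := by
  have h1 : s ≠ some v := fun h => src_ne_tgt hc he h rfl
  have h2 : t ≠ some v := src_ne_tgt hc hf rfl
  rw [← qIntTwo_mul_sub]
  simp [localSum, localTerm, codeStep, pairWeight, he, hf, hv, Cell.weight, h1, h2]

theorem localSum_forkTail {c : ℕ → Cell} {e v f u : ℕ} {l r : ℤ}
    {t : Option ℕ} {A B : ℕ} (hv : c v = .vert l r) (he : c e = .edge (some u) (some v) A)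
    (hf : c f = .edge (some u) t B) (h1 : u ≠ v) (h2 : t ≠ some v) :
    localSum c e v f = 2 * (qInt A * qInt B * qInt (A + B) / qInt 2) := by
  simp only [localSum, localTerm, codeStep, pairWeight, he, hf, hv, Cell.weight, h2, h2.symm]
  simp [h1, add_comm (B : ℤ)]
  ring

theorem localSum_forkHead {c : ℕ → Cell} {e v f x : ℕ} {l r : ℤ}
    {s : Option ℕ} {A B : ℕ} (hv : c v = .vert l r) (he : c e = .edge s (some x) A)
    (hf : c f = .edge (some v) (some x) B) (h1 : x ≠ v) (h2 : s ≠ some v) :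
    localSum c e v f = -(2 * (qInt A * qInt B * qInt (A + B) / qInt 2)) := by
  simp only [localSum, localTerm, codeStep, pairWeight, he, hf, hv, Cell.weight, h2, h2.symm]
  simp [h1, add_comm (B : ℤ)]
  ring

/-- The edges `e` and `f` form a chain at the vertex `v`, leave a common vertex, or enter a common
vertex. -/
def IsExchangeable (v : ℕ) (s t s' t' : Option ℕ) : Prop :=
  (t = some v ∧ s' = some v) ∨ (t = some v ∧ s = s' ∧ s ≠ none ∧ t' ≠ some v) ∨
    (s' = some v ∧ t = t' ∧ t ≠ none ∧ s ≠ some v)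

theorem isExchangeable_of_localSum_ne_zero {c : ℕ → Cell} (hc : c ∈ looseCodes Δ g n)
    {e v f : ℕ} {l r : ℤ} {s t s' t' : Option ℕ} {A B : ℕ} (hv : c v = .vert l r)
    (he : c e = .edge s t A) (hf : c f = .edge s' t' B) (h0 : localSum c e v f ≠ 0) :
    IsExchangeable v s t s' t' ∨ IsExchangeable v s' t' s t := by
  by_contra hN
  simp only [not_or, IsExchangeable] at hN
  obtain ⟨⟨n1, n2, n3⟩, n4, n5, n6⟩ := hN
  apply h0
  have h1 : s = some v → t ≠ some v := src_ne_tgt hc he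
  have h2 : s' = some v → t' ≠ some v := src_ne_tgt hc hf
  have key := qIntTwo_mul_add A B
  have hcomm : qInt ((B : ℤ) + A) = qInt (A + B) := by rw [add_comm]
  simp only [localSum, localTerm, codeStep, pairWeight, he, hf, hv, Cell.weight, hcomm]
  by_cases a1 : s = some v
  · have a2 := h1 a1
    by_cases b1 : s' = some v
    · have b2 := h2 b1
      simp [a1, a2, b1, b2]
      linear_combination key
    · by_cases b2 : t' = some v
      · exact absurd ⟨b2, a1⟩ n4
      · by_cases ht : t = t' ∧ t ≠ none
        · exact absurd ⟨a1, ht.1.symm, ht.1 ▸ ht.2, b1⟩ n6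
        · have hc1 : ¬ (t ≠ none ∧ t = t') := fun h => ht ⟨h.2, h.1⟩
          have hc2 : ¬ (t' ≠ none ∧ t' = t) := fun h => ht ⟨h.2.symm, h.2 ▸ h.1⟩
          have b1' : ¬ some v = s' := fun h => b1 h.symm
          simp only [hc1, hc2, a1, a2, b1, b1', b2]
          simp
          try ring
  · by_cases a2 : t = some v
    · by_cases b1 : s' = some v
      · exact absurd ⟨a2, b1⟩ n1
      · by_cases b2 : t' = some v
        · simp [a1, a2, b1, b2]
          linear_combination -key
        · by_cases ht : s = s' ∧ s ≠ none
          · exact absurd ⟨a2, ht.1, ht.2, b2⟩ n2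
          · have hc1 : ¬ (s ≠ none ∧ s = s') := fun h => ht ⟨h.2, h.1⟩
            have hc2 : ¬ (s' ≠ none ∧ s' = s) := fun h => ht ⟨h.2.symm, h.2 ▸ h.1⟩
            have b2' : ¬ some v = t' := fun h => b2 h.symm
            simp only [hc1, hc2, a1, a2, b1, b2', b2]
            simp
            try ring
    · by_cases b1 : s' = some v
      · have b2 := h2 b1
        by_cases ht : t = t' ∧ t ≠ none
        · exact absurd ⟨b1, ht.1, ht.2, a1⟩ n3
        · have hc1 : ¬ (t ≠ none ∧ t = t') := fun h => ht ⟨h.2, h.1⟩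
          have hc2 : ¬ (t' ≠ none ∧ t' = t) := fun h => ht ⟨h.2.symm, h.2 ▸ h.1⟩
          have a1' : ¬ some v = s := fun h => a1 h.symm
          simp only [hc1, hc2, a1, a2, b1, a1', b2]
          simp
          try ring
      · by_cases b2 : t' = some v
        · by_cases ht : s = s' ∧ s ≠ none
          · exact absurd ⟨b2, ht.1.symm, ht.1 ▸ ht.2, a2⟩ n5
          · have hc1 : ¬ (s ≠ none ∧ s = s') := fun h => ht ⟨h.2, h.1⟩
            have hc2 : ¬ (s' ≠ none ∧ s' = s) := fun h => ht ⟨h.2.symm, h.2 ▸ h.1⟩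
            have a2' : ¬ some v = t := fun h => a2 h.symm
            simp only [hc1, hc2, a1, a2, b1, a2', b2]
            simp
            try ring
        · have hcongr : ((s' ≠ none ∧ s' = s) ∨ (t' ≠ none ∧ t' = t)) ↔
              ((s ≠ none ∧ s = s') ∨ (t ≠ none ∧ t = t')) := by
            constructor <;> rintro (⟨h, h'⟩ | ⟨h, h'⟩) <;> subst h' <;> simp [h]
          simp only [hcongr, a1, a2, b1, b2]
          simp only [or_self, if_false, mul_comm (qInt (B : ℤ)) (qInt A)]
          ring

end

section

variable {Δ : Set (ℝ × ℝ)} {g n : ℕ}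

/-! ### Three consecutive elements -/

/-- The codes of the markings which are increasing except possibly on `{i, i + 1, i + 2}`. -/
def windowCodes (Δ : Set (ℝ × ℝ)) (g n i : ℕ) : Set (ℕ → Cell) :=
  {c ∈ looseCodes Δ g n | ∀ a b, codeStep c a b →
    a < b ∨ ((i ≤ a ∧ a ≤ i + 2) ∧ i ≤ b ∧ b ≤ i + 2)}

/-- `e`, `v`, `f` are the numbers `i`, `i + 1`, `i + 2` in some order. -/
def IsArrangement (i e v f : ℕ) : Prop :=
  (e ≠ v ∧ v ≠ f ∧ e ≠ f) ∧ (i ≤ e ∧ e ≤ i + 2) ∧ (i ≤ v ∧ v ≤ i + 2) ∧ i ≤ f ∧ f ≤ i + 2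

theorem IsArrangement.symm {i e v f : ℕ} (h : IsArrangement i e v f) : IsArrangement i f v e := by
  unfold IsArrangement at *; omega

theorem IsArrangement.cases {i e v f x : ℕ} (h : IsArrangement i e v f) (hx : i ≤ x ∧ x ≤ i + 2) :
    x = e ∨ x = v ∨ x = f := by
  obtain ⟨⟨h1, h2, h3⟩, he, hv, hf⟩ := h
  have he' : e = i ∨ e = i + 1 ∨ e = i + 2 := by omega
  have hv' : v = i ∨ v = i + 1 ∨ v = i + 2 := by omega
  have hf' : f = i ∨ f = i + 1 ∨ f = i + 2 := by omega
  have hx' : x = i ∨ x = i + 1 ∨ x = i + 2 := by omega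
  rcases he' with rfl | rfl | rfl <;> rcases hv' with rfl | rfl | rfl <;>
    rcases hf' with rfl | rfl | rfl <;> simp_all <;> omega

theorem localSum_eq_of_isArrangement {i e v f : ℕ} (h : IsArrangement i e v f) (c : ℕ → Cell) :
    localSum c i (i + 1) (i + 2) = localSum c e v f := by
  obtain ⟨⟨h1, h2, h3⟩, he, hv, hf⟩ := h
  have he' : e = i ∨ e = i + 1 ∨ e = i + 2 := by omega
  have hv' : v = i ∨ v = i + 1 ∨ v = i + 2 := by omega
  have hf' : f = i ∨ f = i + 1 ∨ f = i + 2 := by omega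
  rcases he' with rfl | rfl | rfl <;> rcases hv' with rfl | rfl | rfl <;>
    rcases hf' with rfl | rfl | rfl <;>
      first
      | exact absurd rfl h1
      | exact absurd rfl h2
      | exact absurd rfl h3
      | rfl
      | (simp only [localSum]; ring)

/-- The possible middle ends `p` and `q` of edges `s → p` and `q → t`: a chain at `v`, two edges
leaving `s`, or two edges entering `t`. -/
def ChainOrFork (v : ℕ) (s t p q : Option ℕ) : Prop :=
  (p = some v ∧ q = some v) ∨ (p = some v ∧ q = s ∧ s ≠ none) ∨ (p = t ∧ t ≠ none ∧ q = some v)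

theorem ChainOrFork.ne_none {v : ℕ} {s t p q : Option ℕ} (h : ChainOrFork v s t p q) :
    p ≠ none ∧ q ≠ none := by
  rcases h with ⟨rfl, rfl⟩ | ⟨rfl, rfl, h⟩ | ⟨rfl, h, rfl⟩ <;> simp [*]

theorem ChainOrFork.eqvGen {v : ℕ} {s t p q : Option ℕ} (h : ChainOrFork v s t p q) :
    ∀ a b, (s = some a ∨ a = v ∨ t = some a) → (s = some b ∨ b = v ∨ t = some b) →
      Relation.EqvGen (fun x y => (s = some x ∧ p = some y) ∨ (q = some x ∧ t = some y)) a b := by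
  set r := fun x y => (s = some x ∧ p = some y) ∨ (q = some x ∧ t = some y) with hr
  suffices hv : ∀ a, (s = some a ∨ a = v ∨ t = some a) → Relation.EqvGen r a v from
    fun a b ha hb => (hv a ha).trans _ _ _ (hv b hb).symm
  intro a ha
  rcases h with ⟨rfl, rfl⟩ | ⟨rfl, rfl, h⟩ | ⟨rfl, h, rfl⟩
  · rcases ha with rfl | rfl | rfl
    · exact .rel _ _ (by simp [hr])
    · exact .refl _
    · exact .symm _ _ (.rel _ _ (by simp [hr]))
  · obtain ⟨u, rfl⟩ := Option.ne_none_iff_exists'.1 h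
    have huv : Relation.EqvGen r u v := .rel _ _ (by simp [hr])
    rcases ha with ha | rfl | rfl
    · obtain rfl : u = a := by simpa using ha
      exact huv
    · exact .refl _
    · exact .trans _ _ _ (.symm _ _ (.rel _ _ (by simp [hr]))) huv
  · obtain ⟨x, rfl⟩ := Option.ne_none_iff_exists'.1 h
    have huv : Relation.EqvGen r v x := .rel _ _ (by simp [hr])
    rcases ha with rfl | rfl | ha
    · exact .trans _ x _ (.rel _ _ (by simp [hr])) huv.symm
    · exact .refl _
    · obtain rfl : x = a := by simpa using ha
      exact huv.symm

section Window

variable {c : ℕ → Cell} {i e v f : ℕ} {l r : ℤ} {s t p q : Option ℕ} {A B : ℕ}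

theorem vert_eq_of_window (harr : IsArrangement i e v f)
    (he : c e = .edge s p A) (hf : c f = .edge q t B) {a : ℕ} {l' r' : ℤ}
    (ha : c a = .vert l' r') (hW : i ≤ a ∧ a ≤ i + 2) : a = v := by
  rcases harr.cases hW with rfl | rfl | rfl
  · simp [he] at ha
  · rfl
  · simp [hf] at ha

theorem src_lt_of_window (hc : c ∈ windowCodes Δ g n i) (harr : IsArrangement i e v f)
    (he : c e = .edge s p A) (hf : c f = .edge q t B) {a x w : ℕ} {o : Option ℕ}
    (hx : i ≤ x ∧ x ≤ i + 2) (hcx : c x = .edge (some a) o w) (hav : a ≠ v) : a < i := by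
  obtain ⟨l', r', ha⟩ := src_eq_vert hc.1 hcx
  have hn : ¬ (i ≤ a ∧ a ≤ i + 2) := fun h => hav (vert_eq_of_window harr he hf ha h)
  rcases hc.2 _ _ (codeStep_src hc.1 hcx rfl) with h | h <;> omega

theorem lt_tgt_of_window (hc : c ∈ windowCodes Δ g n i) (harr : IsArrangement i e v f)
    (he : c e = .edge s p A) (hf : c f = .edge q t B) {a x w : ℕ} {o : Option ℕ}
    (hx : i ≤ x ∧ x ≤ i + 2) (hcx : c x = .edge o (some a) w) (hav : a ≠ v) : i + 2 < a := by
  obtain ⟨l', r', ha⟩ := tgt_eq_vert hc.1 hcx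
  have hn : ¬ (i ≤ a ∧ a ≤ i + 2) := fun h => hav (vert_eq_of_window harr he hf ha h)
  rcases hc.2 _ _ (codeStep_tgt hc.1 hcx rfl) with h | h <;> omega

theorem exchange_mem_windowCodes (hc : c ∈ windowCodes Δ g n i) (harr : IsArrangement i e v f)
    (hv : c v = .vert l r) (he : c e = .edge s p A) (hf : c f = .edge q t B)
    (hs : s ≠ some v) (ht : t ≠ some v) (hpq : ChainOrFork v s t p q)
    {p' q' : Option ℕ} (hpq' : ChainOrFork v s t p' q') {A' B' : ℕ} (hA : 0 < A') (hB : 0 < B')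
    (hsA : s = none → A' = 1) (htB : t = none → B' = 1)
    (hd : ∀ x, flow s p' A' x + flow q' t B' x = flow s p A x + flow q t B x) :
    Function.update (Function.update c e (.edge s p' A')) f (.edge q' t B') ∈
      windowCodes Δ g n i := by
  have hef : e ≠ f := harr.1.2.2
  set c' := Function.update (Function.update c e (.edge s p' A')) f (.edge q' t B') with hc'
  have ce : c' e = .edge s p' A' := by rw [hc', Function.update_of_ne hef, Function.update_self]
  have cf : c' f = .edge q' t B' := by rw [hc', Function.update_self]
  have co : ∀ j, j ≠ e → j ≠ f → c' j = c j := fun j h1 h2 => by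
    rw [hc', Function.update_of_ne h2, Function.update_of_ne h1]
  have cv : c' v = .vert l r := by rw [co v harr.1.1.symm harr.1.2.1, hv]
  have cvert : ∀ {a l' r'}, c' a = .vert l' r' → c a = .vert l' r' := by
    intro a l' r' h
    rw [co a] at h
    · exact h
    · rintro rfl; simp [ce] at h
    · rintro rfl; simp [cf] at h
  have hsi : ∀ a, s = some a → a < i := by
    rintro a rfl
    exact src_lt_of_window hc harr he hf harr.2.1 he fun h => hs (by rw [h])
  have hti : ∀ a, t = some a → i + 2 < a := by
    rintro a rfl
    exact lt_tgt_of_window hc harr he hf harr.2.2.2 hf fun h => ht (by rw [h])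
  have hp' : ∀ a, p' = some a → a = v ∨ t = some a := by
    rintro a rfl
    rcases hpq' with ⟨h, -⟩ | ⟨h, -⟩ | ⟨h, -⟩
    · exact .inl (by simpa using h)
    · exact .inl (by simpa using h)
    · exact .inr h.symm
  have hq' : ∀ a, q' = some a → a = v ∨ s = some a := by
    rintro a rfl
    rcases hpq' with ⟨-, h⟩ | ⟨-, h, -⟩ | ⟨-, -, h⟩
    · exact .inl (by simpa using h)
    · exact .inr h.symm
    · exact .inl (by simpa using h)
  have hp : ∀ a, p = some a → a = v ∨ t = some a := by
    rintro a rfl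
    rcases hpq with ⟨h, -⟩ | ⟨h, -⟩ | ⟨h, -⟩
    · exact .inl (by simpa using h)
    · exact .inl (by simpa using h)
    · exact .inr h.symm
  have hq : ∀ a, q = some a → a = v ∨ s = some a := by
    rintro a rfl
    rcases hpq with ⟨-, h⟩ | ⟨-, h, -⟩ | ⟨-, -, h⟩
    · exact .inl (by simpa using h)
    · exact .inr h.symm
    · exact .inl (by simpa using h)
  obtain ⟨-, hWe, hWv, hWf⟩ := id harr
  have hstep : ∀ a b, codeStep c' a b → (codeStep c a b ∧ a ≠ e ∧ a ≠ f ∧ b ≠ e ∧ b ≠ f) ∨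
      (a < i ∧ (b = e ∨ b = f)) ∨ ((a = e ∨ a = f) ∧ i + 2 < b) ∨ (a = e ∧ b = v) ∨
      (a = v ∧ b = f) := by
    intro a b h
    rcases codeStep_cases h with ⟨l', r', o, w, ha, hb⟩ | ⟨l', r', o, w, hb, ha⟩
    · by_cases hbe : b = e
      · subst hbe
        simp only [ce, Cell.edge.injEq] at hb
        exact .inr (.inl ⟨hsi a hb.1, .inl rfl⟩)
      · by_cases hbf : b = f
        · subst hbf
          simp only [cf, Cell.edge.injEq] at hb
          rcases hq' a hb.1 with rfl | h
          · simp
          · exact .inr (.inl ⟨hsi a h, .inr rfl⟩)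
        · rw [co b hbe hbf] at hb
          refine .inl ⟨codeStep_src hc.1 hb rfl, ?_, ?_, hbe, hbf⟩
          · rintro rfl; simp [ce] at ha
          · rintro rfl; simp [cf] at ha
    · by_cases hae : a = e
      · subst hae
        simp only [ce, Cell.edge.injEq] at ha
        rcases hp' b ha.2.1 with rfl | h
        · simp
        · exact .inr (.inr (.inl ⟨.inl rfl, hti b h⟩))
      · by_cases haf : a = f
        · subst haf
          simp only [cf, Cell.edge.injEq] at ha
          exact .inr (.inr (.inl ⟨.inr rfl, hti b ha.2.1⟩))
        · rw [co a hae haf] at ha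
          refine .inl ⟨codeStep_tgt hc.1 ha rfl, hae, haf, ?_, ?_⟩
          · rintro rfl; simp [ce] at hb
          · rintro rfl; simp [cf] at hb
  have hself : ¬ codeStep c v v := by simp [codeStep, hv]
  refine ⟨exchange_mem hc.1 hef he hf Iff.rfl (by simp [hpq.ne_none, hpq'.ne_none])
    (by simp [hpq.ne_none, hpq'.ne_none]) Iff.rfl ?_ hA hB ?_ ?_ hd ?_ ?_ ?_, ?_⟩
  · intro x hx
    have hsv : ∀ x, s = some x → ∃ l r, c x = .vert l r := fun x h => src_eq_vert hc.1 (h ▸ he)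
    have htv : ∀ x, t = some x → ∃ l r, c x = .vert l r := fun x h => tgt_eq_vert hc.1 (h ▸ hf)
    rcases hx with h | h | h | h
    · exact hsv x h
    · rcases hp' x h with rfl | h
      · exact ⟨l, r, hv⟩
      · exact htv x h
    · rcases hq' x h with rfl | h
      · exact ⟨l, r, hv⟩
      · exact hsv x h
    · exact htv x h
  · rintro (h | h)
    · exact hsA h
    · exact absurd h hpq'.ne_none.1
  · rintro (h | h)
    · exact absurd h hpq'.ne_none.2
    · exact htB h
  · let ρ : ℕ → ℕ := fun j => if j = e then i else if j = v then i + 1 else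
      if j = f then i + 2 else j
    have ρe : ρ e = i := by simp [ρ]
    have ρv : ρ v = i + 1 := by simp [ρ, harr.1.1.symm]
    have ρf : ρ f = i + 2 := by simp [ρ, harr.1.2.1.symm, harr.1.2.2.symm]
    have ρo : ∀ j, ¬ (i ≤ j ∧ j ≤ i + 2) → ρ j = j := by
      intro j hj
      have h1 : j ≠ e := fun h => hj (h ▸ hWe)
      have h2 : j ≠ v := fun h => hj (h ▸ hWv)
      have h3 : j ≠ f := fun h => hj (h ▸ hWf)
      simp [ρ, h1, h2, h3]
    have ρW : ∀ j, j ≠ e → j ≠ f → i ≤ j ∧ j ≤ i + 2 → j = v := by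
      intro j h1 h2 h3
      rcases harr.cases h3 with h | h | h
      exacts [absurd h h1, h, absurd h h2]
    refine ⟨ρ, fun a b h => ?_⟩
    rcases hstep a b h with ⟨h, h1, h2, h3, h4⟩ | ⟨h', rfl | rfl⟩ | ⟨rfl | rfl, h'⟩ | ⟨rfl, rfl⟩ |
      ⟨rfl, rfl⟩
    · have hab := hc.2 a b h
      by_cases ha : i ≤ a ∧ a ≤ i + 2
      · obtain rfl := ρW a h1 h2 ha
        by_cases hb : i ≤ b ∧ b ≤ i + 2
        · obtain rfl := ρW b h3 h4 hb
          exact absurd h hself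
        · rw [ρv, ρo b hb]
          omega
      · rw [ρo a ha]
        by_cases hb : i ≤ b ∧ b ≤ i + 2
        · obtain rfl := ρW b h3 h4 hb
          rw [ρv]
          omega
        · rw [ρo b hb]
          omega
    · rw [ρe, ρo a (by omega)]; exact h'
    · rw [ρf, ρo a (by omega)]; omega
    · rw [ρe, ρo b (by omega)]; omega
    · rw [ρf, ρo b (by omega)]; omega
    · rw [ρe, ρv]; omega
    · rw [ρv, ρf]; omega
  · intro a b ha hb
    exact hpq'.eqvGen a b (.inl ha) ((hp b hb).elim (fun h => .inr (.inl h)) fun h => .inr (.inr h))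
  · intro a b ha hb
    exact hpq'.eqvGen a b ((hq a ha).elim (fun h => .inr (.inl h)) fun h => .inl h) (.inr (.inr hb))
  · intro a b h
    rcases hstep a b h with ⟨h, -⟩ | ⟨h, rfl | rfl⟩ | ⟨rfl | rfl, h⟩ | ⟨rfl, rfl⟩ | ⟨rfl, rfl⟩
    · exact hc.2 a b h
    all_goals omega

end Window

end

section

variable {Δ : Set (ℝ × ℝ)} {g n : ℕ}

theorem sum_eq_zero_of_rel {α M : Type*} [Ring M] [IsDomain M] [CharZero M] {A : Finset α}
    {f : α → M} (r : α → α → Prop) (hA : ∀ a ∈ A, f a ≠ 0 → ∃ b ∈ A, r a b)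
    (hsymm : ∀ a b, r a b → r b a)
    (hr : ∀ a ∈ A, ∀ b ∈ A, ∀ b' ∈ A, r a b → r a b' → b = b')
    (hf : ∀ a ∈ A, ∀ b ∈ A, r a b → f a + f b = 0) : ∑ a ∈ A, f a = 0 := by
  classical
  rw [← Finset.sum_filter_ne_zero]
  have hA' : ∀ a ∈ A.filter (fun a => f a ≠ 0), ∃ b ∈ A, r a b := fun a ha =>
    hA a (Finset.mem_filter.1 ha).1 (Finset.mem_filter.1 ha).2
  choose φ hφ hφr using hA'
  have hmem : ∀ a ha, φ a ha ∈ A.filter (fun a => f a ≠ 0) := by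
    intro a ha
    refine Finset.mem_filter.2 ⟨hφ a ha, fun h => ?_⟩
    have h1 := hf a (Finset.mem_filter.1 ha).1 _ (hφ a ha) (hφr a ha)
    rw [h, add_zero] at h1
    exact (Finset.mem_filter.1 ha).2 h1
  refine Finset.sum_involution (fun a ha => φ a ha) ?_ ?_ hmem ?_
  · intro a ha
    exact hf a (Finset.mem_filter.1 ha).1 _ (hφ a ha) (hφr a ha)
  · intro a ha h0 he
    have h1 := hf a (Finset.mem_filter.1 ha).1 _ (hφ a ha) (hφr a ha)
    rw [he, ← two_mul, mul_eq_zero] at h1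
    exact h1.elim (by norm_num) h0
  · intro a ha
    exact hr _ (hφ a ha) _ (hφ _ (hmem a ha)) _ (Finset.mem_filter.1 ha).1 (hφr _ (hmem a ha))
      (hsymm _ _ (hφr a ha))

/-- Exchange of a chain at `v` with two edges leaving a common vertex. -/
def ExchangeTail (c c' : ℕ → Cell) (e v f : ℕ) : Prop :=
  ∃ l r s t A B, 0 < A ∧ 0 < B ∧ s ≠ none ∧ s ≠ some v ∧ t ≠ some v ∧
    c v = .vert l r ∧ c' v = .vert l r ∧
    c e = .edge s (some v) (A + B) ∧ c f = .edge (some v) t B ∧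
    c' e = .edge s (some v) A ∧ c' f = .edge s t B

/-- Exchange of a chain at `v` with two edges entering a common vertex. -/
def ExchangeHead (c c' : ℕ → Cell) (e v f : ℕ) : Prop :=
  ∃ l r s t A B, 0 < A ∧ 0 < B ∧ t ≠ none ∧ s ≠ some v ∧ t ≠ some v ∧
    c v = .vert l r ∧ c' v = .vert l r ∧
    c e = .edge s (some v) A ∧ c f = .edge (some v) t (A + B) ∧
    c' e = .edge s t A ∧ c' f = .edge (some v) t B

/-- Exchange of a chain and a fork. -/
def Exchange (i : ℕ) (c c' : ℕ → Cell) : Prop :=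
  ∃ e v f, IsArrangement i e v f ∧ (∀ j, j ≠ e → j ≠ f → c j = c' j) ∧
    (ExchangeTail c c' e v f ∨ ExchangeHead c c' e v f ∨
      ExchangeTail c' c e v f ∨ ExchangeHead c' c e v f)

theorem Exchange.symm {i : ℕ} {c c' : ℕ → Cell} (h : Exchange i c c') : Exchange i c' c := by
  obtain ⟨e, v, f, h1, h2, h3⟩ := h
  exact ⟨e, v, f, h1, fun j h h' => (h2 j h h').symm, by tauto⟩

theorem exchange_shape {c c' : ℕ → Cell} {e v f : ℕ}
    (h : ExchangeTail c c' e v f ∨ ExchangeHead c c' e v f ∨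
      ExchangeTail c' c e v f ∨ ExchangeHead c' c e v f) :
    ∃ l r s t s' t' A B, c v = .vert l r ∧ c e = .edge s t A ∧ c f = .edge s' t' B ∧
      s ≠ some v ∧ t' ≠ some v ∧ (t = some v ∨ s' = some v) := by
  rcases h with ⟨l, r, s, t, A, B, -, -, h1, h2, h3, h4, h4', h5, h6, h7, h8⟩ |
    ⟨l, r, s, t, A, B, -, -, h1, h2, h3, h4, h4', h5, h6, h7, h8⟩ |
    ⟨l, r, s, t, A, B, -, -, h1, h2, h3, h4, h4', h5, h6, h7, h8⟩ |
    ⟨l, r, s, t, A, B, -, -, h1, h2, h3, h4, h4', h5, h6, h7, h8⟩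
  · exact ⟨_, _, _, _, _, _, _, _, h4, h5, h6, h2, h3, by simp⟩
  · exact ⟨_, _, _, _, _, _, _, _, h4, h5, h6, h2, h3, by simp⟩
  · exact ⟨_, _, _, _, _, _, _, _, h4', h7, h8, h2, h3, by simp⟩
  · exact ⟨_, _, _, _, _, _, _, _, h4', h7, h8, h2, h3, by simp⟩

theorem Exchange.unique {i : ℕ} {c c' c'' : ℕ → Cell} (h : Exchange i c c')
    (h' : Exchange i c c'') : c' = c'' := by
  obtain ⟨e, v, f, harr, hj, hx⟩ := h
  obtain ⟨e', v', f', harr', hj', hx'⟩ := h'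
  have hpos : e' = e ∧ v' = v ∧ f' = f := by
    obtain ⟨l, r, s, t, s', t', A, B, hv, he, hf, hs, ht, hst⟩ := exchange_shape hx
    obtain ⟨l₁, r₁, s₁, t₁, s₁', t₁', A₁, B₁, hv₁, he₁, hf₁, hs₁, ht₁, hst₁⟩ := exchange_shape hx'
    obtain rfl : v' = v := vert_eq_of_window harr he hf hv₁ harr'.2.2.1
    rcases harr.cases harr'.2.1 with rfl | h | rfl
    · rcases harr.cases harr'.2.2.2 with h | h | h
      · exact absurd h.symm harr'.1.2.2
      · exact absurd h.symm harr'.1.2.1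
      · exact ⟨rfl, rfl, h⟩
    · exact absurd h harr'.1.1
    · rcases harr.cases harr'.2.2.2 with rfl | h | h
      · rw [he] at hf₁
        rw [hf] at he₁
        simp only [Cell.edge.injEq] at hf₁ he₁
        obtain ⟨rfl, rfl, -⟩ := hf₁
        obtain ⟨rfl, rfl, -⟩ := he₁
        tauto
      · exact absurd h.symm harr'.1.2.1
      · exact absurd h.symm harr'.1.2.2
  obtain ⟨rfl, rfl, rfl⟩ := hpos
  have key : c' e' = c'' e' ∧ c' f' = c'' f' := by
    clear hj hj' harr harr'
    rcases hx with ⟨l, r, s, t, A, B, hA, hB, h1, h2, h3, h4, h4', h5, h6, h7, h8⟩ |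
      ⟨l, r, s, t, A, B, hA, hB, h1, h2, h3, h4, h4', h5, h6, h7, h8⟩ |
      ⟨l, r, s, t, A, B, hA, hB, h1, h2, h3, h4, h4', h5, h6, h7, h8⟩ |
      ⟨l, r, s, t, A, B, hA, hB, h1, h2, h3, h4, h4', h5, h6, h7, h8⟩ <;>
    rcases hx' with ⟨_, _, s', t', A', B', kA, kB, k1, k2, k3, -, -, k5, k6, k7, k8⟩ |
      ⟨_, _, s', t', A', B', kA, kB, k1, k2, k3, -, -, k5, k6, k7, k8⟩ |
      ⟨_, _, s', t', A', B', kA, kB, k1, k2, k3, -, -, k5, k6, k7, k8⟩ |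
      ⟨_, _, s', t', A', B', kA, kB, k1, k2, k3, -, -, k5, k6, k7, k8⟩ <;>
    simp only [h5, h6, h7, h8, Cell.edge.injEq] at k5 k6 k7 k8 <;>
    simp only [h5, h6, h7, h8, k5, k6, k7, k8] <;> grind
  funext j
  by_cases h1 : j = e'
  · rw [h1, key.1]
  · by_cases h2 : j = f'
    · rw [h2, key.2]
    · rw [← hj j h1 h2, hj' j h1 h2]

theorem Exchange.localSum_add {i : ℕ} {c c' : ℕ → Cell} (hc : c ∈ looseCodes Δ g n)
    (hc' : c' ∈ looseCodes Δ g n) (h : Exchange i c c') :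
    localSum c i (i + 1) (i + 2) + localSum c' i (i + 1) (i + 2) = 0 := by
  obtain ⟨e, v, f, harr, hj, hx⟩ := h
  rw [localSum_eq_of_isArrangement harr, localSum_eq_of_isArrangement harr]
  have tail : ∀ {c c' : ℕ → Cell}, c ∈ looseCodes Δ g n → c' ∈ looseCodes Δ g n →
      ExchangeTail c c' e v f → localSum c e v f + localSum c' e v f = 0 := by
    rintro c c' hc - ⟨l, r, s, t, A, B, hA, hB, h1, h2, h3, h4, h4', h5, h6, h7, h8⟩
    obtain ⟨u, rfl⟩ := Option.ne_none_iff_exists'.1 h1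
    rw [localSum_chain hc h4 h5 h6, localSum_forkTail h4' h7 h8 (fun h => h2 (by rw [h])) h3]
    push_cast
    rw [add_sub_cancel_right]
    ring
  have head : ∀ {c c' : ℕ → Cell}, c ∈ looseCodes Δ g n → c' ∈ looseCodes Δ g n →
      ExchangeHead c c' e v f → localSum c e v f + localSum c' e v f = 0 := by
    rintro c c' hc - ⟨l, r, s, t, A, B, hA, hB, h1, h2, h3, h4, h4', h5, h6, h7, h8⟩
    obtain ⟨u, rfl⟩ := Option.ne_none_iff_exists'.1 h1
    rw [localSum_chain hc h4 h5 h6, localSum_forkHead h4' h7 h8 (fun h => h3 (by rw [h])) h2]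
    push_cast
    rw [show (A : ℤ) - (A + B) = -B by ring, qInt_neg]
    ring
  rcases hx with h | h | h | h
  · exact tail hc hc' h
  · exact head hc hc' h
  · rw [add_comm]; exact tail hc' hc h
  · rw [add_comm]; exact head hc' hc h

theorem exists_exchange_of_isExchangeable {c : ℕ → Cell} {i e v f : ℕ}
    (hc : c ∈ windowCodes Δ g n i) (harr : IsArrangement i e v f) {l r : ℤ}
    {s t s' t' : Option ℕ} {A B : ℕ} (hv : c v = .vert l r) (he : c e = .edge s t A)
    (hf : c f = .edge s' t' B) (hx : IsExchangeable v s t s' t') (h0 : localSum c e v f ≠ 0) :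
    ∃ c' ∈ windowCodes Δ g n i, Exchange i c c' := by
  obtain ⟨hev, hvf, hef⟩ := harr.1
  have hA := weight_pos hc.1 he
  have hB := weight_pos hc.1 hf
  have hup : ∀ x y, (∀ j, j ≠ e → j ≠ f →
      c j = Function.update (Function.update c e x) f y j) := by
    intro x y j h1 h2
    rw [Function.update_of_ne h2, Function.update_of_ne h1]
  have upe : ∀ x y, Function.update (Function.update c e x) f y e = x := by
    intro x y
    rw [Function.update_of_ne hef, Function.update_self]
  have upf : ∀ x y, Function.update (Function.update c e x) f y f = y := by
    intro x y
    rw [Function.update_self]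
  have upv : ∀ x y, Function.update (Function.update c e x) f y v = .vert l r := by
    intro x y
    rw [← hup x y v hev.symm hvf, hv]
  rcases hx with ⟨rfl, rfl⟩ | ⟨rfl, rfl, hs, ht⟩ | ⟨rfl, rfl, ht, hs⟩
  · have hs : s ≠ some v := fun h => src_ne_tgt hc.1 he h rfl
    have ht : t' ≠ some v := src_ne_tgt hc.1 hf rfl
    rcases lt_trichotomy A B with h | h | h
    · have htn : t' ≠ none := fun h' => by
        have := weight_infinite hc.1 hf (.inr h'); omega
      obtain ⟨C, rfl⟩ := Nat.exists_eq_add_of_lt h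
      refine ⟨_, exchange_mem_windowCodes hc harr hv he hf hs ht (.inl ⟨rfl, rfl⟩)
        (p' := t') (q' := some v) (.inr (.inr ⟨rfl, htn, rfl⟩)) (A' := A) (B' := C + 1) hA
        (Nat.succ_pos _) (fun h => weight_infinite hc.1 he (.inl h)) (fun h => absurd h htn) ?_,
        e, v, f, harr, hup _ _, .inr (.inl ⟨l, r, s, t', A, C + 1, hA, Nat.succ_pos _, htn, hs, ht,
          hv, upv _ _, he, hf, upe _ _, upf _ _⟩)⟩
      intro x
      simp only [flow]
      split_ifs <;> push_cast <;> simp_all <;> ring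
    · refine absurd ?_ h0
      rw [localSum_chain hc.1 hv he hf, h, sub_self, qInt_zero]
      simp
    · have hsn : s ≠ none := fun h' => by
        have := weight_infinite hc.1 he (.inl h'); omega
      obtain ⟨C, rfl⟩ := Nat.exists_eq_add_of_lt h
      refine ⟨_, exchange_mem_windowCodes hc harr hv he hf hs ht (.inl ⟨rfl, rfl⟩)
        (p' := some v) (q' := s) (.inr (.inl ⟨rfl, rfl, hsn⟩)) (A' := C + 1) (B' := B)
        (Nat.succ_pos _) hB (fun h => absurd h hsn) (fun h => weight_infinite hc.1 hf (.inr h)) ?_,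
        e, v, f, harr, hup _ _, .inl ⟨l, r, s, t', C + 1, B, Nat.succ_pos _, hB, hsn, hs, ht,
          hv, upv _ _, ?_, hf, upe _ _, upf _ _⟩⟩
      · intro x
        simp only [flow]
        split_ifs <;> push_cast <;> simp_all <;> ring
      · rw [he]; congr 1; omega
  · have hsv : s ≠ some v := fun h => src_ne_tgt hc.1 he h rfl
    refine ⟨_, exchange_mem_windowCodes hc harr hv he hf hsv ht (.inr (.inl ⟨rfl, rfl, hs⟩))
        (p' := some v) (q' := some v) (.inl ⟨rfl, rfl⟩) (A' := A + B) (B' := B)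
        (by omega) hB (fun h => absurd h hs) (fun h => weight_infinite hc.1 hf (.inr h)) ?_,
        e, v, f, harr, hup _ _, .inr (.inr (.inl ⟨l, r, s, t', A, B, hA, hB, hs, hsv, ht,
          upv _ _, hv, upe _ _, upf _ _, he, hf⟩))⟩
    intro x
    simp only [flow]
    split_ifs <;> push_cast <;> simp_all; ring
  · have htv : t ≠ some v := src_ne_tgt hc.1 hf rfl
    refine ⟨_, exchange_mem_windowCodes hc harr hv he hf hs htv (.inr (.inr ⟨rfl, ht, rfl⟩))
        (p' := some v) (q' := some v) (.inl ⟨rfl, rfl⟩) (A' := A) (B' := A + B)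
        hA (by omega) (fun h => weight_infinite hc.1 he (.inl h)) (fun h => absurd h ht) ?_,
        e, v, f, harr, hup _ _, .inr (.inr (.inr ⟨l, r, s, t, A, B, hA, hB, ht, hs, htv,
          upv _ _, hv, upe _ _, upf _ _, he, hf⟩))⟩
    intro x
    simp only [flow]
    split_ifs <;> push_cast <;> simp_all

theorem exists_exchange {c : ℕ → Cell} {i : ℕ} (hi : 1 ≤ i) (hin : i + 2 ≤ n)
    (hc : c ∈ windowCodes Δ g n i) (h0 : localSum c i (i + 1) (i + 2) ≠ 0) :
    ∃ c' ∈ windowCodes Δ g n i, Exchange i c c' := by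
  have main : ∀ {e v f : ℕ} {l r : ℤ} {s t s' t' : Option ℕ} {A B : ℕ}, IsArrangement i e v f →
      c v = .vert l r → c e = .edge s t A → c f = .edge s' t' B →
      ∃ c' ∈ windowCodes Δ g n i, Exchange i c c' := by
    intro e v f l r s t s' t' A B harr hv he hf
    rw [localSum_eq_of_isArrangement harr] at h0
    rcases isExchangeable_of_localSum_ne_zero hc.1 hv he hf h0 with h | h
    · exact exists_exchange_of_isExchangeable hc harr hv he hf h h0
    · refine exists_exchange_of_isExchangeable hc harr.symm hv hf he h ?_
      rwa [← localSum_eq_of_isArrangement harr.symm, localSum_eq_of_isArrangement harr]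
  have e1 := ne_empty hc.1 hi (show i ≤ n by omega)
  have e2 := ne_empty hc.1 (show 1 ≤ i + 1 by omega) (show i + 1 ≤ n by omega)
  have e3 := ne_empty hc.1 (show 1 ≤ i + 2 by omega) hin
  rcases h1 : c i with _ | ⟨l₁, r₁⟩ | ⟨s₁, t₁, w₁⟩
  · exact absurd h1 e1
  · rcases h2 : c (i + 1) with _ | ⟨l₂, r₂⟩ | ⟨s₂, t₂, w₂⟩
    · exact absurd h2 e2
    · rcases h3 : c (i + 2) with _ | ⟨l₃, r₃⟩ | ⟨s₃, t₃, w₃⟩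
      · exact absurd h3 e3
      · exact absurd (localSum_vertices h1 h2 h3) h0
      · exact absurd (localSum_two_vertices hc.1 (by omega) h1 h2 h3) h0
    · rcases h3 : c (i + 2) with _ | ⟨l₃, r₃⟩ | ⟨s₃, t₃, w₃⟩
      · exact absurd h3 e3
      · rw [localSum_swap_right] at h0
        exact absurd (localSum_two_vertices hc.1 (by omega) h1 h3 h2) h0
      · exact main (by unfold IsArrangement; omega) h1 h2 h3
  · rcases h2 : c (i + 1) with _ | ⟨l₂, r₂⟩ | ⟨s₂, t₂, w₂⟩
    · exact absurd h2 e2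
    · rcases h3 : c (i + 2) with _ | ⟨l₃, r₃⟩ | ⟨s₃, t₃, w₃⟩
      · exact absurd h3 e3
      · rw [localSum_swap_left, localSum_swap_right] at h0
        exact absurd (localSum_two_vertices hc.1 (by omega) h2 h3 h1) h0
      · exact main (by unfold IsArrangement; omega) h2 h1 h3
    · rcases h3 : c (i + 2) with _ | ⟨l₃, r₃⟩ | ⟨s₃, t₃, w₃⟩
      · exact absurd h3 e3
      · exact main (by unfold IsArrangement; omega) h3 h1 h2
      · exact absurd (localSum_edges h1 h2 h3) h0

end

section

variable {Δ : Set (ℝ × ℝ)} {g n : ℕ}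

theorem not_codeStep_self (c : ℕ → Cell) (a : ℕ) : ¬ codeStep c a a := by
  intro h
  rcases codeStep_cases h with ⟨l, r, o, w, h1, h2⟩ | ⟨l, r, o, w, h1, h2⟩ <;> simp [h1] at h2

theorem mem_codes_iff {c : ℕ → Cell} {i : ℕ} (hc : c ∈ windowCodes Δ g n i) :
    c ∈ codes Δ g n ↔
      ¬ (codeStep c (i + 1) i ∨ codeStep c (i + 2) i ∨ codeStep c (i + 2) (i + 1)) := by
  constructor
  · rintro h (h' | h' | h') <;> have := h.2 _ _ h' <;> omega
  · intro h
    push Not at h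
    refine ⟨hc.1, fun a b hab => ?_⟩
    rcases hc.2 a b hab with h' | ⟨ha, hb⟩
    · exact h'
    · by_contra hlt
      have ha' : a = i ∨ a = i + 1 ∨ a = i + 2 := by omega
      have hb' : b = i ∨ b = i + 1 ∨ b = i + 2 := by omega
      have hs := not_codeStep_self c
      rcases ha' with rfl | rfl | rfl <;> rcases hb' with rfl | rfl | rfl <;>
        first
        | exact hs _ hab
        | exact h.1 hab
        | exact h.2.1 hab
        | exact h.2.2 hab
        | omega

theorem finite_windowCodes (Δ : Set (ℝ × ℝ)) (g n i : ℕ) : (windowCodes Δ g n i).Finite :=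
  (finite_looseCodes Δ g n).subset fun _ h => h.1

theorem codes_subset_windowCodes (i : ℕ) : codes Δ g n ⊆ windowCodes Δ g n i :=
  fun _ h => ⟨h.1, fun a b hab => .inl (h.2 a b hab)⟩

/-- The factors of the elements outside `{i, i + 1, i + 2}`. -/
def outerWeight (n i : ℕ) (I : Finset ℕ) (c : ℕ → Cell) : QField :=
  (∏ k ∈ I, pairWeight c k (k + 1)) *
    ∏ j ∈ (unpaired n I).filter (fun j => ¬ (i ≤ j ∧ j ≤ i + 2)), (c j).weight

theorem codeMult_insert_left {i : ℕ} {I : Finset ℕ} (hi : 1 ≤ i) (hin : i + 2 ≤ n)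
    (hI : ∀ k ∈ I, k + 1 < i ∨ i + 2 < k) (c : ℕ → Cell) :
    codeMult n (insert i I) c =
      outerWeight n i I c * (pairWeight c i (i + 1) * (c (i + 2)).weight) := by
  have h1 : i ∉ I := fun h => by have := hI i h; omega
  have h2 : unpaired n (insert i I) =
      insert (i + 2) ((unpaired n I).filter fun j => ¬ (i ≤ j ∧ j ≤ i + 2)) := by
    ext j
    simp only [unpaired, Finset.mem_sdiff, Finset.mem_Icc, Finset.mem_union, Finset.mem_insert,
      Finset.mem_image, Finset.mem_filter]
    constructor
    · rintro ⟨hj, hn⟩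
      push Not at hn
      by_cases hj2 : j = i + 2
      · exact .inl hj2
      · refine .inr ⟨⟨hj, ?_⟩, ?_⟩
        · rintro (h | ⟨k, hk, rfl⟩)
          · exact hn.1.2 h
          · exact hn.2 k (.inr hk) rfl
        · have := hn.1.1
          have := hn.2 i (.inl rfl)
          omega
    · rintro (rfl | ⟨⟨hj, hn⟩, hw⟩)
      · refine ⟨by omega, ?_⟩
        rintro ((h | h) | ⟨k, rfl | hk, h⟩)
        · omega
        · have := hI _ h; omega
        · omega
        · have := hI _ hk; omega
      · refine ⟨hj, ?_⟩
        rintro ((h | h) | ⟨k, rfl | hk, h⟩)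
        · omega
        · exact hn (.inl h)
        · omega
        · exact hn (.inr ⟨k, hk, h⟩)
  rw [codeMult, outerWeight, Finset.prod_insert h1, h2, Finset.prod_insert (by simp)]
  ring

theorem codeMult_insert_right {i : ℕ} {I : Finset ℕ} (hi : 1 ≤ i) (hin : i + 2 ≤ n)
    (hI : ∀ k ∈ I, k + 1 < i ∨ i + 2 < k) (c : ℕ → Cell) :
    codeMult n (insert (i + 1) I) c =
      outerWeight n i I c * ((c i).weight * pairWeight c (i + 1) (i + 2)) := by
  have h1 : i + 1 ∉ I := fun h => by have := hI _ h; omega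
  have h2 : unpaired n (insert (i + 1) I) =
      insert i ((unpaired n I).filter fun j => ¬ (i ≤ j ∧ j ≤ i + 2)) := by
    ext j
    simp only [unpaired, Finset.mem_sdiff, Finset.mem_Icc, Finset.mem_union, Finset.mem_insert,
      Finset.mem_image, Finset.mem_filter]
    constructor
    · rintro ⟨hj, hn⟩
      push Not at hn
      by_cases hj2 : j = i
      · exact .inl hj2
      · refine .inr ⟨⟨hj, ?_⟩, ?_⟩
        · rintro (h | ⟨k, hk, rfl⟩)
          · exact hn.1.2 h
          · exact hn.2 k (.inr hk) rfl
        · have := hn.1.1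
          have := hn.2 (i + 1) (.inl rfl)
          omega
    · rintro (rfl | ⟨⟨hj, hn⟩, hw⟩)
      · refine ⟨by omega, ?_⟩
        rintro ((h | h) | ⟨k, rfl | hk, h⟩)
        · omega
        · have := hI _ h; omega
        · omega
        · have := hI _ hk; omega
      · refine ⟨hj, ?_⟩
        rintro ((h | h) | ⟨k, rfl | hk, h⟩)
        · omega
        · exact hn (.inl h)
        · omega
        · exact hn (.inr ⟨k, hk, h⟩)
  rw [codeMult, outerWeight, Finset.prod_insert h1, h2, Finset.prod_insert (by simp)]
  ring

theorem outerWeight_congr {i : ℕ} {I : Finset ℕ} (hI : ∀ k ∈ I, k + 1 < i ∨ i + 2 < k)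
    {c c' : ℕ → Cell} (h : ∀ j, ¬ (i ≤ j ∧ j ≤ i + 2) → c j = c' j) :
    outerWeight n i I c = outerWeight n i I c' := by
  rw [outerWeight, outerWeight]
  congr 1
  · refine Finset.prod_congr rfl fun k hk => ?_
    have := hI k hk
    rw [pairWeight, pairWeight, h k (by omega), h (k + 1) (by omega)]
  · refine Finset.prod_congr rfl fun j hj => ?_
    rw [h j (Finset.mem_filter.1 hj).2]

section Relabel

variable {i : ℕ} {σ : Equiv.Perm ℕ} (hσ : ∀ j, ¬ (i ≤ j ∧ j ≤ i + 2) → σ j = j)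

include hσ

theorem perm_mem_window (j : ℕ) : (i ≤ σ j ∧ σ j ≤ i + 2) ↔ (i ≤ j ∧ j ≤ i + 2) := by
  constructor
  · intro h
    by_contra hj
    rw [hσ j hj] at h
    exact hj h
  · intro h
    by_contra hj
    have := σ.injective (hσ _ hj)
    rw [this] at hj
    exact hj h

theorem outerWeight_relabel {I : Finset ℕ} (hI : ∀ k ∈ I, k + 1 < i ∨ i + 2 < k)
    (c : ℕ → Cell) : outerWeight n i I (relabel σ c) = outerWeight n i I c := by
  rw [outerWeight, outerWeight]
  congr 1
  · refine Finset.prod_congr rfl fun k hk => ?_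
    have := hI k hk
    have h := pairWeight_relabel σ c k (k + 1)
    rwa [hσ k (by omega), hσ (k + 1) (by omega)] at h
  · refine Finset.prod_congr rfl fun j hj => ?_
    have h := relabel_apply σ c j
    rw [hσ j (Finset.mem_filter.1 hj).2] at h
    rw [h, weight_map]

theorem relabel_mem_windowCodes (hi : 1 ≤ i) (hin : i + 2 ≤ n) {c : ℕ → Cell}
    (hc : c ∈ windowCodes Δ g n i) : relabel σ c ∈ windowCodes Δ g n i := by
  refine ⟨relabel_mem hc.1 σ ?_, fun a b hab => ?_⟩
  · have hmem : ∀ j, σ j ∈ Set.Icc 1 n ↔ j ∈ Set.Icc 1 n := by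
      intro j
      have := perm_mem_window hσ j
      have := hσ j
      rw [Set.mem_Icc, Set.mem_Icc]
      by_cases hj : i ≤ j ∧ j ≤ i + 2
      · omega
      · rw [hσ j hj]
    ext j
    constructor
    · rintro ⟨k, hk, rfl⟩
      exact (hmem k).2 hk
    · intro hj
      refine ⟨σ.symm j, (hmem _).1 (by simpa using hj), by simp⟩
  · obtain ⟨a, rfl⟩ := σ.surjective a
    obtain ⟨b, rfl⟩ := σ.surjective b
    rw [codeStep_relabel] at hab
    rw [perm_mem_window hσ, perm_mem_window hσ]
    rcases hc.2 a b hab with h | h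
    · by_cases ha : i ≤ a ∧ a ≤ i + 2
      · by_cases hb : i ≤ b ∧ b ≤ i + 2
        · exact .inr ⟨ha, hb⟩
        · have := (perm_mem_window hσ a).2 ha
          rw [hσ b hb]
          omega
      · rw [hσ a ha]
        by_cases hb : i ≤ b ∧ b ≤ i + 2
        · have := (perm_mem_window hσ b).2 hb
          omega
        · rw [hσ b hb]
          exact .inl h
    · exact .inr h

end Relabel

theorem localTerm_relabel (σ : Equiv.Perm ℕ) (c : ℕ → Cell) (a b d : ℕ) :
    localTerm (relabel σ c) (σ a) (σ b) (σ d) = localTerm c a b d := by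
  classical
  rw [localTerm, localTerm, pairWeight_relabel, pairWeight_relabel, relabel_apply, relabel_apply,
    weight_map, weight_map]
  refine if_congr ?_ rfl rfl
  rw [codeStep_relabel, codeStep_relabel, codeStep_relabel]

theorem sum_localTerm_swap {i : ℕ} (hi : 1 ≤ i) (hin : i + 2 ≤ n) {I : Finset ℕ}
    (hI : ∀ k ∈ I, k + 1 < i ∨ i + 2 < k) {x y : ℕ} (hx : i ≤ x ∧ x ≤ i + 2)
    (hy : i ≤ y ∧ y ≤ i + 2) (a b d : ℕ) :
    ∑ c ∈ (finite_windowCodes Δ g n i).toFinset, outerWeight n i I c * localTerm c a b d =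
      ∑ c ∈ (finite_windowCodes Δ g n i).toFinset, outerWeight n i I c *
        localTerm c (Equiv.swap x y a) (Equiv.swap x y b) (Equiv.swap x y d) := by
  have hσ : ∀ j, ¬ (i ≤ j ∧ j ≤ i + 2) → Equiv.swap x y j = j := fun j hj =>
    Equiv.swap_apply_of_ne_of_ne (fun h => hj (h ▸ hx)) (fun h => hj (h ▸ hy))
  have hinv : ∀ c, relabel (Equiv.swap x y) (relabel (Equiv.swap x y) c) = c := by
    intro c
    have := relabel_symm_relabel (Equiv.swap x y) c
    rwa [Equiv.symm_swap] at this
  refine Finset.sum_nbij' (relabel (Equiv.swap x y)) (relabel (Equiv.swap x y)) ?_ ?_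
    (fun c _ => hinv c) (fun c _ => hinv c) ?_
  · intro c hc
    rw [Set.Finite.mem_toFinset] at hc ⊢
    exact relabel_mem_windowCodes hσ hi hin hc
  · intro c hc
    rw [Set.Finite.mem_toFinset] at hc ⊢
    exact relabel_mem_windowCodes hσ hi hin hc
  · intro c _
    rw [localTerm_relabel, outerWeight_relabel hσ hI]

theorem sum_outerWeight_mul_localTerm {i : ℕ} (hi : 1 ≤ i) (hin : i + 2 ≤ n) {I : Finset ℕ}
    (hI : ∀ k ∈ I, k + 1 < i ∨ i + 2 < k) :
    ∑ c ∈ (finite_windowCodes Δ g n i).toFinset,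
      outerWeight n i I c * localTerm c i (i + 1) (i + 2) = 0 := by
  have hsum : ∑ c ∈ (finite_windowCodes Δ g n i).toFinset,
      outerWeight n i I c * localSum c i (i + 1) (i + 2) = 0 := by
    refine sum_eq_zero_of_rel (Exchange i) ?_ (fun _ _ h => h.symm)
      (fun _ _ _ _ _ _ h h' => h.unique h') ?_
    · intro c hc h0
      rw [Set.Finite.mem_toFinset] at hc
      obtain ⟨c', hc', h⟩ := exists_exchange hi hin hc (right_ne_zero_of_mul h0)
      exact ⟨c', by rwa [Set.Finite.mem_toFinset], h⟩
    · intro c hc c' hc' h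
      rw [Set.Finite.mem_toFinset] at hc hc'
      have h1 := h.localSum_add hc.1 hc'.1
      have h2 : outerWeight n i I c = outerWeight n i I c' := by
        obtain ⟨e, v, f, harr, hj, -⟩ := h
        refine outerWeight_congr hI fun j hjW => hj j ?_ ?_
        · rintro rfl; exact hjW harr.2.1
        · rintro rfl; exact hjW harr.2.2.2
      rw [h2, ← mul_add, h1, mul_zero]
  have sw := fun x y hx hy => sum_localTerm_swap (Δ := Δ) (g := g) hi hin hI (x := x) (y := y) hx hy
  have s01 := sw i (i + 1) (by omega) (by omega)
  have s12 := sw (i + 1) (i + 2) (by omega) (by omega)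
  have s02 := sw i (i + 2) (by omega) (by omega)
  have a1 := s01 i (i + 1) (i + 2)
  have a2 := s12 i (i + 1) (i + 2)
  have a3 := s02 i (i + 1) (i + 2)
  have a4 := s01 i (i + 2) (i + 1)
  have a5 := s12 (i + 1) i (i + 2)
  simp only [Equiv.swap_apply_left, Equiv.swap_apply_right,
    Equiv.swap_apply_of_ne_of_ne (show i + 2 ≠ i by omega) (show i + 2 ≠ i + 1 by omega),
    Equiv.swap_apply_of_ne_of_ne (show i ≠ i + 1 by omega) (show i ≠ i + 2 by omega),
    Equiv.swap_apply_of_ne_of_ne (show i + 1 ≠ i by omega) (show i + 1 ≠ i + 2 by omega)]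
    at a1 a2 a3 a4 a5
  simp only [localSum, mul_add, Finset.sum_add_distrib] at hsum
  rw [← a5, ← a4, ← a3, ← a2, ← a1] at hsum
  have h6 : (6 : QField) ≠ 0 := by norm_num
  refine mul_left_cancel₀ h6 ?_
  linear_combination hsum

/-- Sliding a pair does not change the sum of the multiplicities. -/
theorem sum_codeMult_slide {i : ℕ} (hi : 1 ≤ i) (hin : i + 2 ≤ n) {I : Finset ℕ}
    (hI : ∀ k ∈ I, k + 1 < i ∨ i + 2 < k) :
    ∑ c ∈ (finite_codes Δ g n).toFinset, codeMult n (insert i I) c =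
      ∑ c ∈ (finite_codes Δ g n).toFinset, codeMult n (insert (i + 1) I) c := by
  classical
  rw [← sub_eq_zero, ← Finset.sum_sub_distrib, ← sum_outerWeight_mul_localTerm (Δ := Δ) (g := g)
    hi hin hI]
  refine Finset.sum_subset_zero_on_sdiff ?_ ?_ ?_
  · intro c hc
    rw [Set.Finite.mem_toFinset] at hc ⊢
    exact codes_subset_windowCodes i hc
  · intro c hc
    rw [Finset.mem_sdiff, Set.Finite.mem_toFinset, Set.Finite.mem_toFinset] at hc
    rw [mem_codes_iff hc.1, not_not] at hc
    rw [localTerm, if_pos hc.2, mul_zero]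
  · intro c hc
    rw [Set.Finite.mem_toFinset] at hc
    rw [codeMult_insert_left hi hin hI, codeMult_insert_right hi hin hI, localTerm,
      if_neg ((mem_codes_iff (codes_subset_windowCodes i hc)).1 hc), mul_sub]

/-- The first `s` pairs `{1, 2}, {3, 4}, …`. -/
def firstPairs (s : ℕ) : Finset ℕ := (Finset.range s).image fun j => 2 * j + 1

theorem sum_codeMult_eq_firstPairs {I : Finset ℕ} (hI : IsPairingIndex n I) :
    ∑ c ∈ (finite_codes Δ g n).toFinset, codeMult n I c =
      ∑ c ∈ (finite_codes Δ g n).toFinset, codeMult n (firstPairs I.card) c := by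
  classical
  induction hN : ∑ i ∈ I, i using Nat.strong_induction_on generalizing I with
  | _ N ih =>
  by_cases hmove : ∃ i ∈ I, 2 ≤ i ∧ ∀ j ∈ I, j + 2 ≠ i
  · obtain ⟨k, hk, hk2, hkI⟩ := hmove
    obtain ⟨i, rfl⟩ : ∃ i, k = i + 1 := ⟨k - 1, by omega⟩
    have hI0 : ∀ j ∈ I.erase (i + 1), j + 1 < i ∨ i + 2 < j := by
      intro j hj
      obtain ⟨hj1, hj⟩ := Finset.mem_erase.1 hj
      have h1 := hkI j hj
      have h2 : j ≠ i := fun h => hI.2 j hj (h ▸ hk)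
      have h3 : j ≠ i + 1 + 1 := fun h => hI.2 _ hk (h ▸ hj)
      omega
    have hin := (hI.1 _ hk).2
    have hi : i ∉ I.erase (i + 1) := fun h => by have := hI0 i h; omega
    have hslide := sum_codeMult_slide (Δ := Δ) (g := g) (n := n) (i := i) (by omega) hin hI0
    rw [Finset.insert_erase hk] at hslide
    have hcard : (insert i (I.erase (i + 1))).card = I.card := by
      rw [Finset.card_insert_of_notMem hi, Finset.card_erase_add_one hk]
    rw [← hslide, ← hcard]
    refine ih _ ?_ ?_ rfl
    · rw [← hN, Finset.sum_insert hi, ← Finset.add_sum_erase _ _ hk]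
      omega
    · constructor
      · intro j hj
        rcases Finset.mem_insert.1 hj with rfl | hj
        · omega
        · exact hI.1 j (Finset.mem_of_mem_erase hj)
      · intro j hj hj'
        rcases Finset.mem_insert.1 hj with rfl | hj
        · rcases Finset.mem_insert.1 hj' with h | hj'
          · omega
          · have := hI0 _ hj'; omega
        · rcases Finset.mem_insert.1 hj' with h | hj'
          · have := hI0 _ hj; omega
          · exact hI.2 j (Finset.mem_of_mem_erase hj) (Finset.mem_of_mem_erase hj')
  · push Not at hmove
    suffices h : I = firstPairs I.card by rw [← h]
    have hdown : ∀ j, 2 * j + 1 ∈ I ∨ 2 * j + 2 ∈ I → ∀ j' ≤ j, 2 * j' + 1 ∈ I := by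
      intro j
      induction j with
      | zero =>
        intro h j' hj'
        obtain rfl : j' = 0 := by omega
        rcases h with h | h
        · exact h
        · obtain ⟨k, hk, hk'⟩ := hmove _ h (by omega)
          have := (hI.1 k hk).1
          omega
      | succ j ihj =>
        intro h j' hj'
        have hprev : 2 * j + 1 ∈ I ∨ 2 * j + 2 ∈ I := by
          rcases h with h | h
          · obtain ⟨k, hk, hk'⟩ := hmove _ h (by omega)
            obtain rfl : k = 2 * j + 1 := by omega
            exact .inl hk
          · obtain ⟨k, hk, hk'⟩ := hmove _ h (by omega)
            obtain rfl : k = 2 * j + 2 := by omega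
            exact .inr hk
        rcases Nat.lt_or_ge j j' with hlt | hle
        · obtain rfl : j' = j + 1 := by omega
          rcases h with h | h
          · exact h
          · obtain ⟨k, hk, hk'⟩ := hmove _ h (by omega)
            obtain rfl : k = 2 * j + 1 + 1 := by omega
            exact absurd hk (hI.2 _ (ihj hprev j le_rfl))
        · exact ihj hprev j' hle
    have hodd : ∀ i ∈ I, ∃ j, i = 2 * j + 1 := by
      intro i hi
      rcases Nat.even_or_odd' i with ⟨j, rfl | rfl⟩
      · exfalso
        have := (hI.1 _ hi).1
        obtain ⟨k, rfl⟩ : ∃ k, j = k + 1 := ⟨j - 1, by omega⟩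
        exact hI.2 _ (hdown k (.inr hi) k le_rfl) hi
      · exact ⟨j, rfl⟩
    let J : Finset ℕ := I.image fun i => i / 2
    have hIJ : I = J.image fun j => 2 * j + 1 := by
      ext i
      simp only [J, Finset.image_image, Finset.mem_image, Function.comp_apply]
      constructor
      · intro hi
        obtain ⟨j, rfl⟩ := hodd i hi
        exact ⟨_, hi, by omega⟩
      · rintro ⟨k, hk, rfl⟩
        obtain ⟨j, rfl⟩ := hodd k hk
        convert hk using 1
        omega
    have hinj : Function.Injective fun j => 2 * j + 1 := fun a b h => by
      simp only at h; omega
    have hcard : I.card = J.card := by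
      conv_lhs => rw [hIJ]
      rw [Finset.card_image_of_injective _ hinj]
    have hJ : J = Finset.range J.card := by
      have hclosed : ∀ j ∈ J, ∀ j' ≤ j, j' ∈ J := by
        intro j hj j' hj'
        have h1 : 2 * j + 1 ∈ I := by rw [hIJ]; exact Finset.mem_image_of_mem _ hj
        have h2 := hdown j (.inl h1) j' hj'
        exact Finset.mem_image.2 ⟨_, h2, by omega⟩
      symm
      refine Finset.eq_of_subset_of_card_le ?_ (by simp)
      intro j hj
      by_contra hjJ
      have : J ⊆ Finset.range j := by
        intro x hx
        rw [Finset.mem_range]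
        by_contra hle
        exact hjJ (hclosed x hx j (by omega))
      have := Finset.card_le_card this
      rw [Finset.card_range] at this
      rw [Finset.mem_range] at hj
      omega
    rw [firstPairs, hcard, ← hJ]
    exact hIJ

theorem invariant_eq_sum {n s : ℕ}
    (hn : ∀ D : FloorDiagram Δ g, Fintype.card D.V + Fintype.card D.E = n)
    {S : Finset (Finset ℕ)} (hS : IsPairing n s S) :
    invariant Δ g S =
      ∑ c ∈ (finite_codes Δ g n).toFinset, codeMult n (firstPairs s) c := by
  obtain ⟨I, hI, rfl, rfl⟩ := hS.exists_index
  rw [invariant_eq_finsum hn hI, finsum_mem_eq_finite_toFinset_sum _ (finite_codes Δ g n),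
    sum_codeMult_eq_firstPairs hI]

end

section

variable {Δ Δ' : Set (ℝ × ℝ)} {g N : ℕ} {k : ℤ}

/-! ### Removing the two top vertices -/

/-- The relation between the data of a polygon with a top corner and of the polygon obtained by
cutting it off. -/
structure TopCut (Δ Δ' : Set (ℝ × ℝ)) (k : ℤ) : Prop where
  ePlus_eq : ePlus Δ = 0
  ePlus_cut : ePlus Δ' = 2
  eMinus_cut : eMinus Δ' = eMinus Δ
  height_cut : height Δ = height Δ' + 2
  bLeft_eq : ∀ j, k < j → bLeft Δ j = 0
  bRight_eq : ∀ j, 1 - k < j → bRight Δ j = 0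
  bLeft_cut : ∀ j, bLeft Δ j = bLeft Δ' j + if j = k then 2 else 0
  bRight_cut : ∀ j, bRight Δ j = bRight Δ' j + if j = 1 - k then 2 else 0

theorem TopCut.L_le (hT : TopCut Δ Δ' k) (D : FloorDiagram Δ g) (v : D.V) : D.L v ≤ k := by
  classical
  by_contra h
  have h1 := D.L_bij (D.L v)
  rw [hT.bLeft_eq _ (by omega), Finset.card_eq_zero] at h1
  have : v ∈ (∅ : Finset D.V) := by rw [← h1]; simp
  simp at this

theorem TopCut.R_le (hT : TopCut Δ Δ' k) (D : FloorDiagram Δ g) (v : D.V) : D.R v ≤ 1 - k := by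
  classical
  by_contra h
  have h1 := D.R_bij (D.R v)
  rw [hT.bRight_eq _ (by omega), Finset.card_eq_zero] at h1
  have : v ∈ (∅ : Finset D.V) := by rw [← h1]; simp
  simp at this

theorem TopCut.tgt_ne_none (hT : TopCut Δ Δ' k) (D : FloorDiagram Δ g) (e : D.E) :
    D.tgt e ≠ none := by
  intro h
  have h1 := D.card_sinks
  rw [hT.ePlus_eq, Finset.card_eq_zero] at h1
  have : e ∈ (∅ : Finset D.E) := by rw [← h1]; simp [OrientedGraph.sinks, h]
  simp at this

/-- A vertex that no edge leaves is entered by at most one edge, which has weight `1`. -/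
theorem TopCut.entering (hT : TopCut Δ Δ' k) (D : FloorDiagram Δ g) {v : D.V}
    (hv : ∀ e, D.src e ≠ some v) {e : D.E} (he : D.tgt e = some v) :
    D.L v = k ∧ D.R v = 1 - k ∧ D.w e = 1 ∧ ∀ e', D.tgt e' = some v → e' = e := by
  classical
  have h1 := D.div_eq v
  have h2 := hT.L_le D v
  have h3 := hT.R_le D v
  rw [OrientedGraph.divergence, Finset.filter_false_of_mem fun e _ => hv e, Finset.sum_empty,
    sub_zero] at h1
  have hmem : e ∈ Finset.univ.filter fun e => D.tgt e = some v := by simp [he]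
  have hw := D.w_pos e
  rw [← Finset.add_sum_erase _ _ hmem] at h1
  have hnn : 0 ≤ ∑ e ∈ (Finset.univ.filter fun e => D.tgt e = some v).erase e, (D.w e : ℤ) :=
    Finset.sum_nonneg fun _ _ => by positivity
  refine ⟨by omega, by omega, by omega, fun e' he' => ?_⟩
  by_contra hne
  have hmem' : e' ∈ (Finset.univ.filter fun e => D.tgt e = some v).erase e := by simp [he', hne]
  have hw' := D.w_pos e'
  rw [← Finset.add_sum_erase _ _ hmem'] at h1
  have hnn' : 0 ≤ ∑ e ∈ ((Finset.univ.filter fun e => D.tgt e = some v).erase e).erase e',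
      (D.w e : ℤ) := Finset.sum_nonneg fun _ _ => by positivity
  omega

theorem FloorDiagram.exists_entering (D : FloorDiagram Δ g) {v v' : D.V}
    (hv : ∀ e, D.src e ≠ some v) (hne : v ≠ v') :
    ∃ e u, D.src e = some u ∧ D.tgt e = some v := by
  have h := D.connected.preconnected v v'
  rw [SimpleGraph.reachable_iff_reflTransGen] at h
  rcases Relation.ReflTransGen.cases_head h with h | ⟨x, hx, -⟩
  · exact absurd h hne
  · rw [OrientedGraph.underlying, SimpleGraph.fromRel_adj] at hx
    rcases hx with ⟨-, ⟨e, h1, h2⟩ | ⟨e, h1, h2⟩⟩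
    · exact absurd h1 (hv e)
    · exact ⟨e, x, h1, h2⟩

section Cut

open Classical in
/-- Restriction of an end point to the vertices different from `v₁` and `v₂`. -/
def restrictEnd {V : Type} (v₁ v₂ : V) (o : Option V) : Option {v // v ≠ v₁ ∧ v ≠ v₂} :=
  o.bind fun v => if h : v ≠ v₁ ∧ v ≠ v₂ then some ⟨v, h⟩ else none

theorem restrictEnd_eq_some {V : Type} {v₁ v₂ : V} (o : Option V)
    (v : {v // v ≠ v₁ ∧ v ≠ v₂}) : restrictEnd v₁ v₂ o = some v ↔ o = some v.1 := by
  obtain ⟨v, hv⟩ := v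
  cases o with
  | none => simp [restrictEnd]
  | some u =>
    simp only [restrictEnd, Option.bind_some, Option.some.injEq]
    split_ifs with h
    · simp
    · simp only [false_iff]
      rintro rfl
      exact h hv

theorem restrictEnd_eq_none {V : Type} {v₁ v₂ : V} (o : Option V) :
    restrictEnd v₁ v₂ o = none ↔ o = none ∨ o = some v₁ ∨ o = some v₂ := by
  cases o with
  | none => simp [restrictEnd]
  | some u =>
    simp only [restrictEnd, Option.bind_some, Option.some.injEq]
    split_ifs with h
    · simp [h]
    · simp only [false_or, true_iff]
      tauto

/-- The diagram obtained by removing two vertices that no edge leaves. -/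
theorem TopCut.exists_remove (hT : TopCut Δ Δ' k) (D : FloorDiagram Δ g) {v₁ v₂ : D.V}
    (hne : v₁ ≠ v₂) (h₁ : ∀ e, D.src e ≠ some v₁) (h₂ : ∀ e, D.src e ≠ some v₂) :
    ∃ D' : FloorDiagram Δ' g, ∃ (φ : {v // v ≠ v₁ ∧ v ≠ v₂} ≃ D'.V) (ψ : D.E ≃ D'.E),
      (∀ e, D'.src (ψ e) = (restrictEnd v₁ v₂ (D.src e)).map φ) ∧
      (∀ e, D'.tgt (ψ e) = (restrictEnd v₁ v₂ (D.tgt e)).map φ) ∧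
      (∀ e, D'.w (ψ e) = D.w e) ∧ (∀ v, D'.L (φ v) = D.L v) ∧ (∀ v, D'.R (φ v) = D.R v) := by
  classical
  obtain ⟨e₁, u₁, hs₁, ht₁⟩ := D.exists_entering h₁ hne
  obtain ⟨e₂, u₂, hs₂, ht₂⟩ := D.exists_entering h₂ hne.symm
  obtain ⟨hL₁, hR₁, hw₁, hu₁⟩ := hT.entering D h₁ ht₁
  obtain ⟨hL₂, hR₂, hw₂, hu₂⟩ := hT.entering D h₂ ht₂
  have he : e₁ ≠ e₂ := by
    rintro rfl
    exact hne (by simpa using ht₁.symm.trans ht₂)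
  have hsn : ∀ e, restrictEnd v₁ v₂ (D.src e) = none ↔ D.src e = none := by
    intro e
    rw [restrictEnd_eq_none]
    simp [h₁ e, h₂ e]
  have htn : ∀ e, restrictEnd v₁ v₂ (D.tgt e) = none ↔ e = e₁ ∨ e = e₂ := by
    intro e
    rw [restrictEnd_eq_none]
    simp only [hT.tgt_ne_none D e, false_or]
    constructor
    · exact Or.imp (hu₁ e) (hu₂ e)
    · rintro (rfl | rfl)
      · exact .inl ht₁
      · exact .inr ht₂
  let Γ : OrientedGraph :=
    { V := {v // v ≠ v₁ ∧ v ≠ v₂}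
      E := D.E
      fintypeV := inferInstance
      fintypeE := inferInstance
      src := fun e => restrictEnd v₁ v₂ (D.src e)
      tgt := fun e => restrictEnd v₁ v₂ (D.tgt e)
      adjacent_vertex := by
        intro e
        by_cases h : e = e₁ ∨ e = e₂
        · left
          rw [ne_eq, hsn]
          rcases h with rfl | rfl <;> simp [hs₁, hs₂]
        · right
          rwa [ne_eq, htn] }
  have hu : ∀ {e : D.E} {u}, D.src e = some u → u ≠ v₁ ∧ u ≠ v₂ := by
    intro e u h
    refine ⟨?_, ?_⟩
    · rintro rfl; exact h₁ e h
    · rintro rfl; exact h₂ e h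
  have hcV : Fintype.card D.V = Fintype.card Γ.V + 2 := by
    have h3 : Fintype.card Γ.V = (Finset.univ.filter fun v => v ≠ v₁ ∧ v ≠ v₂).card :=
      Fintype.card_subtype _
    have h4 : (Finset.univ.filter fun v => v ≠ v₁ ∧ v ≠ v₂) = ({v₁, v₂} : Finset D.V)ᶜ := by
      ext v; simp
    have h5 := Finset.card_add_card_compl ({v₁, v₂} : Finset D.V)
    rw [← h4, ← h3, Finset.card_pair hne] at h5
    omega
  have hconn : Γ.underlying.Connected := by
    let f : D.V → Γ.V := fun v => if h : v ≠ v₁ ∧ v ≠ v₂ then ⟨v, h⟩ else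
      if v = v₁ then ⟨u₁, hu hs₁⟩ else ⟨u₂, hu hs₂⟩
    have f0 : ∀ v (h : v ≠ v₁ ∧ v ≠ v₂), f v = ⟨v, h⟩ := fun v h => by simp only [f]; rw [dif_pos h]
    have f1 : f v₁ = ⟨u₁, hu hs₁⟩ := by simp [f]
    have f2 : f v₂ = ⟨u₂, hu hs₂⟩ := by simp [f, hne.symm]
    have hall : ∀ e u v, D.src e = some u → D.tgt e = some v →
        Γ.underlying.Reachable (f u) (f v) := by
      intro e u v hs ht
      rw [f0 u (hu hs)]
      by_cases hv : v ≠ v₁ ∧ v ≠ v₂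
      · rw [f0 v hv]
        exact OrientedGraph.reachable_of (Γ := Γ) (e := e)
          ((restrictEnd_eq_some _ _).2 hs) ((restrictEnd_eq_some _ _).2 ht)
      · by_cases hv1 : v = v₁
        · subst hv1
          obtain rfl := hu₁ e ht
          obtain rfl : u = u₁ := by simpa using hs.symm.trans hs₁
          rw [f1]
        · obtain rfl : v = v₂ := by tauto
          obtain rfl := hu₂ e ht
          obtain rfl : u = u₂ := by simpa using hs.symm.trans hs₂
          rw [f2]
    refine connected_of_reachable D.connected f ?_ fun u v h => ?_
    · rintro ⟨v, hv⟩
      exact ⟨v, f0 v hv⟩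
    · rw [OrientedGraph.underlying, SimpleGraph.fromRel_adj] at h
      rcases h with ⟨-, ⟨x, hu, hv⟩ | ⟨x, hu, hv⟩⟩
      · exact hall x u v hu hv
      · exact (hall x v u hu hv).symm
  have hac : Γ.Acyclic := by
    let ι : Γ.V ⊕ Γ.E → D.V ⊕ D.E := Sum.map Subtype.val id
    have hstep : ∀ α β, Γ.Step α β → D.toOrientedGraph.Step (ι α) (ι β) := by
      rintro _ _ (⟨v, e, h⟩ | ⟨e, v, h⟩)
      · exact .leave _ _ ((restrictEnd_eq_some _ _).1 h)
      · exact .enter _ _ ((restrictEnd_eq_some _ _).1 h)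
    intro α hα
    exact D.acyclic (ι α) (Relation.TransGen.lift ι hstep _ _ hα)
  have hbE : Γ.boundedEdges = D.toOrientedGraph.boundedEdges \ {e₁, e₂} := by
    ext e
    simp only [OrientedGraph.boundedEdges, Finset.mem_filter, Finset.mem_univ, true_and,
      Finset.mem_sdiff, Finset.mem_insert, Finset.mem_singleton]
    change (restrictEnd v₁ v₂ (D.src e) ≠ none ∧ restrictEnd v₁ v₂ (D.tgt e) ≠ none) ↔ _
    rw [ne_eq, ne_eq, hsn, htn]
    simp [hT.tgt_ne_none D e]
  have hcE : Γ.boundedEdges.card + 2 = D.toOrientedGraph.boundedEdges.card := by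
    have hsub : ({e₁, e₂} : Finset D.E) ⊆ D.toOrientedGraph.boundedEdges := by
      intro e h
      simp only [Finset.mem_insert, Finset.mem_singleton] at h
      rcases h with rfl | rfl <;> simp [OrientedGraph.boundedEdges, hs₁, ht₁, hs₂, ht₂]
    have h3 := Finset.card_sdiff_add_card_eq_card hsub
    rw [Finset.card_pair he] at h3
    rw [hbE]
    exact h3
  have hcount : ∀ (F : D.V → ℤ) (x : ℤ), F v₁ = x → F v₂ = x → ∀ j,
      (Finset.univ.filter fun v => F v = j).card =
        (Finset.univ.filter fun v : Γ.V => F v.1 = j).card + if j = x then 2 else 0 := by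
    intro F x hF₁ hF₂ j
    have h3 : (Finset.univ.filter fun v : Γ.V => F v.1 = j).map
        (Function.Embedding.subtype _) = (Finset.univ.filter fun v => F v = j) \ {v₁, v₂} := by
      ext v
      simp
    rw [← Finset.card_map (Function.Embedding.subtype _), h3]
    split_ifs with hj
    · have hsub : ({v₁, v₂} : Finset D.V) ⊆ Finset.univ.filter fun v => F v = j := by
        intro v h
        simp only [Finset.mem_insert, Finset.mem_singleton] at h
        rcases h with rfl | rfl <;> simp [hF₁, hF₂, hj]
      have := Finset.card_sdiff_add_card_eq_card hsub
      rw [Finset.card_pair hne] at this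
      omega
    · rw [Finset.sdiff_eq_self_of_disjoint, add_zero]
      rw [Finset.disjoint_left]
      intro v hv h
      simp only [Finset.mem_filter, Finset.mem_univ, true_and] at hv
      simp only [Finset.mem_insert, Finset.mem_singleton] at h
      rcases h with rfl | rfl
      · exact hj (hv.symm.trans hF₁)
      · exact hj (hv.symm.trans hF₂)
  let D' : FloorDiagram Δ' g :=
    { toOrientedGraph := Γ
      w := D.w
      L := fun v => D.L v.1
      R := fun v => D.R v.1
      w_pos := D.w_pos
      connected := hconn
      acyclic := hac
      genus_eq := by
        have h3 := D.genus_eq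
        rw [OrientedGraph.genus, OrientedGraph.card_connectedComponent D.connected] at h3
        rw [OrientedGraph.genus, OrientedGraph.card_connectedComponent hconn]
        omega
      card_V := by
        have h3 := D.card_V
        rw [hT.height_cut, hcV] at h3
        push_cast at h3
        linarith
      card_sinks := by
        rw [hT.ePlus_cut, ← Finset.card_pair he]
        congr 1
        ext e
        simp only [OrientedGraph.sinks, Finset.mem_filter, Finset.mem_univ, true_and,
          Finset.mem_insert, Finset.mem_singleton]
        exact htn e
      card_sources := by
        rw [hT.eMinus_cut, ← D.card_sources]
        congr 1
        ext e
        simp only [OrientedGraph.sources, Finset.mem_filter, Finset.mem_univ, true_and]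
        exact hsn e
      w_infinite := by
        rintro e (h | h)
        · exact D.w_infinite e (.inl ((hsn e).1 h))
        · rcases (htn e).1 h with h' | h'
          · rw [h', hw₁]
          · rw [h', hw₂]
      L_bij := by
        intro j
        have h3 := D.L_bij j
        have h4 := hcount D.L k hL₁ hL₂ j
        rw [hT.bLeft_cut] at h3
        have h5 := h4.symm.trans h3
        convert Nat.add_right_cancel h5
      R_bij := by
        intro j
        have h3 := D.R_bij j
        have h4 := hcount D.R (1 - k) hR₁ hR₂ j
        rw [hT.bRight_cut] at h3
        have h5 := h4.symm.trans h3
        convert Nat.add_right_cancel h5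
      div_eq := by
        intro v
        rw [← D.div_eq v.1, OrientedGraph.divergence, OrientedGraph.divergence]
        congr 1
        · refine Finset.sum_congr ?_ fun _ _ => rfl
          ext e
          simp only [Finset.mem_filter, Finset.mem_univ, true_and]
          exact restrictEnd_eq_some _ _
        · refine Finset.sum_congr ?_ fun _ _ => rfl
          ext e
          simp only [Finset.mem_filter, Finset.mem_univ, true_and]
          exact restrictEnd_eq_some _ _ }
  refine ⟨D', Equiv.refl _, Equiv.refl _, fun e => ?_, fun e => ?_, fun e => rfl, fun v => rfl,
    fun v => rfl⟩
  · simp only [Equiv.coe_refl, Option.map_id, id]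
    rfl
  · simp only [Equiv.coe_refl, Option.map_id, id]
    rfl

end Cut

end

section

variable {Δ Δ' : Set (ℝ × ℝ)} {g N : ℕ} {k : ℤ}

theorem OrientedGraph.divergence_eq_of_unique {Γ : OrientedGraph} (w : Γ.E → ℕ) {v : Γ.V} {e : Γ.E}
    (hs : ∀ e', Γ.src e' ≠ some v) (ht : ∀ e', Γ.tgt e' = some v ↔ e' = e) :
    Γ.divergence w v = w e := by
  classical
  rw [divergence, Finset.filter_false_of_mem fun e' _ => hs e', Finset.sum_empty, sub_zero,
    Finset.sum_eq_single_of_mem e (by simp [ht])]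
  exact fun e' he' hne => absurd ((ht e').1 (Finset.mem_filter.1 he').2) hne

/-- The diagram obtained by letting the two sinks enter new vertices. -/
theorem TopCut.exists_extend (hT : TopCut Δ Δ' k) (D : FloorDiagram Δ' g) {e₁ e₂ : D.E}
    (he : e₁ ≠ e₂) (h₁ : D.tgt e₁ = none) (h₂ : D.tgt e₂ = none)
    {m : D.V ⊕ D.E → ℕ} (hm : ∀ α β, D.toOrientedGraph.Step α β → m α < m β)
    (hmN : ∀ α, m α ≤ N) :
    ∃ D' : FloorDiagram Δ g, ∃ (φ : D.V ⊕ Bool ≃ D'.V) (ψ : D.E ≃ D'.E),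
      (∀ e, D'.src (ψ e) = (D.src e).map fun v => φ (.inl v)) ∧
      (∀ e, D.tgt e ≠ none → D'.tgt (ψ e) = (D.tgt e).map fun v => φ (.inl v)) ∧
      D'.tgt (ψ e₁) = some (φ (.inr false)) ∧ D'.tgt (ψ e₂) = some (φ (.inr true)) ∧
      (∀ e, D'.w (ψ e) = D.w e) ∧
      (∀ v, D'.L (φ (.inl v)) = D.L v) ∧ (∀ v, D'.R (φ (.inl v)) = D.R v) ∧
      (∀ b, D'.L (φ (.inr b)) = k) ∧ (∀ b, D'.R (φ (.inr b)) = 1 - k) ∧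
      ∀ e, D.tgt e = none → e = e₁ ∨ e = e₂ := by
  classical
  have hsinks : D.toOrientedGraph.sinks = {e₁, e₂} := by
    symm
    refine Finset.eq_of_subset_of_card_le ?_ ?_
    · intro e h
      simp only [Finset.mem_insert, Finset.mem_singleton] at h
      rcases h with rfl | rfl <;> simp [OrientedGraph.sinks, h₁, h₂]
    · rw [D.card_sinks, hT.ePlus_cut, Finset.card_pair he]
  have hnone : ∀ e, D.tgt e = none → e = e₁ ∨ e = e₂ := by
    intro e h
    have : e ∈ D.toOrientedGraph.sinks := by simp [OrientedGraph.sinks, h]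
    rw [hsinks] at this
    simpa using this
  let tgt : D.E → Option (D.V ⊕ Bool) := fun e =>
    if e = e₁ then some (.inr false) else if e = e₂ then some (.inr true) else
      (D.tgt e).map .inl
  have t1 : tgt e₁ = some (.inr false) := by simp [tgt]
  have t2 : tgt e₂ = some (.inr true) := by simp [tgt, he.symm]
  have t0 : ∀ e, D.tgt e ≠ none → tgt e = (D.tgt e).map .inl := by
    intro e h
    have ne1 : e ≠ e₁ := by rintro rfl; exact h h₁
    have ne2 : e ≠ e₂ := by rintro rfl; exact h h₂
    simp [tgt, ne1, ne2]
  have hcases : ∀ P : D.E → Prop, P e₁ → P e₂ → (∀ e, D.tgt e ≠ none → P e) → ∀ e, P e := by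
    intro P p1 p2 p0 e
    by_cases h : D.tgt e = none
    · rcases hnone e h with rfl | rfl <;> assumption
    · exact p0 e h
  have tne : ∀ e, tgt e ≠ none := by
    refine hcases _ (by simp [t1]) (by simp [t2]) fun e h => ?_
    rw [t0 e h]
    simpa using h
  have tinl : ∀ e v, tgt e = some (.inl v) ↔ D.tgt e = some v := by
    intro e v
    revert e
    refine hcases _ (by simp [t1, h₁]) (by simp [t2, h₂]) fun e h => ?_
    rw [t0 e h]
    simp
  have tinr : ∀ e b, tgt e = some (.inr b) ↔ e = if b then e₂ else e₁ := by
    intro e b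
    revert e
    refine hcases _ ?_ ?_ fun e h => ?_
    · cases b <;> simp [t1, he]
    · cases b <;> simp [t2, he.symm]
    · have ne1 : e ≠ e₁ := by rintro rfl; exact h h₁
      have ne2 : e ≠ e₂ := by rintro rfl; exact h h₂
      rw [t0 e h]
      cases b <;> simp [ne1, ne2]
  have sinl : ∀ e v, ((D.src e).map Sum.inl : Option (D.V ⊕ Bool)) = some (.inl v) ↔
      D.src e = some v := by
    intro e v; simp
  have sinr : ∀ e b, ((D.src e).map Sum.inl : Option (D.V ⊕ Bool)) ≠ some (.inr b) := by
    intro e v; simp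
  have hs : ∀ e, e = e₁ ∨ e = e₂ → D.src e ≠ none := by
    intro e h
    rcases D.adjacent_vertex e with h' | h'
    · exact h'
    · rcases h with rfl | rfl
      · exact absurd h₁ h'
      · exact absurd h₂ h'
  let Γ : OrientedGraph :=
    { V := D.V ⊕ Bool
      E := D.E
      fintypeV := inferInstance
      fintypeE := inferInstance
      src := fun e => (D.src e).map Sum.inl
      tgt := tgt
      adjacent_vertex := fun e => .inr (tne e) }
  have hcV : Fintype.card Γ.V = Fintype.card D.V + 2 := Fintype.card_sum
  have hconn : Γ.underlying.Connected := by
    have hreach : ∀ u v, D.toOrientedGraph.underlying.Reachable u v →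
        Γ.underlying.Reachable (.inl u) (.inl v) := by
      have hall : ∀ e u v, D.src e = some u → D.tgt e = some v →
          Γ.underlying.Reachable (.inl u) (.inl v) := fun e u v hu hv =>
        OrientedGraph.reachable_of (Γ := Γ) (e := e) ((sinl e u).2 hu) ((tinl e v).2 hv)
      intro u v huv
      rw [SimpleGraph.reachable_iff_reflTransGen] at huv
      induction huv with
      | refl => exact .rfl
      | tail _ h' ih =>
        refine ih.trans ?_
        rw [OrientedGraph.underlying, SimpleGraph.fromRel_adj] at h'
        rcases h' with ⟨-, ⟨x, hu, hv⟩ | ⟨x, hu, hv⟩⟩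
        · exact hall x _ _ hu hv
        · exact (hall x _ _ hu hv).symm
    obtain ⟨v₀⟩ := D.connected.nonempty
    have hto : ∀ x : Γ.V, Γ.underlying.Reachable x (.inl v₀) := by
      rintro (v | b)
      · exact hreach _ _ (D.connected.preconnected v v₀)
      · have h3 : ∃ u, D.src (if b then e₂ else e₁) = some u :=
          Option.ne_none_iff_exists'.1 (hs _ (by cases b <;> simp))
        obtain ⟨u, hu⟩ := h3
        refine .trans (.symm ?_) (hreach u v₀ (D.connected.preconnected u v₀))
        exact OrientedGraph.reachable_of (Γ := Γ) (e := if b then e₂ else e₁)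
          ((sinl _ u).2 hu) ((tinr _ b).2 rfl)
    exact (SimpleGraph.connected_iff _).2
      ⟨fun x y => (hto x).trans (hto y).symm, ⟨.inl v₀⟩⟩
  have hac : Γ.Acyclic := by
    refine OrientedGraph.acyclic_of_increasing
      (m := fun
        | .inl (.inl v) => m (.inl v)
        | .inl (.inr _) => N + 1
        | .inr e => m (.inr e)) ?_
    rintro _ _ (⟨v | b, e, h⟩ | ⟨e, v | b, h⟩)
    · exact hm _ _ (.leave _ _ ((sinl e v).1 h))
    · exact absurd h (sinr e b)
    · exact hm _ _ (.enter _ _ ((tinl e v).1 h))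
    · exact Nat.lt_succ_of_le (hmN _)
  have hbE : D.toOrientedGraph.boundedEdges = Γ.boundedEdges \ {e₁, e₂} := by
    ext e
    simp only [OrientedGraph.boundedEdges, Finset.mem_filter, Finset.mem_univ, true_and,
      Finset.mem_sdiff, Finset.mem_insert, Finset.mem_singleton]
    change _ ↔ ((D.src e).map Sum.inl ≠ none ∧ tgt e ≠ none) ∧ _
    have : D.tgt e ≠ none ↔ ¬ (e = e₁ ∨ e = e₂) := by
      constructor
      · rintro h (rfl | rfl)
        · exact h h₁
        · exact h h₂
      · exact fun h h' => h (hnone e h')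
    rw [this]
    simp [tne e]
  have hcE : D.toOrientedGraph.boundedEdges.card + 2 = Γ.boundedEdges.card := by
    have hsub : ({e₁, e₂} : Finset D.E) ⊆ Γ.boundedEdges := by
      intro e h
      simp only [Finset.mem_insert, Finset.mem_singleton] at h
      simp only [OrientedGraph.boundedEdges, Finset.mem_filter, Finset.mem_univ, true_and]
      exact ⟨by simpa [Γ] using hs e h, tne e⟩
    have h3 := Finset.card_sdiff_add_card_eq_card hsub
    rw [Finset.card_pair he] at h3
    rw [hbE]
    exact h3
  have hcount : ∀ (F : D.V → ℤ) (x j : ℤ),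
      (Finset.univ.filter fun v : D.V ⊕ Bool => Sum.elim F (fun _ => x) v = j).card =
        (Finset.univ.filter fun v => F v = j).card + if j = x then 2 else 0 := by
    intro F x j
    rw [Finset.card_filter, Finset.card_filter, Fintype.sum_sum_type]
    simp only [Sum.elim_inl, Sum.elim_inr]
    congr 1
    by_cases h : j = x
    · simp [h]
    · simp [h, Ne.symm h]
  let D' : FloorDiagram Δ g :=
    { toOrientedGraph := Γ
      w := D.w
      L := Sum.elim D.L fun _ => k
      R := Sum.elim D.R fun _ => 1 - k
      w_pos := D.w_pos
      connected := hconn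
      acyclic := hac
      genus_eq := by
        have h3 := D.genus_eq
        rw [OrientedGraph.genus, OrientedGraph.card_connectedComponent D.connected] at h3
        rw [OrientedGraph.genus, OrientedGraph.card_connectedComponent hconn]
        omega
      card_V := by
        have h3 := D.card_V
        rw [hT.height_cut, hcV, ← h3]
        push_cast
        ring
      card_sinks := by
        rw [hT.ePlus_eq, Finset.card_eq_zero, OrientedGraph.sinks, Finset.filter_eq_empty_iff]
        exact fun e _ => tne e
      card_sources := by
        rw [← hT.eMinus_cut, ← D.card_sources]
        congr 1
        ext e
        simp [OrientedGraph.sources, Γ]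
      w_infinite := by
        rintro e (h | h)
        · exact D.w_infinite e (.inl (by simpa [Γ] using h))
        · exact absurd h (tne e)
      L_bij := by
        intro j
        rw [hT.bLeft_cut, ← D.L_bij j]
        convert hcount D.L k j
      R_bij := by
        intro j
        rw [hT.bRight_cut, ← D.R_bij j]
        convert hcount D.R (1 - k) j
      div_eq := by
        rintro (v | b)
        · refine Eq.trans ?_ (D.div_eq v)
          rw [OrientedGraph.divergence, OrientedGraph.divergence]
          congr 1
          · refine Finset.sum_congr ?_ fun _ _ => rfl
            ext e
            simp only [Finset.mem_filter, Finset.mem_univ, true_and]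
            exact tinl e v
          · refine Finset.sum_congr ?_ fun _ _ => rfl
            ext e
            simp only [Finset.mem_filter, Finset.mem_univ, true_and]
            exact sinl e v
        · rw [OrientedGraph.divergence_eq_of_unique (Γ := Γ) D.w (fun e => sinr e b)
            fun e => tinr e b]
          have h4 : D.w (if b then e₂ else e₁) = 1 :=
            D.w_infinite _ (.inr (by cases b <;> simp [h₁, h₂]))
          rw [h4]
          simp }
  refine ⟨D', Equiv.refl _, Equiv.refl _, fun e => rfl, fun e h => t0 e h, t1, t2, fun e => rfl,
    fun v => rfl, fun v => rfl, fun b => rfl, fun b => rfl, hnone⟩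

end

section

variable {Δ Δ' : Set (ℝ × ℝ)} {g N : ℕ} {k : ℤ}

theorem mark_le {n : ℕ} {c : ℕ → Cell} (hc : c ∈ looseCodes Δ g n) {j : ℕ}
    (h : c j ≠ .empty) : 1 ≤ j ∧ j ≤ n := by
  obtain ⟨D, m, hm, hr, rfl⟩ := hc
  by_contra hj
  refine h (FloorDiagram.code_of_not_mem fun α hα => hj ?_)
  have : j ∈ Set.Icc 1 n := hr ▸ ⟨α, hα⟩
  exact this

theorem TopCut.code_tgt (hT : TopCut Δ Δ' k) {n : ℕ} {c : ℕ → Cell} (hc : c ∈ codes Δ g n)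
    {j w : ℕ} {s t : Option ℕ} (h : c j = .edge s t w) : ∃ b, t = some b ∧ j < b ∧ b ≤ n := by
  have ht : ∃ b, t = some b := by
    obtain ⟨⟨D, m, hm, hr, rfl⟩, -⟩ := hc
    obtain ⟨e, -, -, rfl, -⟩ := FloorDiagram.code_eq_edge hm h
    obtain ⟨v, hv⟩ := Option.ne_none_iff_exists'.1 (hT.tgt_ne_none D e)
    exact ⟨_, by rw [hv]; rfl⟩
  obtain ⟨b, rfl⟩ := ht
  refine ⟨b, rfl, hc.2 _ _ (codeStep_tgt hc.1 h rfl), ?_⟩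
  obtain ⟨l, r, hb⟩ := tgt_eq_vert hc.1 h
  exact (mark_le hc.1 (by simp [hb])).2

theorem TopCut.code_top (hT : TopCut Δ Δ' k) {n : ℕ} (hn : 1 ≤ n) {c : ℕ → Cell}
    (hc : c ∈ codes Δ g n) : ∃ l r, c n = .vert l r := by
  rcases h : c n with _ | ⟨l, r⟩ | ⟨s, t, w⟩
  · exact absurd h (ne_empty hc.1 hn le_rfl)
  · exact ⟨l, r, rfl⟩
  · obtain ⟨b, -, h1, h2⟩ := hT.code_tgt hc h
    omega

theorem TopCut.code_edge_top (hT : TopCut Δ Δ' k) {c : ℕ → Cell}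
    (hc : c ∈ codes Δ g (N + 2)) {s t : Option ℕ} {w : ℕ} (h : c (N + 1) = .edge s t w) :
    t = some (N + 2) ∧ w = 1 := by
  obtain ⟨b, rfl, h1, h2⟩ := hT.code_tgt hc h
  obtain rfl : b = N + 2 := by omega
  refine ⟨rfl, ?_⟩
  obtain ⟨⟨D, m, hm, hr, rfl⟩, hinc⟩ := hc
  obtain ⟨e, -, -, ht, rfl⟩ := FloorDiagram.code_eq_edge hm h
  obtain ⟨v, hv, hvm⟩ := Option.map_eq_some_iff.1 ht
  refine (hT.entering D ?_ hv).2.2.1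
  intro e' he'
  have h3 := hinc _ _ ((FloorDiagram.codeStep_code hm _ _).2
    (OrientedGraph.Step.leave v e' he'))
  have h4 : m (.inr e') ∈ Set.Icc 1 (N + 2) := hr ▸ ⟨_, rfl⟩
  have := h4.2
  omega

/-- Removing the elements with mark larger than `N`. -/
def cutCell (N : ℕ) : Cell → Cell
  | .empty => .empty
  | .vert l r => .vert l r
  | .edge s t w => .edge s (t.filter fun x => x ≤ N) w

/-- Removing the elements with mark larger than `N`. -/
def cutCode (N : ℕ) (c : ℕ → Cell) (j : ℕ) : Cell :=
  if j ≤ N then cutCell N (c j) else .empty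

/-- The edges `a` and `b` enter the top vertices `N + 1` and `N + 2`, respectively. -/
def TopEdges (N : ℕ) (k : ℤ) (c : ℕ → Cell) (a b : ℕ) : Prop :=
  a ≠ b ∧ a ≤ N ∧ b ≤ N ∧
    (∃ u, u ≤ N ∧ c a = .edge (some u) (some (N + 1)) 1) ∧
    (∃ u, u ≤ N ∧ c b = .edge (some u) (some (N + 2)) 1) ∧
    c (N + 1) = .vert k (1 - k) ∧ c (N + 2) = .vert k (1 - k) ∧
    (∀ j s w, c j = .edge s (some (N + 1)) w → j = a) ∧
    (∀ j s w, c j = .edge s (some (N + 2)) w → j = b)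

theorem TopCut.cut_mem (hT : TopCut Δ Δ' k) {c : ℕ → Cell} (hc : c ∈ codes Δ g (N + 2))
    {l r : ℤ} (hv : c (N + 1) = .vert l r) :
    cutCode N c ∈ codes Δ' g N ∧ ∃ a b, TopEdges N k c a b := by
  obtain ⟨l', r', hv'⟩ := hT.code_top (by omega) hc
  obtain ⟨⟨D, m, hm, hr, rfl⟩, hinc⟩ := hc
  obtain ⟨v₁, hm₁, -⟩ := FloorDiagram.code_eq_vert hm hv
  obtain ⟨v₂, hm₂, -⟩ := FloorDiagram.code_eq_vert hm hv'
  have hmem : ∀ α, 1 ≤ m α ∧ m α ≤ N + 2 := fun α => by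
    have : m α ∈ Set.Icc 1 (N + 2) := hr ▸ ⟨α, rfl⟩
    exact this
  have hstep : ∀ α β, D.toOrientedGraph.Step α β → m α < m β := fun α β h =>
    hinc _ _ ((FloorDiagram.codeStep_code hm _ _).2 h)
  have hne : v₁ ≠ v₂ := by rintro rfl; omega
  have hE : ∀ e, m (.inr e) ≤ N := by
    intro e
    have h1 := FloorDiagram.inl_ne_inr hm v₁ e
    have h2 := FloorDiagram.inl_ne_inr hm v₂ e
    have := hmem (.inr e)
    omega
  have hV : ∀ v, m (.inl v) ≤ N ↔ v ≠ v₁ ∧ v ≠ v₂ := by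
    intro v
    constructor
    · intro h
      refine ⟨?_, ?_⟩ <;> rintro rfl <;> omega
    · rintro ⟨h1, h2⟩
      have h3 : m (.inl v) ≠ N + 1 := fun h => h1 (FloorDiagram.inl_inj hm (h.trans hm₁.symm))
      have h4 : m (.inl v) ≠ N + 2 := fun h => h2 (FloorDiagram.inl_inj hm (h.trans hm₂.symm))
      have := hmem (.inl v)
      omega
  have h₁ : ∀ e, D.src e ≠ some v₁ := fun e h => by
    have h3 := hstep _ _ (.leave v₁ e h)
    have := hE e
    omega
  have h₂ : ∀ e, D.src e ≠ some v₂ := fun e h => by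
    have h3 := hstep _ _ (.leave v₂ e h)
    have := hE e
    omega
  constructor
  · obtain ⟨D', φ, ψ, hs, ht, hw, hL, hR⟩ := hT.exists_remove D hne h₁ h₂
    let ι : D'.V ⊕ D'.E → D.V ⊕ D.E := Sum.map (fun v => (φ.symm v).1) ψ.symm
    let m' : D'.V ⊕ D'.E → ℕ := fun α => m (ι α)
    have hι : Function.Injective ι :=
      Sum.map_injective.2 ⟨Subtype.val_injective.comp φ.symm.injective, ψ.symm.injective⟩
    have hm' : Function.Injective m' := hm.comp hι
    have hres : ∀ o : Option D.V, (((restrictEnd v₁ v₂ o).map φ).map fun v => m' (.inl v)) =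
        (o.map fun v => m (.inl v)).filter fun x => x ≤ N := by
      intro o
      cases o with
      | none => rfl
      | some v =>
        by_cases h : v ≠ v₁ ∧ v ≠ v₂
        · rw [(restrictEnd_eq_some (some v) ⟨v, h⟩).2 rfl]
          simp [m', ι, Option.filter, (hV v).2 h]
        · rw [(restrictEnd_eq_none _).2 (by
            have : v = v₁ ∨ v = v₂ := by tauto
            simpa using this)]
          have : ¬ m (.inl v) ≤ N := fun h' => h ((hV v).1 h')
          simp [Option.filter, this]
    have hcode : D'.code m' = cutCode N (D.code m) := by
      funext j
      by_cases hj : ∃ α, m' α = j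
      · obtain ⟨α, rfl⟩ := hj
        rw [FloorDiagram.code_apply hm']
        rcases α with v | e
        · obtain ⟨⟨v, h⟩, rfl⟩ := φ.surjective v
          have h3 : m' (.inl (φ ⟨v, h⟩)) = m (.inl v) := by simp [m', ι]
          rw [h3, cutCode, if_pos ((hV v).2 h), FloorDiagram.code_inl hm]
          simp [FloorDiagram.cell, cutCell, hL, hR]
        · obtain ⟨e, rfl⟩ := ψ.surjective e
          have h3 : m' (.inr (ψ e)) = m (.inr e) := by simp [m', ι]
          rw [h3, cutCode, if_pos (hE e), FloorDiagram.code_inr hm, FloorDiagram.cell, cutCell,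
            hs, ht, hw, hres, hres]
          congr 1
          rcases ho : D.src e with _ | u
          · rfl
          · have hu : u ≠ v₁ ∧ u ≠ v₂ := by
              refine ⟨?_, ?_⟩
              · rintro rfl; exact h₁ e ho
              · rintro rfl; exact h₂ e ho
            simp [Option.filter, (hV u).2 hu]
      · rw [FloorDiagram.code_of_not_mem (not_exists.1 hj), cutCode]
        split_ifs with hjN
        · by_cases hj' : ∃ α, m α = j
          · exfalso
            obtain ⟨α, rfl⟩ := hj'
            rcases α with v | e
            · exact hj ⟨.inl (φ ⟨v, (hV v).1 hjN⟩), by simp [m', ι]⟩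
            · exact hj ⟨.inr (ψ e), by simp [m', ι]⟩
          · rw [FloorDiagram.code_of_not_mem (not_exists.1 hj'), cutCell]
        · rfl
    refine ⟨⟨D', m', hm', ?_, hcode⟩, ?_⟩
    · ext j
      constructor
      · rintro ⟨α, rfl⟩
        refine ⟨(hmem _).1, ?_⟩
        rcases α with v | e
        · exact (hV _).2 (φ.symm v).2
        · exact hE _
      · rintro ⟨hj1, hj2⟩
        have : j ∈ Set.range m := by rw [hr]; exact ⟨hj1, by omega⟩
        obtain ⟨α, rfl⟩ := this
        rcases α with v | e
        · exact ⟨.inl (φ ⟨v, (hV v).1 hj2⟩), by simp [m', ι]⟩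
        · exact ⟨.inr (ψ e), by simp [m', ι]⟩
    · rw [← hcode, ← FloorDiagram.increasing_iff hm']
      refine FloorDiagram.prec_increasing ?_
      rintro _ _ (⟨v, e, h⟩ | ⟨e, v, h⟩)
      · obtain ⟨e, rfl⟩ := ψ.surjective e
        obtain ⟨v, rfl⟩ := φ.surjective v
        rw [hs, Option.map_eq_some_iff] at h
        obtain ⟨x, hx, hx'⟩ := h
        obtain rfl := φ.injective hx'
        have := hstep _ _ (.leave _ _ ((restrictEnd_eq_some _ _).1 hx))
        simpa [m', ι] using this
      · obtain ⟨e, rfl⟩ := ψ.surjective e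
        obtain ⟨v, rfl⟩ := φ.surjective v
        rw [ht, Option.map_eq_some_iff] at h
        obtain ⟨x, hx, hx'⟩ := h
        obtain rfl := φ.injective hx'
        have := hstep _ _ (.enter _ _ ((restrictEnd_eq_some _ _).1 hx))
        simpa [m', ι] using this
  · obtain ⟨e₁, u₁, hs₁, ht₁⟩ := D.exists_entering h₁ hne
    obtain ⟨e₂, u₂, hs₂, ht₂⟩ := D.exists_entering h₂ hne.symm
    obtain ⟨hL₁, hR₁, hw₁, hu₁⟩ := hT.entering D h₁ ht₁
    obtain ⟨hL₂, hR₂, hw₂, hu₂⟩ := hT.entering D h₂ ht₂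
    have hu : ∀ {e u}, D.src e = some u → m (.inl u) ≤ N := by
      intro e u h
      have h3 := hstep _ _ (.leave u e h)
      have := hE e
      omega
    refine ⟨m (.inr e₁), m (.inr e₂), ?_, hE _, hE _, ⟨m (.inl u₁), hu hs₁, ?_⟩,
      ⟨m (.inl u₂), hu hs₂, ?_⟩, ?_, ?_, ?_, ?_⟩
    · intro h
      obtain rfl := FloorDiagram.inr_inj hm h
      exact hne (by simpa using ht₁.symm.trans ht₂)
    · rw [FloorDiagram.code_inr hm, hs₁, ht₁, hw₁, ← hm₁]; rfl
    · rw [FloorDiagram.code_inr hm, hs₂, ht₂, hw₂, ← hm₂]; rfl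
    · rw [← hm₁, FloorDiagram.code_inl hm, hL₁, hR₁]
    · rw [← hm₂, FloorDiagram.code_inl hm, hL₂, hR₂]
    · intro j s w h
      obtain ⟨e, rfl, -, h, -⟩ := FloorDiagram.code_eq_edge hm h
      rw [← hm₁, FloorDiagram.map_mark_eq_some hm] at h
      rw [hu₁ e h]
    · intro j s w h
      obtain ⟨e, rfl, -, h, -⟩ := FloorDiagram.code_eq_edge hm h
      rw [← hm₂, FloorDiagram.map_mark_eq_some hm] at h
      rw [hu₂ e h]

end

section

variable {Δ Δ' : Set (ℝ × ℝ)} {g N : ℕ} {k : ℤ}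

theorem TopCut.exists_extension (hT : TopCut Δ Δ' k) {c' : ℕ → Cell} (hc' : c' ∈ codes Δ' g N)
    (p : Prop) : ∃ c ∈ codes Δ g (N + 2), (∃ l r, c (N + 1) = .vert l r) ∧ cutCode N c = c' ∧
      ∃ a b, TopEdges N k c a b ∧ (a < b ↔ p) := by
  classical
  obtain ⟨⟨D, m, hm, hr, rfl⟩, hinc⟩ := hc'
  have hmem : ∀ α, 1 ≤ m α ∧ m α ≤ N := fun α => by
    have : m α ∈ Set.Icc 1 N := hr ▸ ⟨α, rfl⟩
    exact this
  have hstep : ∀ α β, D.toOrientedGraph.Step α β → m α < m β := fun α β h =>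
    hinc _ _ ((FloorDiagram.codeStep_code hm _ _).2 h)
  have hsinks : ∃ e₁ e₂, e₁ ≠ e₂ ∧ D.tgt e₁ = none ∧ D.tgt e₂ = none ∧
      (m (.inr e₁) < m (.inr e₂) ↔ p) := by
    have h := D.card_sinks
    rw [hT.ePlus_cut, Finset.card_eq_two] at h
    obtain ⟨e₁, e₂, hne, h⟩ := h
    have h1 : D.tgt e₁ = none := by
      have : e₁ ∈ D.toOrientedGraph.sinks := by rw [h]; simp
      simpa [OrientedGraph.sinks] using this
    have h2 : D.tgt e₂ = none := by
      have : e₂ ∈ D.toOrientedGraph.sinks := by rw [h]; simp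
      simpa [OrientedGraph.sinks] using this
    by_cases hlt : m (.inr e₁) < m (.inr e₂) ↔ p
    · exact ⟨e₁, e₂, hne, h1, h2, hlt⟩
    · refine ⟨e₂, e₁, hne.symm, h2, h1, ?_⟩
      have hne' : m (.inr e₁) ≠ m (.inr e₂) := fun h => hne (FloorDiagram.inr_inj hm h)
      by_cases hp : p
      · simp only [hp, iff_true] at hlt ⊢
        omega
      · simp only [hp, iff_false] at hlt ⊢
        omega
  obtain ⟨e₁, e₂, hne, h₁, h₂, hp⟩ := hsinks
  obtain ⟨D', φ, ψ, hs, ht, ht₁, ht₂, hw, hL, hR, hLb, hRb, hnone⟩ :=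
    hT.exists_extend D hne h₁ h₂ hstep (fun α => (hmem α).2)
  let M : (D.V ⊕ Bool) ⊕ D.E → ℕ := fun
    | .inl (.inl v) => m (.inl v)
    | .inl (.inr b) => if b then N + 2 else N + 1
    | .inr e => m (.inr e)
  have hM : Function.Injective M := by
    rintro ((v | b) | e) ((v' | b') | e') h
    · rw [FloorDiagram.inl_inj hm h]
    · have := hmem (.inl v)
      simp only [M] at h
      split_ifs at h <;> omega
    · exact absurd h (FloorDiagram.inl_ne_inr hm v e')
    · have := hmem (.inl v')
      simp only [M] at h
      split_ifs at h <;> omega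
    · cases b <;> cases b' <;> simp [M] at h ⊢
    · have := hmem (.inr e')
      simp only [M] at h
      split_ifs at h <;> omega
    · exact absurd h.symm (FloorDiagram.inl_ne_inr hm v' e)
    · have := hmem (.inr e)
      simp only [M] at h
      split_ifs at h <;> omega
    · rw [FloorDiagram.inr_inj hm h]
  let ι : D'.V ⊕ D'.E ≃ (D.V ⊕ Bool) ⊕ D.E := Equiv.sumCongr φ.symm ψ.symm
  let m' : D'.V ⊕ D'.E → ℕ := fun α => M (ι α)
  have hm' : Function.Injective m' := hM.comp ι.injective
  have mv : ∀ v, m' (.inl (φ (.inl v))) = m (.inl v) := fun v => by simp [m', ι, M]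
  have m1 : m' (.inl (φ (.inr false))) = N + 1 := by simp [m', ι, M]
  have m2 : m' (.inl (φ (.inr true))) = N + 2 := by simp [m', ι, M]
  have me : ∀ e, m' (.inr (ψ e)) = m (.inr e) := fun e => by simp [m', ι, M]
  have hcasesV : ∀ v : D'.V, (∃ u, v = φ (.inl u)) ∨ v = φ (.inr false) ∨ v = φ (.inr true) := by
    intro v
    obtain ⟨v | b, rfl⟩ := φ.surjective v
    · exact .inl ⟨v, rfl⟩
    · cases b <;> simp
  have hr' : Set.range m' = Set.Icc 1 (N + 2) := by
    ext j
    constructor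
    · rintro ⟨v | e, rfl⟩
      · rcases hcasesV v with ⟨v, rfl⟩ | rfl | rfl
        · rw [mv]
          exact ⟨(hmem _).1, (hmem _).2.trans (by omega)⟩
        · rw [m1]; exact ⟨by omega, by omega⟩
        · rw [m2]; exact ⟨by omega, by omega⟩
      · obtain ⟨e, rfl⟩ := ψ.surjective e
        rw [me]
        exact ⟨(hmem _).1, (hmem _).2.trans (by omega)⟩
    · rintro ⟨hj1, hj2⟩
      by_cases hjN : j ≤ N
      · have : j ∈ Set.range m := by rw [hr]; exact ⟨hj1, hjN⟩
        obtain ⟨v | e, rfl⟩ := this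
        · exact ⟨.inl (φ (.inl v)), mv v⟩
        · exact ⟨.inr (ψ e), me e⟩
      · have : j = N + 1 ∨ j = N + 2 := by omega
        rcases this with rfl | rfl
        · exact ⟨_, m1⟩
        · exact ⟨_, m2⟩
  have hsrc : ∀ e, ((D'.src (ψ e)).map fun v => m' (.inl v)) =
      (D.src e).map fun v => m (.inl v) := by
    intro e
    rw [hs, Option.map_map]
    congr 1
    funext v
    exact mv v
  have htgt : ∀ e, D.tgt e ≠ none → ((D'.tgt (ψ e)).map fun v => m' (.inl v)) =
      (D.tgt e).map fun v => m (.inl v) := by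
    intro e h
    rw [ht e h, Option.map_map]
    congr 1
    funext v
    exact mv v
  have htgt1 : ((D'.tgt (ψ e₁)).map fun v => m' (.inl v)) = some (N + 1) := by
    rw [ht₁, Option.map_some, m1]
  have htgt2 : ((D'.tgt (ψ e₂)).map fun v => m' (.inl v)) = some (N + 2) := by
    rw [ht₂, Option.map_some, m2]
  have hcut : cutCode N (D'.code m') = D.code m := by
    funext j
    by_cases hjN : j ≤ N
    · rw [cutCode, if_pos hjN]
      by_cases hj : ∃ α, m α = j
      · obtain ⟨v | e, rfl⟩ := hj
        · rw [← mv, FloorDiagram.code_inl hm', mv, FloorDiagram.code_inl hm, cutCell, hL, hR]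
        · rw [← me, FloorDiagram.code_inr hm', me, FloorDiagram.code_inr hm, cutCell, hsrc, hw]
          by_cases h : D.tgt e = none
          · rw [h]
            rcases hnone e h with rfl | rfl
            · rw [htgt1]; simp [Option.filter]
            · rw [htgt2]; simp [Option.filter]
          · rw [htgt e h]
            obtain ⟨v, hv⟩ := Option.ne_none_iff_exists'.1 h
            rw [hv]
            simp [Option.filter, (hmem (.inl v)).2]
      · rw [FloorDiagram.code_of_not_mem (not_exists.1 hj), FloorDiagram.code_of_not_mem]
        · rfl
        · rintro (v | e) h
          · rcases hcasesV v with ⟨v, rfl⟩ | rfl | rfl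
            · exact hj ⟨_, (mv v).symm.trans h⟩
            · rw [m1] at h; omega
            · rw [m2] at h; omega
          · obtain ⟨e, rfl⟩ := ψ.surjective e
            exact hj ⟨_, (me e).symm.trans h⟩
    · rw [cutCode, if_neg hjN, FloorDiagram.code_of_not_mem]
      intro α h
      exact hjN (h ▸ (hmem α).2)
  have hcodes : D'.code m' ∈ codes Δ g (N + 2) := by
    refine ⟨⟨D', m', hm', hr', rfl⟩, ?_⟩
    rw [← FloorDiagram.increasing_iff hm']
    refine FloorDiagram.prec_increasing ?_
    rintro _ _ (⟨v, e, h⟩ | ⟨e, v, h⟩)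
    · obtain ⟨e, rfl⟩ := ψ.surjective e
      rw [hs, Option.map_eq_some_iff] at h
      obtain ⟨u, hu, rfl⟩ := h
      rw [mv, me]
      exact hstep _ _ (.leave _ _ hu)
    · obtain ⟨e, rfl⟩ := ψ.surjective e
      have := (hmem (.inr e)).2
      by_cases hn : D.tgt e = none
      · rcases hnone e hn with rfl | rfl
        · obtain rfl : φ (.inr false) = v := by simpa using ht₁.symm.trans h
          rw [me, m1]; omega
        · obtain rfl : φ (.inr true) = v := by simpa using ht₂.symm.trans h
          rw [me, m2]; omega
      · rw [ht e hn, Option.map_eq_some_iff] at h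
        obtain ⟨u, hu, rfl⟩ := h
        rw [mv, me]
        exact hstep _ _ (.enter _ _ hu)
  have hvert : D'.code m' (N + 1) = .vert k (1 - k) := by
    rw [← m1, FloorDiagram.code_inl hm', hLb, hRb]
  refine ⟨D'.code m', hcodes, ⟨_, _, hvert⟩, hcut, ?_⟩
  obtain ⟨-, a, b, hab⟩ := hT.cut_mem hcodes hvert
  refine ⟨a, b, hab, ?_⟩
  obtain ⟨-, -, -, -, -, -, -, ha, hb⟩ := hab
  have ha' := ha (m' (.inr (ψ e₁))) _ _ (by rw [FloorDiagram.code_inr hm', htgt1])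
  have hb' := hb (m' (.inr (ψ e₂))) _ _ (by rw [FloorDiagram.code_inr hm', htgt2])
  rw [← ha', ← hb', me, me, hp]

theorem TopCut.tgt_le_or (hT : TopCut Δ Δ' k) {c : ℕ → Cell} (hc : c ∈ codes Δ g (N + 2))
    {a b : ℕ} (hab : TopEdges N k c a b) {j w : ℕ} {s t : Option ℕ} (h : c j = .edge s t w) :
    (∃ x, t = some x ∧ x ≤ N) ∨ (j = a ∧ t = some (N + 1)) ∨ (j = b ∧ t = some (N + 2)) := by
  obtain ⟨x, rfl, -, hx⟩ := hT.code_tgt hc h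
  obtain ⟨-, -, -, -, -, -, -, ha, hb⟩ := hab
  have : x ≤ N ∨ x = N + 1 ∨ x = N + 2 := by omega
  rcases this with hx | rfl | rfl
  · exact .inl ⟨x, rfl, hx⟩
  · exact .inr (.inl ⟨ha _ _ _ h, rfl⟩)
  · exact .inr (.inr ⟨hb _ _ _ h, rfl⟩)

theorem TopCut.eq_of_cut_eq (hT : TopCut Δ Δ' k) {c c' : ℕ → Cell} (hc : c ∈ codes Δ g (N + 2))
    (hc' : c' ∈ codes Δ g (N + 2)) {a b a' b' : ℕ} (hab : TopEdges N k c a b)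
    (hab' : TopEdges N k c' a' b') (hlt : a < b ↔ a' < b') (h : cutCode N c = cutCode N c') :
    c = c' := by
  have hj : ∀ j ≤ N, cutCell N (c j) = cutCell N (c' j) := by
    intro j hjN
    have := congrFun h j
    rwa [cutCode, cutCode, if_pos hjN, if_pos hjN] at this
  have hsink : ∀ {c c' : ℕ → Cell} {a b a' b' : ℕ}, c' ∈ codes Δ g (N + 2) →
      TopEdges N k c a b → TopEdges N k c' a' b' →
      (∀ j ≤ N, cutCell N (c j) = cutCell N (c' j)) → ∀ j, j = a ∨ j = b → j = a' ∨ j = b' := by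
    intro c c' a b a' b' hc' hab hab' hj j hjab
    have hjN : j ≤ N := by
      rcases hjab with rfl | rfl
      · exact hab.2.1
      · exact hab.2.2.1
    have hcut : ∃ u, cutCell N (c j) = .edge (some u) none 1 := by
      obtain ⟨-, -, -, ⟨u, -, hu⟩, ⟨u', -, hu'⟩, -⟩ := hab
      rcases hjab with rfl | rfl
      · exact ⟨u, by rw [hu]; simp [cutCell, Option.filter]⟩
      · exact ⟨u', by rw [hu']; simp [cutCell, Option.filter]⟩
    obtain ⟨u, hu⟩ := hcut
    rw [hj j hjN] at hu
    rcases hcj : c' j with _ | ⟨l, r⟩ | ⟨s, t, w⟩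
    · simp [hcj, cutCell] at hu
    · simp [hcj, cutCell] at hu
    · rcases hT.tgt_le_or hc' hab' hcj with ⟨x, rfl, hx⟩ | ⟨hx, -⟩ | ⟨hx, -⟩
      · simp [hcj, cutCell, Option.filter, hx] at hu
      · exact .inl hx
      · exact .inr hx
  have h1 := hsink hc' hab hab' hj
  have h1a := h1 a (.inl rfl)
  have h1b := h1 b (.inr rfl)
  have hne := hab.1
  have hne' := hab'.1
  obtain ⟨rfl, rfl⟩ : a = a' ∧ b = b' := by
    by_cases hl : a < b
    · have := hlt.1 hl
      omega
    · have : ¬ a' < b' := fun h => hl (hlt.2 h)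
      omega
  funext j
  by_cases hjN : j ≤ N
  · have hcut := hj j hjN
    rcases hcj : c j with _ | ⟨l, r⟩ | ⟨s, t, w⟩ <;>
      rcases hcj' : c' j with _ | ⟨l', r'⟩ | ⟨s', t', w'⟩ <;>
      simp only [hcj, hcj', cutCell, reduceCtorEq, Cell.edge.injEq, Cell.vert.injEq] at hcut
    · rfl
    · rw [hcut.1, hcut.2]
    · obtain ⟨rfl, h2, rfl⟩ := hcut
      suffices t = t' by rw [this]
      rcases hT.tgt_le_or hc hab hcj with ⟨x, rfl, hx⟩ | ⟨hx, rfl⟩ | ⟨hx, rfl⟩ <;>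
        rcases hT.tgt_le_or hc' hab' hcj' with ⟨x', rfl, hx'⟩ | ⟨hx', rfl⟩ | ⟨hx', rfl⟩ <;>
        first
        | rfl
        | exact absurd (hx.symm.trans hx') hne
        | exact absurd (hx'.symm.trans hx) hne
        | exact congrArg some (by simpa [Option.filter, hx, hx'] using h2)
  · by_cases hj2 : j ≤ N + 2
    · have : j = N + 1 ∨ j = N + 2 := by omega
      rcases this with rfl | rfl
      · rw [hab.2.2.2.2.2.1, hab'.2.2.2.2.2.1]
      · rw [hab.2.2.2.2.2.2.1, hab'.2.2.2.2.2.2.1]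
    · have h2 : c j = .empty := by
        by_contra h; exact hj2 (mark_le hc.1 h).2
      have h3 : c' j = .empty := by
        by_contra h; exact hj2 (mark_le hc'.1 h).2
      rw [h2, h3]

theorem TopCut.codeMult_cut (hT : TopCut Δ Δ' k) {c : ℕ → Cell} (hc : c ∈ codes Δ g (N + 2))
    {a b : ℕ} (hab : TopEdges N k c a b) {I : Finset ℕ} (hI : IsPairingIndex N I) :
    codeMult N I c = codeMult N I (cutCode N c) := by
  classical
  rw [codeMult, codeMult]
  congr 1
  · refine Finset.prod_congr rfl fun i hi => ?_
    have hiN := (hI.1 i hi).2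
    rw [pairWeight, pairWeight, cutCode, cutCode, if_pos (by omega), if_pos hiN]
    rcases h1 : c i with _ | ⟨l, r⟩ | ⟨s, t, w⟩ <;>
      rcases h2 : c (i + 1) with _ | ⟨l', r'⟩ | ⟨s', t', w'⟩ <;> simp only [cutCell]
    · refine if_congr (or_congr Iff.rfl ?_) rfl rfl
      rcases hT.tgt_le_or hc hab h2 with ⟨x, rfl, hx⟩ | ⟨hx, rfl⟩ | ⟨hx, rfl⟩
      · simp [Option.filter, hx]
      · simp [Option.filter]; omega
      · simp [Option.filter]; omega
    · refine if_congr (or_congr Iff.rfl ?_) rfl rfl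
      rcases hT.tgt_le_or hc hab h1 with ⟨x, rfl, hx⟩ | ⟨hx, rfl⟩ | ⟨hx, rfl⟩
      · simp [Option.filter, hx]
      · simp [Option.filter]; omega
      · simp [Option.filter]; omega
    · refine if_congr (or_congr Iff.rfl ?_) rfl rfl
      rcases hT.tgt_le_or hc hab h1 with ⟨x, rfl, hx⟩ | ⟨hx, rfl⟩ | ⟨hx, rfl⟩ <;>
      rcases hT.tgt_le_or hc hab h2 with ⟨x', rfl, hx'⟩ | ⟨hx', rfl⟩ | ⟨hx', rfl⟩ <;>
      simp [Option.filter, hx, hx'] <;> omega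
  · refine Finset.prod_congr rfl fun j hj => ?_
    have hjN : j ≤ N := by
      have := (Finset.mem_sdiff.1 hj).1
      exact (Finset.mem_Icc.1 this).2
    rw [cutCode, if_pos hjN]
    cases c j <;> rfl

theorem codeMult_add_two {I : Finset ℕ} (hI : IsPairingIndex N I) (c : ℕ → Cell) :
    codeMult (N + 2) I c = codeMult N I c * ((c (N + 1)).weight * (c (N + 2)).weight) := by
  have h : unpaired (N + 2) I = insert (N + 1) (insert (N + 2) (unpaired N I)) := by
    ext j
    simp only [unpaired, Finset.mem_sdiff, Finset.mem_Icc, Finset.mem_union, Finset.mem_insert,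
      Finset.mem_image]
    constructor
    · rintro ⟨hj, hn⟩
      by_cases hjN : j ≤ N
      · exact .inr (.inr ⟨⟨hj.1, hjN⟩, hn⟩)
      · omega
    · rintro (rfl | rfl | ⟨hj, hn⟩)
      · refine ⟨by omega, ?_⟩
        rintro (h | ⟨i, hi, h⟩)
        · have := hI.1 _ h; omega
        · have := hI.1 _ hi; omega
      · refine ⟨by omega, ?_⟩
        rintro (h | ⟨i, hi, h⟩)
        · have := hI.1 _ h; omega
        · have := hI.1 _ hi; omega
      · exact ⟨by omega, hn⟩
  rw [codeMult, codeMult, h, Finset.prod_insert, Finset.prod_insert]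
  · ring
  · simp [unpaired]
  · simp [unpaired]

theorem codeMult_insert_top {I : Finset ℕ} (hI : IsPairingIndex N I) (c : ℕ → Cell) :
    codeMult (N + 2) (insert (N + 1) I) c = codeMult N I c * pairWeight c (N + 1) (N + 2) := by
  have hN : N + 1 ∉ I := fun h => by have := hI.1 _ h; omega
  have h : unpaired (N + 2) (insert (N + 1) I) = unpaired N I := by
    ext j
    simp only [unpaired, Finset.mem_sdiff, Finset.mem_Icc, Finset.mem_union, Finset.mem_insert,
      Finset.mem_image]
    constructor
    · rintro ⟨hj, hn⟩
      push Not at hn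
      have h1 := hn.1.1
      have h2 := hn.2 (N + 1) (.inl rfl)
      refine ⟨by omega, ?_⟩
      rintro (h | ⟨i, hi, h⟩)
      · exact hn.1.2 h
      · exact hn.2 i (.inr hi) h
    · rintro ⟨hj, hn⟩
      refine ⟨by omega, ?_⟩
      rintro ((h | h) | ⟨i, rfl | hi, h⟩)
      · omega
      · exact hn (.inl h)
      · omega
      · exact hn (.inr ⟨i, hi, h⟩)
  rw [codeMult, codeMult, h, Finset.prod_insert hN]
  ring

theorem TopCut.codeMult_sub (hT : TopCut Δ Δ' k) {I : Finset ℕ} (hI : IsPairingIndex N I)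
    {c : ℕ → Cell} (hc : c ∈ codes Δ g (N + 2)) [Decidable (∃ l r, c (N + 1) = .vert l r)] :
    codeMult (N + 2) I c - codeMult (N + 2) (insert (N + 1) I) c =
      if ∃ l r, c (N + 1) = .vert l r then codeMult N I c else 0 := by
  rw [codeMult_add_two hI, codeMult_insert_top hI]
  obtain ⟨l', r', h'⟩ := hT.code_top (by omega) hc
  obtain ⟨x, h⟩ : ∃ x, c (N + 1) = x := ⟨_, rfl⟩
  rcases x with _ | ⟨l, r⟩ | ⟨s, t, w⟩
  · exact absurd h (ne_empty hc.1 (by omega) (by omega))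
  · simp [pairWeight, h, h', Cell.weight]
  · obtain ⟨rfl, rfl⟩ := hT.code_edge_top hc h
    simp [pairWeight, h, h', Cell.weight, qInt_one, qIntTwo_one]

/-- The effect of pairing the two top elements. -/
theorem TopCut.sum_codeMult_sub (hT : TopCut Δ Δ' k) {I : Finset ℕ} (hI : IsPairingIndex N I) :
    ∑ c ∈ (finite_codes Δ g (N + 2)).toFinset, codeMult (N + 2) I c -
      ∑ c ∈ (finite_codes Δ g (N + 2)).toFinset, codeMult (N + 2) (insert (N + 1) I) c =
    2 * ∑ c ∈ (finite_codes Δ' g N).toFinset, codeMult N I c := by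
  classical
  rw [← Finset.sum_sub_distrib, Finset.sum_congr rfl fun c hc =>
    hT.codeMult_sub hI ((Set.Finite.mem_toFinset _).1 hc), ← Finset.sum_filter]
  have hbool : 2 * ∑ c ∈ (finite_codes Δ' g N).toFinset, codeMult N I c =
      ∑ x ∈ (finite_codes Δ' g N).toFinset ×ˢ (Finset.univ : Finset Bool), codeMult N I x.1 := by
    rw [Finset.sum_product, Finset.mul_sum]
    simp [two_mul]
  rw [hbool]
  refine sum_eq_sum_of_rel (fun c x => cutCode N c = x.1 ∧
    ∃ a b, TopEdges N k c a b ∧ (a < b ↔ x.2 = true)) ?_ ?_ ?_ ?_ ?_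
  · intro c hc
    obtain ⟨hc, l, r, hv⟩ := Finset.mem_filter.1 hc
    rw [Set.Finite.mem_toFinset] at hc
    obtain ⟨h, a, b, hab⟩ := hT.cut_mem hc hv
    refine ⟨(cutCode N c, decide (a < b)), ?_, rfl, a, b, hab, by simp⟩
    rw [Finset.mem_product, Set.Finite.mem_toFinset]
    exact ⟨h, Finset.mem_univ _⟩
  · rintro ⟨c', β⟩ h
    rw [Finset.mem_product, Set.Finite.mem_toFinset] at h
    obtain ⟨c, hc, hv, hcut, hab⟩ := hT.exists_extension h.1 (β = true)
    exact ⟨c, Finset.mem_filter.2 ⟨(Set.Finite.mem_toFinset _).2 hc, hv⟩, hcut, hab⟩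
  · rintro c hc ⟨c₁, β₁⟩ - ⟨c₂, β₂⟩ - ⟨h₁, a₁, b₁, hab₁, hβ₁⟩ ⟨h₂, a₂, b₂, hab₂, hβ₂⟩
    obtain rfl : a₁ = a₂ := by
      obtain ⟨-, -, -, ⟨u, -, hu⟩, -⟩ := hab₁
      exact hab₂.2.2.2.2.2.2.2.1 _ _ _ hu
    obtain rfl : b₁ = b₂ := by
      obtain ⟨-, -, -, -, ⟨u, -, hu⟩, -⟩ := hab₁
      exact hab₂.2.2.2.2.2.2.2.2 _ _ _ hu
    have : β₁ = β₂ := Bool.eq_iff_iff.2 (hβ₁.symm.trans hβ₂)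
    rw [this, ← show c₁ = c₂ from h₁.symm.trans h₂]
  · rintro c hc c' hc' ⟨c₁, β⟩ - ⟨h₁, a₁, b₁, hab₁, hβ₁⟩ ⟨h₂, a₂, b₂, hab₂, hβ₂⟩
    have hc := (Set.Finite.mem_toFinset _).1 (Finset.mem_filter.1 hc).1
    have hc' := (Set.Finite.mem_toFinset _).1 (Finset.mem_filter.1 hc').1
    exact hT.eq_of_cut_eq hc hc' hab₁ hab₂ (hβ₁.trans hβ₂.symm) (h₁.trans h₂.symm)
  · rintro c hc ⟨c', β⟩ - ⟨h, a, b, hab, -⟩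
    have hc := (Set.Finite.mem_toFinset _).1 (Finset.mem_filter.1 hc).1
    rw [hT.codeMult_cut hc hab hI, h]

end

section

/-! ### Cutting off the top corner -/

variable {Δ : Set (ℝ × ℝ)} {p : ℤ × ℤ} {k : ℤ}

theorem mem_lattice_iff {x : ℝ × ℝ} :
    x ∈ lattice ↔ (∃ a : ℤ, (a : ℝ) = x.1) ∧ ∃ b : ℤ, (b : ℝ) = x.2 := by
  constructor
  · rintro ⟨z, rfl⟩
    exact ⟨⟨z.1, rfl⟩, ⟨z.2, rfl⟩⟩
  · rintro ⟨⟨a, ha⟩, ⟨b, hb⟩⟩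
    exact ⟨(a, b), Prod.ext ha hb⟩

theorem finite_inter_lattice (hΔ : IsCompact Δ) : (Δ ∩ lattice).Finite := by
  have key : ∀ f : ℝ × ℝ → ℝ, Continuous f → ∃ N : ℤ, ∀ x ∈ Δ, |f x| ≤ N := by
    intro f hf
    obtain ⟨C, hC⟩ := hΔ.exists_bound_of_continuousOn hf.continuousOn
    obtain ⟨N, hN⟩ := exists_nat_ge C
    exact ⟨N, fun x hx => (hC x hx).trans (by exact_mod_cast hN)⟩
  obtain ⟨N, hN⟩ := key Prod.fst continuous_fst
  obtain ⟨M, hM⟩ := key Prod.snd continuous_snd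
  refine (((Set.finite_Icc (-N) N).prod (Set.finite_Icc (-M) M)).image
    fun z : ℤ × ℤ => ((z.1 : ℝ), (z.2 : ℝ))).subset ?_
  rintro _ ⟨hx, z, rfl⟩
  have h1 := abs_le.1 (hN _ hx)
  have h2 := abs_le.1 (hM _ hx)
  simp only at h1 h2
  exact ⟨z, ⟨⟨by exact_mod_cast h1.1, by exact_mod_cast h1.2⟩,
    ⟨by exact_mod_cast h2.1, by exact_mod_cast h2.2⟩⟩, rfl⟩

theorem face_subset (Δ : Set (ℝ × ℝ)) (ν : ℝ × ℝ) : face Δ ν ⊆ Δ := fun _ hx => hx.1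

theorem finite_face_inter_lattice (hΔ : IsCompact Δ) (ν : ℝ × ℝ) :
    (face Δ ν ∩ lattice).Finite :=
  (finite_inter_lattice hΔ).subset (Set.inter_subset_inter_left _ (face_subset _ _))

theorem face_nonempty (hΔ : IsCompact Δ) (hne : Δ.Nonempty) (ν : ℝ × ℝ) :
    (face Δ ν).Nonempty := by
  obtain ⟨x, hx, hmax⟩ := hΔ.exists_isMaxOn hne
    (f := fun y : ℝ × ℝ => ν.1 * y.1 + ν.2 * y.2) (by fun_prop)
  exact ⟨x, hx, fun y hy => hmax hy⟩

theorem sideLength_eq_zero_of_subset {ν x : ℝ × ℝ} (h : face Δ ν ⊆ {x}) :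
    sideLength Δ ν = 0 := by
  have : (face Δ ν ∩ lattice).ncard ≤ 1 := by
    rw [← Set.ncard_singleton x]
    exact Set.ncard_le_ncard (Set.inter_subset_left.trans h)
  unfold sideLength
  omega

/-- A half plane that contains a face of `Δ` does not change this face. -/
theorem face_cutTopCorner_of_le {ν : ℝ × ℝ} (hne : (face Δ ν).Nonempty)
    (h : ∀ x ∈ face Δ ν, x.2 ≤ (p.2 : ℝ) - 2) : face (cutTopCorner Δ p) ν = face Δ ν := by
  ext x
  constructor
  · rintro ⟨hx, hmax⟩
    obtain ⟨x₀, hx₀⟩ := hne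
    refine ⟨hx.1, fun y hy => (hx₀.2 y hy).trans (hmax x₀ ⟨hx₀.1, h x₀ hx₀⟩)⟩
  · rintro hx
    exact ⟨⟨hx.1, h x hx⟩, fun y hy => hx.2 y hy.1⟩

/-- At the highest point of a polygon, the sides on one side of it are ordered by their normal
vectors. -/
theorem sideLength_eq_zero_of_lt {σ : ℝ} (hσ : σ ^ 2 = 1) {m j : ℤ} {x : ℝ × ℝ}
    (hx : x ∈ face Δ (σ, (m : ℝ))) (htop : ∀ y ∈ Δ, y.2 ≤ x.2) (hj : m < j) :
    sideLength Δ (σ, (j : ℝ)) = 0 := by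
  refine sideLength_eq_zero_of_subset (x := x) fun y hy => ?_
  have h1 := hy.2 x hx.1
  have h2 := hx.2 y hy.1
  have hj' : (0 : ℝ) < j - m := by exact_mod_cast sub_pos.2 hj
  simp only at h1 h2
  have h3 : y.2 = x.2 := by
    refine le_antisymm (htop y hy.1) ?_
    by_contra! h
    nlinarith
  rw [h3] at h1 h2
  have h4 : σ * y.1 = σ * x.1 := by linarith
  exact Prod.ext (mul_left_cancel₀ (by rintro rfl; norm_num at hσ) h4) h3

theorem sideLength_cutTopCorner (hconv : Convex ℝ Δ) (hcpt : IsCompact Δ) {σ : ℤ}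
    (hσ : σ ^ 2 = 1) {m : ℤ} (hp : ((p.1 : ℝ), (p.2 : ℝ)) ∈ face Δ ((σ : ℝ), (m : ℝ)))
    (hq : ((p.1 : ℝ) + 2 * (σ * m), (p.2 : ℝ) - 2) ∈ face Δ ((σ : ℝ), (m : ℝ)))
    (htop : ∀ y ∈ Δ, y.2 ≤ (p.2 : ℝ)) (j : ℤ) :
    sideLength Δ ((σ : ℝ), (j : ℝ)) =
      sideLength (cutTopCorner Δ p) ((σ : ℝ), (j : ℝ)) + if j = m then 2 else 0 := by
  have hσ' : (σ : ℝ) ^ 2 = 1 := by exact_mod_cast hσ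
  have hσ0 : (σ : ℝ) ≠ 0 := by rintro h; rw [h] at hσ'; norm_num at hσ'
  have hq' : ((p.1 : ℝ) + 2 * (σ * m), (p.2 : ℝ) - 2) ∈
      face (cutTopCorner Δ p) ((σ : ℝ), (m : ℝ)) :=
    ⟨⟨hq.1, le_rfl⟩, fun y hy => hq.2 y hy.1⟩
  rcases lt_trichotomy j m with hj | rfl | hj
  · rw [if_neg hj.ne, add_zero]
    unfold sideLength
    rw [face_cutTopCorner_of_le (face_nonempty hcpt ⟨_, hp.1⟩ _)]
    intro x hx
    have h1 := hx.2 _ hq.1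
    have h2 := hq.2 x hx.1
    have hj' : (0 : ℝ) < m - j := by exact_mod_cast sub_pos.2 hj
    simp only at h1 h2
    by_contra! h
    nlinarith
  · rw [if_pos rfl]
    set P : ℝ × ℝ := ((p.1 : ℝ), (p.2 : ℝ)) with hP
    set P' : ℝ × ℝ := ((p.1 : ℝ) + σ * j, (p.2 : ℝ) - 1) with hP'
    have hmid : P' ∈ Δ := by
      have := hconv hp.1 hq.1 (a := 1 / 2) (b := 1 / 2) (by norm_num) (by norm_num) (by norm_num)
      convert this using 1
      ext <;> simp [hP'] <;> ring
    have hline : ∀ x : ℝ × ℝ, x ∈ face Δ ((σ : ℝ), (j : ℝ)) ↔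
        x ∈ Δ ∧ x.1 = p.1 + σ * j * (p.2 - x.2) := by
      intro x
      constructor
      · intro hx
        refine ⟨hx.1, mul_left_cancel₀ hσ0 ?_⟩
        have h1 := hx.2 _ hp.1
        have h2 := hp.2 x hx.1
        simp only at h1 h2
        linear_combination (h2.antisymm h1) - j * (p.2 - x.2) * hσ'
      · rintro ⟨hx, h⟩
        refine ⟨hx, fun y hy => (hp.2 y hy).trans (le_of_eq ?_)⟩
        simp only
        rw [h]
        linear_combination -j * (p.2 - x.2) * hσ'
    have hP'face : P' ∈ face Δ ((σ : ℝ), (j : ℝ)) :=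
      (hline P').2 ⟨hmid, by simp only [hP']; ring⟩
    have hA : face Δ ((σ : ℝ), (j : ℝ)) ∩ lattice =
        insert P (insert P' (face (cutTopCorner Δ p) ((σ : ℝ), (j : ℝ)) ∩ lattice)) := by
      ext x
      simp only [Set.mem_insert_iff, Set.mem_inter_iff]
      constructor
      · rintro ⟨hx, hl⟩
        rcases le_or_gt x.2 ((p.2 : ℝ) - 2) with h | h
        · exact Or.inr (Or.inr ⟨⟨⟨hx.1, h⟩, fun y hy => hx.2 y hy.1⟩, hl⟩)
        · obtain ⟨-, b, hb⟩ := mem_lattice_iff.1 hl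
          have hx1 := ((hline x).1 hx).2
          have htx := htop x hx.1
          rw [← hb] at h htx hx1
          have h' : p.2 - 2 < b := by exact_mod_cast h
          have htx' : b ≤ p.2 := by exact_mod_cast htx
          obtain rfl | rfl : b = p.2 ∨ b = p.2 - 1 := by omega
          · left
            exact Prod.ext (by rw [hx1]; simp [hP]) hb.symm
          · right; left
            exact Prod.ext (by rw [hx1, hP']; push_cast; ring) (by rw [← hb, hP']; push_cast; rfl)
      · rintro (rfl | rfl | ⟨hx, hl⟩)
        · exact ⟨hp, p, rfl⟩
        · exact ⟨hP'face, mem_lattice_iff.2 ⟨⟨p.1 + σ * j, by simp [hP']⟩, p.2 - 1, by simp [hP']⟩⟩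
        · exact ⟨⟨hx.1.1, fun y hy => (hq.2 y hy).trans (hx.2 _ hq'.1)⟩, hl⟩
    have hfin : (face (cutTopCorner Δ p) ((σ : ℝ), (j : ℝ)) ∩ lattice).Finite :=
      (finite_inter_lattice hcpt).subset fun x hx => ⟨hx.1.1.1, hx.2⟩
    have hpos : 0 < (face (cutTopCorner Δ p) ((σ : ℝ), (j : ℝ)) ∩ lattice).ncard :=
      (Set.ncard_pos hfin).2 ⟨_, hq', mem_lattice_iff.2
        ⟨⟨p.1 + 2 * (σ * j), by push_cast; rfl⟩, p.2 - 2, by push_cast; rfl⟩⟩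
    have hP'n : P' ∉ face (cutTopCorner Δ p) ((σ : ℝ), (j : ℝ)) ∩ lattice := by
      intro h
      have := h.1.1.2
      simp only [hP'] at this
      linarith
    have hPn : P ∉ insert P' (face (cutTopCorner Δ p) ((σ : ℝ), (j : ℝ)) ∩ lattice) := by
      rintro (h | h)
      · have := congrArg Prod.snd h
        simp only [hP, hP'] at this
        linarith
      · have := h.1.1.2
        simp only [hP] at this
        linarith
    unfold sideLength
    rw [hA, Set.ncard_insert_of_notMem hPn (hfin.insert _), Set.ncard_insert_of_notMem hP'n hfin]
    omega
  · rw [if_neg hj.ne', add_zero, sideLength_eq_zero_of_lt hσ' hp htop hj,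
      sideLength_eq_zero_of_lt hσ' hq' (fun y hy => hy.2) hj]

namespace HasTopCorner

theorem snd_le (h : HasTopCorner Δ p k) {y : ℝ × ℝ} (hy : y ∈ Δ) : y.2 ≤ p.2 := by
  have h1 := h.1.2 y hy
  have h2 := h.2.2.1.2 y hy
  simp only at h1 h2
  linarith

theorem face_top_subset (h : HasTopCorner Δ p k) :
    face Δ (0, 1) ⊆ {((p.1 : ℝ), (p.2 : ℝ))} := by
  intro x hx
  have h0 := hx.2 _ h.1.1
  have h1 := h.1.2 x hx.1
  have h2 := h.2.2.1.2 x hx.1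
  simp only at h0 h1 h2
  have h3 : x.2 = p.2 := by linarith
  rw [h3] at h1 h2
  exact Prod.ext (by simp only; linarith) h3

theorem mem_face_top (h : HasTopCorner Δ p k) :
    ((p.1 : ℝ), (p.2 : ℝ)) ∈ face Δ (0, 1) :=
  ⟨h.1.1, fun y hy => by simpa using h.snd_le hy⟩

theorem mem_face_top_cut (h : HasTopCorner Δ p k) :
    ((p.1 : ℝ) - 2 * k, (p.2 : ℝ) - 2) ∈ face (cutTopCorner Δ p) (0, 1) :=
  ⟨⟨h.2.1.1, le_rfl⟩, fun y hy => by simpa using hy.2⟩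

theorem ePlus_cutTopCorner (hconv : Convex ℝ Δ) (h : HasTopCorner Δ p k) :
    ePlus (cutTopCorner Δ p) = 2 := by
  set q : ℤ → ℝ × ℝ := fun i => ((p.1 - 2 * k + i : ℤ), (p.2 - 2 : ℤ)) with hq
  have hA : face (cutTopCorner Δ p) (0, 1) ∩ lattice = {q 0, q 1, q 2} := by
    ext x
    simp only [Set.mem_insert_iff, Set.mem_singleton_iff, Set.mem_inter_iff]
    constructor
    · rintro ⟨hx, hl⟩
      obtain ⟨⟨a, ha⟩, b, hb⟩ := mem_lattice_iff.1 hl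
      have h0 := hx.2 _ h.mem_face_top_cut.1
      have h0' := hx.1.2
      have h1 := h.1.2 x hx.1.1
      have h2 := h.2.2.1.2 x hx.1.1
      simp only at h0 h0' h1 h2
      have h3 : x.2 = p.2 - 2 := by linarith
      rw [h3, ← ha] at h1 h2
      have h1' : -1 * a + k * (p.2 - 2) ≤ -1 * p.1 + k * p.2 := by exact_mod_cast h1
      have h2' : 1 * a + (1 - k) * (p.2 - 2) ≤ 1 * p.1 + (1 - k) * p.2 := by exact_mod_cast h2
      have h4 : p.1 - 2 * k ≤ a := by linarith
      have h5 : a ≤ p.1 - 2 * k + 2 := by linarith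
      have hx2 : x.2 = ((p.2 - 2 : ℤ) : ℝ) := by rw [h3]; push_cast; rfl
      obtain rfl | rfl | rfl : a = p.1 - 2 * k + 0 ∨ a = p.1 - 2 * k + 1 ∨
          a = p.1 - 2 * k + 2 := by omega
      · exact Or.inl (Prod.ext ha.symm hx2)
      · exact Or.inr (Or.inl (Prod.ext ha.symm hx2))
      · exact Or.inr (Or.inr (Prod.ext ha.symm hx2))
    · intro hx
      have hmem : ∀ i : ℤ, 0 ≤ i → i ≤ 2 → q i ∈ face (cutTopCorner Δ p) (0, 1) ∩ lattice := by
        intro i hi hi'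
        have hi1 : (0 : ℝ) ≤ i / 2 := by
          have : (0 : ℝ) ≤ i := by exact_mod_cast hi
          positivity
        have hi2 : (i : ℝ) / 2 ≤ 1 := by
          have : (i : ℝ) ≤ 2 := by exact_mod_cast hi'
          linarith
        refine ⟨⟨⟨?_, by simp [hq]⟩, fun y hy => by simpa [hq] using hy.2⟩, ⟨(p.1 - 2 * k + i, p.2 - 2), rfl⟩⟩
        have := hconv h.2.1.1 h.2.2.2.1 (a := 1 - i / 2) (b := i / 2) (by linarith) hi1 (by ring)
        convert this using 1
        ext <;> simp [hq] <;> ring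
      rcases hx with rfl | rfl | rfl
      · exact hmem 0 (by norm_num) (by norm_num)
      · exact hmem 1 (by norm_num) (by norm_num)
      · exact hmem 2 (by norm_num) (by norm_num)
  have hinj : ∀ i j, q i = q j → i = j := by
    intro i j hij
    have := congrArg Prod.fst hij
    simpa [hq] using this
  unfold ePlus sideLength
  rw [hA, Set.ncard_eq_three.2 ⟨q 0, q 1, q 2, fun h => by simpa using hinj _ _ h,
    fun h => by simpa using hinj _ _ h, fun h => by simpa using hinj _ _ h, rfl⟩]

theorem face_bottom_cut (hcpt : IsCompact Δ) (h : HasTopCorner Δ p k) :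
    face (cutTopCorner Δ p) (0, -1) = face Δ (0, -1) := by
  refine face_cutTopCorner_of_le (face_nonempty hcpt ⟨_, h.1.1⟩ _) fun x hx => ?_
  have := hx.2 _ h.2.1.1
  simp only at this
  linarith

end HasTopCorner

theorem isGreatest_of_mem_face {x : ℝ × ℝ} (hx : x ∈ face Δ (0, 1)) :
    IsGreatest (Prod.snd '' Δ) x.2 := by
  refine ⟨⟨x, hx.1, rfl⟩, ?_⟩
  rintro _ ⟨y, hy, rfl⟩
  simpa using hx.2 y hy

theorem isLeast_of_mem_face {x : ℝ × ℝ} (hx : x ∈ face Δ (0, -1)) :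
    IsLeast (Prod.snd '' Δ) x.2 := by
  refine ⟨⟨x, hx.1, rfl⟩, ?_⟩
  rintro _ ⟨y, hy, rfl⟩
  simpa using hx.2 y hy

theorem height_eq {t b : ℝ × ℝ} (ht : t ∈ face Δ (0, 1)) (hb : b ∈ face Δ (0, -1)) :
    height Δ = t.2 - b.2 := by
  rw [height, (isGreatest_of_mem_face ht).csSup_eq, (isLeast_of_mem_face hb).csInf_eq]

theorem HasTopCorner.topCut (hconv : Convex ℝ Δ) (hcpt : IsCompact Δ)
    (h : HasTopCorner Δ p k) : TopCut Δ (cutTopCorner Δ p) k := by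
  have hp := h.1
  have hq := h.2.1
  have hp' := h.2.2.1
  have hq' := h.2.2.2
  refine ⟨sideLength_eq_zero_of_subset h.face_top_subset, h.ePlus_cutTopCorner hconv, ?_, ?_,
    ?_, ?_, ?_, ?_⟩
  · unfold eMinus sideLength
    rw [h.face_bottom_cut hcpt]
  · obtain ⟨b, hb⟩ := face_nonempty hcpt ⟨_, h.1.1⟩ (0, -1)
    rw [height_eq h.mem_face_top hb,
      height_eq h.mem_face_top_cut (by rwa [h.face_bottom_cut hcpt])]
    ring
  · intro j hj
    exact sideLength_eq_zero_of_lt (by norm_num) hp (fun y hy => h.snd_le hy) hj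
  · intro j hj
    refine sideLength_eq_zero_of_lt (m := 1 - k) (by norm_num) (x := (p.1, p.2)) ?_
      (fun y hy => h.snd_le hy) hj
    push_cast
    exact hp'
  · intro j
    have := sideLength_cutTopCorner (σ := -1) (m := k) hconv hcpt (by norm_num)
      (by push_cast; exact hp) (by push_cast; convert hq using 2; ring)
      (fun y hy => h.snd_le hy) j
    push_cast at this
    exact this
  · intro j
    have := sideLength_cutTopCorner (σ := 1) (m := 1 - k) hconv hcpt (by norm_num)
      (by push_cast; exact hp') (by push_cast; convert hq' using 2; ring)
      (fun y hy => h.snd_le hy) j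
    push_cast at this
    exact this

end

section

/-! ### Lattice points on the boundary -/

variable {Δ : Set (ℝ × ℝ)} {p : ℤ × ℤ} {k : ℤ}

theorem exists_add_smul_mem_of_mem_interior {z : ℝ × ℝ} (hz : z ∈ interior Δ) (v : ℝ × ℝ) :
    ∃ ε : ℝ, 0 < ε ∧ z + ε • v ∈ Δ := by
  have hc : ContinuousAt (fun ε : ℝ => z + ε • v) 0 := by fun_prop
  have h0 : Δ ∈ nhds (z + (0 : ℝ) • v) := by simpa using mem_interior_iff_mem_nhds.1 hz
  have h1 : ∀ᶠ ε in nhdsWithin (0 : ℝ) (Set.Ioi 0), z + ε • v ∈ Δ :=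
    nhdsWithin_le_nhds (hc.eventually_mem h0)
  obtain ⟨ε, hε, hpos⟩ := (h1.and self_mem_nhdsWithin).exists
  exact ⟨ε, hpos, hε⟩

theorem notMem_interior_of_mem_face {ν z : ℝ × ℝ} (hν : ν ≠ 0) (hz : z ∈ face Δ ν) :
    z ∉ interior Δ := by
  intro hi
  obtain ⟨ε, hε, hm⟩ := exists_add_smul_mem_of_mem_interior hi ν
  have h := hz.2 _ hm
  simp only [Prod.fst_add, Prod.snd_add, Prod.smul_fst, Prod.smul_snd, smul_eq_mul] at h
  have h2 : ε * (ν.1 ^ 2 + ν.2 ^ 2) ≤ 0 := by linarith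
  have h3 : ν.1 ^ 2 + ν.2 ^ 2 ≤ 0 := nonpos_of_mul_nonpos_right h2 hε
  refine hν (Prod.ext ?_ ?_)
  · exact pow_eq_zero_iff two_ne_zero |>.1 (by nlinarith [sq_nonneg ν.1, sq_nonneg ν.2])
  · exact pow_eq_zero_iff two_ne_zero |>.1 (by nlinarith [sq_nonneg ν.1, sq_nonneg ν.2])

theorem exists_mem_interior_snd_eq (hconv : Convex ℝ Δ) (hint : (interior Δ).Nonempty)
    {t b : ℝ × ℝ} (ht : t ∈ Δ) (hb : b ∈ Δ) {h : ℝ} (hbh : b.2 < h) (hht : h < t.2) :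
    ∃ c : ℝ, (c, h) ∈ interior Δ := by
  obtain ⟨o, ho⟩ := hint
  have key : ∀ d ∈ Δ, ∀ a : ℝ, 0 < a → a ≤ 1 → a * o.2 + (1 - a) * d.2 = h →
      ∃ c : ℝ, (c, h) ∈ interior Δ := by
    intro d hd a ha ha' hh
    refine ⟨a * o.1 + (1 - a) * d.1, ?_⟩
    have := hconv.combo_interior_self_mem_interior ho hd ha (sub_nonneg.2 ha') (by ring)
    convert this using 1
    exact Prod.ext rfl hh.symm
  rcases le_total h o.2 with ho' | ho'
  · have hpos : 0 < o.2 - b.2 := by linarith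
    refine key b hb ((h - b.2) / (o.2 - b.2)) (div_pos (by linarith) hpos)
      ((div_le_one hpos).2 (by linarith)) ?_
    field_simp
    ring
  · have hpos : 0 < t.2 - o.2 := by linarith
    refine key t ht ((t.2 - h) / (t.2 - o.2)) (div_pos (by linarith) hpos)
      ((div_le_one hpos).2 (by linarith)) ?_
    field_simp
    ring

/-- The boundary of a convex body meets a horizontal line through an interior point in two
points. -/
theorem exists_frontier_inter_eq_pair (hconv : Convex ℝ Δ) (hcpt : IsCompact Δ) {c h : ℝ}
    (hc : (c, h) ∈ interior Δ) :
    ∃ l r : ℝ, l < r ∧ frontier Δ ∩ {z | z.2 = h} = {(l, h), (r, h)} := by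
  have hS : IsCompact {x : ℝ | (x, h) ∈ Δ} := by
    have : {x : ℝ | (x, h) ∈ Δ} = Prod.fst '' (Δ ∩ {z | z.2 = h}) := by
      ext x
      constructor
      · exact fun hx => ⟨(x, h), ⟨hx, rfl⟩, rfl⟩
      · rintro ⟨⟨x, _⟩, ⟨hx, rfl⟩, rfl⟩
        exact hx
    rw [this]
    exact (hcpt.inter_right (isClosed_eq continuous_snd continuous_const)).image continuous_fst
  have hcS : c ∈ {x : ℝ | (x, h) ∈ Δ} := (interior_subset hc : (c, h) ∈ Δ)
  obtain ⟨l, hl, hlmin⟩ := hS.exists_isLeast ⟨c, hcS⟩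
  obtain ⟨r, hr, hrmax⟩ := hS.exists_isGreatest ⟨c, hcS⟩
  have hlni : (l, h) ∉ interior Δ := by
    intro hi
    obtain ⟨ε, hε, hm⟩ := exists_add_smul_mem_of_mem_interior hi (-1, 0)
    have : l ≤ l + ε * -1 := hlmin (by simpa using hm)
    linarith
  have hrni : (r, h) ∉ interior Δ := by
    intro hi
    obtain ⟨ε, hε, hm⟩ := exists_add_smul_mem_of_mem_interior hi (1, 0)
    have : r + ε * 1 ≤ r := hrmax (by simpa using hm)
    linarith
  have hlc : l < c := lt_of_le_of_ne (hlmin hcS) (by rintro rfl; exact hlni hc)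
  have hcr : c < r := lt_of_le_of_ne (hrmax hcS) (by rintro rfl; exact hrni hc)
  have key : ∀ d x : ℝ, (d, h) ∈ Δ → ∀ a : ℝ, 0 < a → a ≤ 1 → a * c + (1 - a) * d = x →
      (x, h) ∈ interior Δ := by
    intro d x hd a ha ha' hh
    have := hconv.combo_interior_self_mem_interior hc hd ha (sub_nonneg.2 ha') (by ring)
    convert this using 1
    exact Prod.ext hh.symm (by simp; ring)
  refine ⟨l, r, hlc.trans hcr, ?_⟩
  rw [hcpt.isClosed.frontier_eq]
  ext ⟨x, y⟩
  simp only [Set.mem_inter_iff, Set.mem_sdiff, Set.mem_ofPred_eq, Set.mem_insert_iff,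
    Set.mem_singleton_iff, Prod.mk.injEq]
  constructor
  · rintro ⟨⟨hx, hxi⟩, rfl⟩
    have h1 : l ≤ x := hlmin hx
    have h2 : x ≤ r := hrmax hx
    by_contra! hne
    have h1' : l < x := lt_of_le_of_ne h1 fun e => hne.1 e.symm rfl
    have h2' : x < r := lt_of_le_of_ne h2 fun e => hne.2 e rfl
    apply hxi
    rcases le_total x c with hxc | hxc
    · have hpos : 0 < c - l := by linarith
      refine key l x hl ((x - l) / (c - l)) (div_pos (by linarith) hpos)
        ((div_le_one hpos).2 (by linarith)) ?_
      field_simp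
      ring
    · have hpos : 0 < r - c := by linarith
      refine key r x hr ((r - x) / (r - c)) (div_pos (by linarith) hpos)
        ((div_le_one hpos).2 (by linarith)) ?_
      field_simp
      ring
  · rintro (⟨rfl, rfl⟩ | ⟨rfl, rfl⟩)
    · exact ⟨⟨hl, hlni⟩, rfl⟩
    · exact ⟨⟨hr, hrni⟩, rfl⟩

theorem face_top_eq {t : ℝ × ℝ} (ht : t ∈ face Δ (0, 1)) :
    face Δ (0, 1) = {z ∈ Δ | z.2 = t.2} := by
  ext z
  constructor
  · intro hz
    exact ⟨hz.1, (isGreatest_of_mem_face hz).unique (isGreatest_of_mem_face ht)⟩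
  · rintro ⟨hz, he⟩
    refine ⟨hz, fun y hy => ?_⟩
    have := ht.2 y hy
    simp only at this
    linarith

theorem face_bottom_eq {b : ℝ × ℝ} (hb : b ∈ face Δ (0, -1)) :
    face Δ (0, -1) = {z ∈ Δ | z.2 = b.2} := by
  ext z
  constructor
  · intro hz
    exact ⟨hz.1, (isLeast_of_mem_face hz).unique (isLeast_of_mem_face hb)⟩
  · rintro ⟨hz, he⟩
    refine ⟨hz, fun y hy => ?_⟩
    have := hb.2 y hy
    simp only at this
    linarith

theorem frontier_inter_eq_of_face (hcpt : IsCompact Δ) {ν : ℝ × ℝ} (hν : ν ≠ 0) {h : ℝ}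
    (hf : face Δ ν = {z ∈ Δ | z.2 = h}) : frontier Δ ∩ {z | z.2 = h} = face Δ ν := by
  rw [hcpt.isClosed.frontier_eq]
  ext z
  constructor
  · rintro ⟨⟨hz, -⟩, hh⟩
    rw [hf]
    exact ⟨hz, hh⟩
  · intro hz
    exact ⟨⟨hz.1, notMem_interior_of_mem_face hν hz⟩, (hf ▸ hz).2⟩

theorem boundaryPoints_eq (hconv : Convex ℝ Δ) (hcpt : IsCompact Δ)
    (hint : (interior Δ).Nonempty) {t b : ℝ × ℝ} (ht : t ∈ face Δ (0, 1) ∩ lattice)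
    (hb : b ∈ face Δ (0, -1) ∩ lattice)
    (hlat : ∀ z ∈ frontier Δ, ∀ h : ℤ, z.2 = h → b.2 < z.2 → z.2 < t.2 → z ∈ lattice)
    {a : ℕ} (ha : (a : ℝ) = height Δ) :
    0 < a ∧ boundaryPoints Δ = 2 * a + ePlus Δ + eMinus Δ := by
  classical
  obtain ⟨-, t₂, ht₂⟩ := mem_lattice_iff.1 ht.2
  obtain ⟨-, b₂, hb₂⟩ := mem_lattice_iff.1 hb.2
  have hΔt : ∀ z ∈ Δ, z.2 ≤ t₂ := fun z hz => ht₂ ▸ (isGreatest_of_mem_face ht.1).2 ⟨z, hz, rfl⟩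
  have hΔb : ∀ z ∈ Δ, (b₂ : ℝ) ≤ z.2 := fun z hz =>
    hb₂ ▸ (isLeast_of_mem_face hb.1).2 ⟨z, hz, rfl⟩
  have hfront : frontier Δ ⊆ Δ := hcpt.isClosed.frontier_subset
  have hfin : (frontier Δ ∩ lattice).Finite :=
    (finite_inter_lattice hcpt).subset (Set.inter_subset_inter_left _ hfront)
  have htop := frontier_inter_eq_of_face hcpt (ν := (0, 1)) (by simp) (face_top_eq ht.1)
  have hbot := frontier_inter_eq_of_face hcpt (ν := (0, -1)) (by simp) (face_bottom_eq hb.1)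
  rw [← ht₂] at htop
  rw [← hb₂] at hbot
  have hlt : b₂ < t₂ := by
    obtain ⟨o, ho⟩ := hint
    have h1 : o.2 < t₂ := by
      refine lt_of_le_of_ne (hΔt o (interior_subset ho)) fun h => ?_
      refine notMem_interior_of_mem_face (ν := (0, 1)) (by simp) ?_ ho
      rw [face_top_eq ht.1]
      exact ⟨interior_subset ho, h.trans ht₂⟩
    exact_mod_cast (hΔb o (interior_subset ho)).trans_lt h1
  have ha' : (a : ℤ) = t₂ - b₂ := by
    rw [height_eq ht.1 hb.1, ← ht₂, ← hb₂] at ha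
    exact_mod_cast ha
  have hfib : ∀ h : ℤ, (hfin.toFinset.filter fun z : ℝ × ℝ => ⌊z.2⌋ = h).card =
      (frontier Δ ∩ {z | z.2 = h} ∩ lattice).ncard := by
    intro h
    rw [← Set.ncard_coe_finset]
    congr 1
    ext z
    simp only [Finset.coe_filter, Set.Finite.mem_toFinset, Set.mem_inter_iff, Set.mem_ofPred_eq]
    constructor
    · rintro ⟨⟨h1, h2⟩, h3⟩
      obtain ⟨-, m, hm⟩ := mem_lattice_iff.1 h2
      rw [← hm, Int.floor_intCast] at h3
      exact ⟨⟨h1, by rw [← hm, h3]⟩, h2⟩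
    · rintro ⟨⟨h1, h2⟩, h3⟩
      exact ⟨⟨h1, h3⟩, by rw [h2, Int.floor_intCast]⟩
  have hmid : ∀ h ∈ Finset.Ioo b₂ t₂,
      (frontier Δ ∩ {z | z.2 = h} ∩ lattice).ncard = 2 := by
    intro h hh
    rw [Finset.mem_Ioo] at hh
    have h1 : (b₂ : ℝ) < h := by exact_mod_cast hh.1
    have h2 : (h : ℝ) < t₂ := by exact_mod_cast hh.2
    obtain ⟨c, hc⟩ := exists_mem_interior_snd_eq hconv hint ht.1.1 hb.1.1 (h := h)
      (by rwa [← hb₂]) (by rwa [← ht₂])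
    obtain ⟨l, r, hlr, he⟩ := exists_frontier_inter_eq_pair hconv hcpt hc
    rw [Set.inter_eq_left.2, he, Set.ncard_pair]
    · intro h
      exact hlr.ne (congrArg Prod.fst h)
    · rintro z ⟨hz, hzh⟩
      have hzh' : z.2 = h := hzh
      exact hlat z hz h hzh (by rwa [hzh', ← hb₂]) (by rwa [hzh', ← ht₂])
  have hpos : ∀ ν : ℝ × ℝ, (face Δ ν ∩ lattice).Nonempty →
      (face Δ ν ∩ lattice).ncard = sideLength Δ ν + 1 := by
    intro ν hν
    have := (Set.ncard_pos (finite_face_inter_lattice hcpt ν)).2 hν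
    unfold sideLength
    omega
  have hcount : boundaryPoints Δ =
      ∑ h ∈ Finset.Icc b₂ t₂, (frontier Δ ∩ {z | z.2 = h} ∩ lattice).ncard := by
    unfold boundaryPoints
    rw [Set.ncard_eq_toFinset_card _ hfin,
      Finset.card_eq_sum_card_fiberwise (f := fun z : ℝ × ℝ => ⌊z.2⌋) (t := Finset.Icc b₂ t₂)]
    · exact Finset.sum_congr rfl fun h _ => hfib h
    · intro z hz
      have hz' : z ∈ Δ := hfront ((Set.Finite.mem_toFinset _).1 hz).1
      rw [Finset.coe_Icc]
      refine ⟨Int.le_floor.2 (hΔb z hz'), ?_⟩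
      have := (Int.floor_le z.2).trans (hΔt z hz')
      exact_mod_cast this
  have hsplit : Finset.Icc b₂ t₂ = insert b₂ (insert t₂ (Finset.Ioo b₂ t₂)) := by
    ext h
    simp only [Finset.mem_Icc, Finset.mem_insert, Finset.mem_Ioo]
    omega
  rw [hsplit, Finset.sum_insert (by simp [hlt.ne]), Finset.sum_insert (by simp),
    Finset.sum_congr rfl hmid, htop, hbot, hpos _ ⟨t, ht⟩, hpos _ ⟨b, hb⟩] at hcount
  simp only [Finset.sum_const, Int.card_Ioo, smul_eq_mul] at hcount
  refine ⟨by omega, ?_⟩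
  unfold ePlus eMinus
  omega

theorem exists_mem_face_of_convexHull {T : Set (ℝ × ℝ)} {ν : ℝ × ℝ}
    (h : (face (convexHull ℝ T) ν).Nonempty) : ∃ t ∈ T, t ∈ face (convexHull ℝ T) ν := by
  obtain ⟨z, hz⟩ := h
  have hconvex : ConvexOn ℝ (convexHull ℝ T) fun x : ℝ × ℝ => ν.1 * x.1 + ν.2 * x.2 := by
    refine ⟨convex_convexHull ℝ T, fun x _ y _ a b _ _ _ => le_of_eq ?_⟩
    simp only [Prod.fst_add, Prod.snd_add, Prod.smul_fst, Prod.smul_snd, smul_eq_mul]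
    ring
  obtain ⟨t, ht, hle⟩ := hconvex.exists_ge_of_mem_convexHull (subset_convexHull ℝ T) hz.1
  exact ⟨t, ht, subset_convexHull ℝ T ht, fun y hy => (hz.2 y hy).trans hle⟩

theorem exists_mem_face_of_mem_frontier (hconv : Convex ℝ Δ) (hint : (interior Δ).Nonempty)
    {z : ℝ × ℝ} (hz : z ∈ Δ) (hzi : z ∉ interior Δ) : ∃ ν ≠ 0, z ∈ face Δ ν := by
  obtain ⟨f, hf⟩ := geometric_hahn_banach_open_point hconv.interior isOpen_interior hzi
  have hfx : ∀ x : ℝ × ℝ, f x = f (1, 0) * x.1 + f (0, 1) * x.2 := by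
    intro x
    have : x = x.1 • ((1, 0) : ℝ × ℝ) + x.2 • ((0, 1) : ℝ × ℝ) := by ext <;> simp
    conv_lhs => rw [this]
    rw [map_add, map_smul, map_smul, smul_eq_mul, smul_eq_mul]
    ring
  refine ⟨(f (1, 0), f (0, 1)), ?_, hz, fun y hy => ?_⟩
  · intro h0
    obtain ⟨o, ho⟩ := hint
    have := hf o ho
    rw [hfx o, hfx z, (Prod.mk.inj h0).1, (Prod.mk.inj h0).2] at this
    simp at this
  · rw [← hfx, ← hfx]
    have hcl : y ∈ closure (interior Δ) := by
      rw [hconv.closure_interior_eq_closure_of_nonempty_interior hint]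
      exact subset_closure hy
    exact closure_minimal (fun a ha => (hf a ha).le)
      (isClosed_le f.continuous continuous_const) hcl

theorem IsHTransverse.mem_lattice_of_mem_frontier (hΔ : IsHTransverse Δ) {t b : ℝ × ℝ}
    (ht : t ∈ Δ) (hb : b ∈ Δ) {z : ℝ × ℝ} (hz : z ∈ frontier Δ) {h : ℤ} (hzh : z.2 = h)
    (hbz : b.2 < z.2) (hzt : z.2 < t.2) : z ∈ lattice := by
  obtain ⟨⟨⟨T, hTfin, hT, rfl⟩, hint⟩, hedge⟩ := hΔ
  have hconv := convex_convexHull ℝ T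
  rw [(hTfin.isCompact_convexHull ℝ).isClosed.frontier_eq] at hz
  obtain ⟨hz, hzi⟩ := hz
  by_cases hext : z ∈ (convexHull ℝ T).extremePoints ℝ
  · exact hT (extremePoints_convexHull_subset hext)
  obtain ⟨ν, hν, hzf⟩ := exists_mem_face_of_mem_frontier hconv hint hz hzi
  have hnt : (face (convexHull ℝ T) ν).Nontrivial := by
    rw [mem_extremePoints] at hext
    push Not at hext
    obtain ⟨x, hx, y, hy, ⟨α, β, hα, hβ, hαβ, rfl⟩, hne⟩ := hext hz
    have h1 := hzf.2 x hx
    have h2 := hzf.2 y hy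
    simp only [Prod.fst_add, Prod.snd_add, Prod.smul_fst, Prod.smul_snd, smul_eq_mul] at h1 h2
    have hle : ∀ u v : ℝ, u ≤ α * u + β * v → v ≤ α * u + β * v → u = v := by
      intro u v hu hv
      obtain rfl : β = 1 - α := by linarith
      exact le_antisymm (le_of_mul_le_mul_left (by linarith) hβ)
        (le_of_mul_le_mul_left (by linarith) hα)
    have heq := hle (ν.1 * x.1 + ν.2 * x.2) (ν.1 * y.1 + ν.2 * y.2) (by linarith) (by linarith)
    have hval : ν.1 * (α • x + β • y).1 + ν.2 * (α • x + β • y).2 = ν.1 * x.1 + ν.2 * x.2 := by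
      simp only [Prod.fst_add, Prod.snd_add, Prod.smul_fst, Prod.smul_snd, smul_eq_mul]
      obtain rfl : β = 1 - α := by linarith
      linear_combination (α - 1) * heq
    refine ⟨x, ⟨hx, fun w hw => hval ▸ hzf.2 w hw⟩, y,
      ⟨hy, fun w hw => heq ▸ hval ▸ hzf.2 w hw⟩, ?_⟩
    rintro rfl
    rw [← add_smul, hαβ, one_smul] at hne
    exact hne rfl rfl
  obtain ⟨c, hc, hνc⟩ := hedge ν hν hnt
  obtain ⟨u, hu, huf⟩ := exists_mem_face_of_convexHull ⟨z, hzf⟩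
  obtain ⟨⟨u₁, hu₁⟩, u₂, hu₂⟩ := mem_lattice_iff.1 (hT hu)
  have h1 := hzf.2 u huf.1
  have h2 := huf.2 z hz
  have h3 := hzf.2 t ht
  have h4 := hzf.2 b hb
  rcases hνc with rfl | rfl | ⟨j, rfl | rfl⟩
  · simp only [Prod.smul_fst, Prod.smul_snd, smul_eq_mul] at h3
    nlinarith
  · simp only [Prod.smul_fst, Prod.smul_snd, smul_eq_mul] at h4
    nlinarith
  · simp only [Prod.smul_fst, Prod.smul_snd, smul_eq_mul] at h1 h2
    have h5 : u.1 + j * u.2 = z.1 + j * z.2 := mul_left_cancel₀ hc.ne' (by linarith)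
    refine mem_lattice_iff.2 ⟨⟨u₁ + j * u₂ - j * h, ?_⟩, h, hzh.symm⟩
    push_cast
    rw [hu₁, hu₂, ← hzh]
    linarith
  · simp only [Prod.smul_fst, Prod.smul_snd, smul_eq_mul] at h1 h2
    have h5 : -u.1 + j * u.2 = -z.1 + j * z.2 := mul_left_cancel₀ hc.ne' (by linarith)
    refine mem_lattice_iff.2 ⟨⟨u₁ - j * u₂ + j * h, ?_⟩, h, hzh.symm⟩
    push_cast
    rw [hu₁, hu₂, ← hzh]
    linarith

theorem IsLatticePolygon.convex (hΔ : IsLatticePolygon Δ) : Convex ℝ Δ := by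
  obtain ⟨⟨T, -, -, rfl⟩, -⟩ := hΔ
  exact convex_convexHull ℝ T

theorem IsLatticePolygon.isCompact (hΔ : IsLatticePolygon Δ) : IsCompact Δ := by
  obtain ⟨⟨T, hT, -, rfl⟩, -⟩ := hΔ
  exact hT.isCompact_convexHull ℝ

theorem IsLatticePolygon.face_inter_lattice_nonempty (hΔ : IsLatticePolygon Δ) (ν : ℝ × ℝ) :
    (face Δ ν ∩ lattice).Nonempty := by
  have h := face_nonempty hΔ.isCompact (hΔ.2.mono interior_subset) ν
  obtain ⟨⟨T, -, hT, rfl⟩, -⟩ := hΔ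
  obtain ⟨t, ht, htf⟩ := exists_mem_face_of_convexHull h
  exact ⟨t, htf, hT ht⟩

theorem IsHTransverse.boundaryPoints_eq (hΔ : IsHTransverse Δ) {a : ℕ}
    (ha : (a : ℝ) = height Δ) : 0 < a ∧ boundaryPoints Δ = 2 * a + ePlus Δ + eMinus Δ := by
  obtain ⟨t, ht⟩ := hΔ.1.face_inter_lattice_nonempty (0, 1)
  obtain ⟨b, hb⟩ := hΔ.1.face_inter_lattice_nonempty (0, -1)
  exact FloorDiagrams.boundaryPoints_eq hΔ.1.convex hΔ.1.isCompact hΔ.1.2 ht hb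
    (fun z hz h hzh => hΔ.mem_lattice_of_mem_frontier ht.1.1 hb.1.1 hz hzh) ha

theorem convex_cutTopCorner (hconv : Convex ℝ Δ) : Convex ℝ (cutTopCorner Δ p) :=
  hconv.inter (convex_halfSpace_le (f := Prod.snd) ⟨fun _ _ => rfl, fun _ _ => rfl⟩ _)

theorem isCompact_cutTopCorner (hcpt : IsCompact Δ) : IsCompact (cutTopCorner Δ p) :=
  hcpt.inter_right (isClosed_le continuous_snd continuous_const)

theorem mem_interior_cutTopCorner {z : ℝ × ℝ} (hz : z ∈ interior Δ)
    (hlt : z.2 < (p.2 : ℝ) - 2) : z ∈ interior (cutTopCorner Δ p) := by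
  have ho : IsOpen (interior Δ ∩ {x : ℝ × ℝ | x.2 < (p.2 : ℝ) - 2}) :=
    isOpen_interior.inter (isOpen_lt continuous_snd continuous_const)
  have hsub : interior Δ ∩ {x : ℝ × ℝ | x.2 < (p.2 : ℝ) - 2} ⊆ cutTopCorner Δ p :=
    fun x hx => ⟨interior_subset hx.1, le_of_lt hx.2⟩
  exact interior_maximal hsub ho ⟨hz, hlt⟩

theorem IsHTransverse.boundaryPoints_cutTopCorner_eq (hΔ : IsHTransverse Δ)
    (htop : HasTopCorner Δ p k) {a : ℕ} (ha : (a : ℝ) = height (cutTopCorner Δ p))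
    (hpos : 0 < a) :
    boundaryPoints (cutTopCorner Δ p) =
      2 * a + ePlus (cutTopCorner Δ p) + eMinus (cutTopCorner Δ p) := by
  have hconv := hΔ.1.convex
  have hcpt := hΔ.1.isCompact
  obtain ⟨b, hb⟩ := hΔ.1.face_inter_lattice_nonempty (0, -1)
  have hb' : b ∈ face (cutTopCorner Δ p) (0, -1) ∩ lattice := by
    rwa [htop.face_bottom_cut hcpt]
  have hlt : b.2 < (p.2 : ℝ) - 2 := by
    rw [height_eq htop.mem_face_top_cut hb'.1] at ha
    have : (0 : ℝ) < a := by exact_mod_cast hpos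
    simp only at ha
    linarith
  have hint : (interior (cutTopCorner Δ p)).Nonempty := by
    obtain ⟨c, hc⟩ := exists_mem_interior_snd_eq hconv hΔ.1.2 htop.1.1 hb.1.1
      (h := (b.2 + ((p.2 : ℝ) - 2)) / 2) (by linarith) (by simp only; linarith)
    exact ⟨_, mem_interior_cutTopCorner hc (by simp only; linarith)⟩
  have hq : ((p.1 : ℝ) - 2 * k, (p.2 : ℝ) - 2) ∈ lattice :=
    mem_lattice_iff.2 ⟨⟨p.1 - 2 * k, by push_cast; rfl⟩, p.2 - 2, by push_cast; rfl⟩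
  refine (FloorDiagrams.boundaryPoints_eq (convex_cutTopCorner hconv)
    (isCompact_cutTopCorner hcpt) hint ⟨htop.mem_face_top_cut, hq⟩ hb' ?_ ha).2
  intro z hz h hzh hbz hzt
  rw [(isCompact_cutTopCorner hcpt).isClosed.frontier_eq] at hz
  simp only at hzt
  refine hΔ.mem_lattice_of_mem_frontier htop.1.1 hb.1.1 ?_ hzh hbz (by simp only; linarith)
  rw [hcpt.isClosed.frontier_eq]
  exact ⟨hz.1.1, fun hi => hz.2 (mem_interior_cutTopCorner hi hzt)⟩

end

section

/-! ### The number of elements of a floor diagram -/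

variable {Δ : Set (ℝ × ℝ)} {p : ℤ × ℤ} {k : ℤ} {g : ℕ}

theorem OrientedGraph.card_E (Γ : OrientedGraph) :
    Fintype.card Γ.E = Γ.boundedEdges.card + Γ.sources.card + Γ.sinks.card := by
  classical
  have h1 : Disjoint Γ.boundedEdges Γ.sources := by
    rw [Finset.disjoint_left]
    intro e he hs
    simp only [boundedEdges, sources, Finset.mem_filter] at he hs
    exact he.2.1 hs.2
  have h2 : Disjoint (Γ.boundedEdges ∪ Γ.sources) Γ.sinks := by
    rw [Finset.disjoint_left]
    intro e he hs
    simp only [boundedEdges, sources, sinks, Finset.mem_union, Finset.mem_filter] at he hs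
    rcases he with he | he
    · exact he.2.2 hs.2
    · exact (Γ.adjacent_vertex e).elim (fun h => h he.2) fun h => h hs.2
  rw [← Finset.card_union_of_disjoint h1, ← Finset.card_union_of_disjoint h2, ← Finset.card_univ]
  congr 1
  ext e
  simp only [boundedEdges, sources, sinks, Finset.mem_union, Finset.mem_filter, Finset.mem_univ,
    true_and, true_iff]
  tauto

theorem FloorDiagram.card_V_pos (D : FloorDiagram Δ g) : 0 < Fintype.card D.V :=
  Fintype.card_pos_iff.2 D.connected.nonempty

theorem FloorDiagram.card_eq_numElements (D : FloorDiagram Δ g)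
    (h : boundaryPoints Δ = 2 * Fintype.card D.V + ePlus Δ + eMinus Δ) :
    Fintype.card D.V + Fintype.card D.E = numElements Δ g := by
  have h1 := D.card_E
  have h2 := D.genus_eq
  rw [OrientedGraph.genus, OrientedGraph.card_connectedComponent D.connected] at h2
  rw [D.card_sources, D.card_sinks] at h1
  have h3 := D.card_V_pos
  unfold numElements
  omega

theorem isPairingIndex_firstPairs {n s : ℕ} (h : 2 * s ≤ n) :
    IsPairingIndex n (firstPairs s) := by
  constructor
  · intro i hi
    simp only [firstPairs, Finset.mem_image, Finset.mem_range] at hi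
    omega
  · intro i hi hi'
    simp only [firstPairs, Finset.mem_image, Finset.mem_range] at hi hi'
    omega

theorem card_firstPairs (s : ℕ) : (firstPairs s).card = s := by
  rw [firstPairs, Finset.card_image_of_injective _ fun a b h => by simpa using h, Finset.card_range]

theorem card_insert_firstPairs {N s : ℕ} (h : 2 * s ≤ N) :
    (insert (N + 1) (firstPairs s)).card = s + 1 := by
  rw [Finset.card_insert_of_notMem, card_firstPairs]
  intro hN
  have := (isPairingIndex_firstPairs h).1 _ hN
  omega

theorem isPairingIndex_insert_firstPairs {N s : ℕ} (h : 2 * s ≤ N) :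
    IsPairingIndex (N + 2) (insert (N + 1) (firstPairs s)) := by
  have h0 := isPairingIndex_firstPairs h
  constructor
  · intro i hi
    rcases Finset.mem_insert.1 hi with rfl | hi
    · omega
    · have := h0.1 i hi
      omega
  · intro i hi hi'
    rcases Finset.mem_insert.1 hi with rfl | hi <;> rcases Finset.mem_insert.1 hi' with h' | hi'
    · omega
    · have := h0.1 _ hi'
      omega
    · have := h0.1 i hi
      omega
    · exact h0.2 i hi hi'

theorem invariant_sub_invariant (hΔ : IsHTransverse Δ) (htop : HasTopCorner Δ p k) {s : ℕ}
    (hs : s + 1 ≤ sMax Δ g) {S' S T : Finset (Finset ℕ)}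
    (hS' : IsPairing (numElements Δ g) (s + 1) S') (hS : IsPairing (numElements Δ g) s S)
    (hT : IsPairing (numElements (cutTopCorner Δ p) g) s T) :
    invariant Δ g S - invariant Δ g S' = 2 * invariant (cutTopCorner Δ p) g T := by
  have hcut := htop.topCut hΔ.1.convex hΔ.1.isCompact
  unfold sMax at hs
  obtain ⟨N, hN⟩ : ∃ N, numElements Δ g = N + 2 := ⟨numElements Δ g - 2, by omega⟩
  rw [hN] at hs hS hS'
  have hsN : 2 * s ≤ N := by omega
  have hcard : ∀ D : FloorDiagram Δ g, Fintype.card D.V + Fintype.card D.E = N + 2 := fun D =>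
    (D.card_eq_numElements (hΔ.boundaryPoints_eq D.card_V).2).trans hN
  have hcard' : ∀ D : FloorDiagram (cutTopCorner Δ p) g,
      Fintype.card D.V + Fintype.card D.E = numElements (cutTopCorner Δ p) g := fun D =>
    D.card_eq_numElements (hΔ.boundaryPoints_cutTopCorner_eq htop D.card_V D.card_V_pos)
  have hnum : ∀ _ : FloorDiagram (cutTopCorner Δ p) g,
      numElements (cutTopCorner Δ p) g = N := by
    intro D
    have h1 := hΔ.boundaryPoints_cutTopCorner_eq htop D.card_V D.card_V_pos
    have h2 := (hΔ.boundaryPoints_eq (a := Fintype.card D.V + 2)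
      (by rw [hcut.height_cut, ← D.card_V]; push_cast; rfl)).2
    have h3 := D.card_V_pos
    rw [hcut.ePlus_cut, hcut.eMinus_cut] at h1
    rw [hcut.ePlus_eq] at h2
    unfold numElements at hN ⊢
    omega
  have hinv : invariant (cutTopCorner Δ p) g T =
      ∑ c ∈ (finite_codes (cutTopCorner Δ p) g N).toFinset, codeMult N (firstPairs s) c := by
    by_cases hD : Nonempty (FloorDiagram (cutTopCorner Δ p) g)
    · obtain ⟨D⟩ := hD
      rw [hnum D] at hT
      exact invariant_eq_sum (fun D => (hcard' D).trans (hnum D)) hT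
    · have hempty : ∀ n, (finite_codes (cutTopCorner Δ p) g n).toFinset = ∅ := by
        intro n
        rw [Set.Finite.toFinset_eq_empty, Set.eq_empty_iff_forall_notMem]
        rintro c ⟨⟨D, -⟩, -⟩
        exact hD ⟨D⟩
      rw [invariant_eq_sum hcard' hT, hempty, hempty, Finset.sum_empty, Finset.sum_empty]
  rw [invariant_eq_sum hcard hS, invariant_eq_sum hcard hS', hinv,
    ← hcut.sum_codeMult_sub (isPairingIndex_firstPairs hsN),
    sum_codeMult_eq_firstPairs (isPairingIndex_insert_firstPairs hsN),
    card_insert_firstPairs hsN]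

end

end FloorDiagrams

end

theorem proposition3p7 (Δ : Set (ℝ × ℝ)) (hΔ : FloorDiagrams.IsHTransverse Δ)
    (p : ℤ × ℤ) (k : ℤ) (htop : FloorDiagrams.HasTopCorner Δ p k)
    (g s : ℕ) (hs : s + 1 ≤ FloorDiagrams.sMax Δ g)
    (S' S T : Finset (Finset ℕ))
    (hS' : FloorDiagrams.IsPairing (FloorDiagrams.numElements Δ g) (s + 1) S')
    (hS : FloorDiagrams.IsPairing (FloorDiagrams.numElements Δ g) s S)
    (hT : FloorDiagrams.IsPairing
      (FloorDiagrams.numElements (FloorDiagrams.cutTopCorner Δ p) g) s T) :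
    FloorDiagrams.invariant Δ g S' =
      FloorDiagrams.invariant Δ g S -
        2 * FloorDiagrams.invariant (FloorDiagrams.cutTopCorner Δ p) g T := by
  rw [← FloorDiagrams.invariant_sub_invariant hΔ htop hs hS' hS hT, sub_sub_cancel]
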